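/- **Setting.** Let $\{f(\cdot;\theta):\theta\in\Theta\}$, $\Theta\subset\mathbb R^p$, be strictly positive, jointly measurable probability densities with respect to a measure $\mu$, and let $\theta_0\in\Theta$. Write $S(\theta;y)=\partial\log f(y;\theta)/\partial\theta$, $I(\theta;y)=-\partial^2\log f(y;\theta)/\partial\theta\,\partial\theta^{T}$ and $\mathcal I(\theta)=E\{I(\theta;Y)\}$ for $Y\sim f(\cdot;\theta_0)$. Consider a sequence of finite populations $y_1,\dots,y_N$, i.i.d. from $f(\cdot;\theta_0)$, with inclusion probabilities $\pi_i\in(0,1]$ (possibly random and dependent on the $y_i$). From each population a Poisson sample $A$ is drawn: given the $y_i$ and $\pi_i$, the inclusion indicators are independent, $\mathrm{Ber}(\pi_i)$. Let $n=|A|$ and $w_i=\pi_i^{-1}$, and define $$l_w(\theta)=\frac1N\sum_{i\in A}w_i\log f(y_i;\theta),\qquad \hat S_w(\theta)=\frac1N\sum_{i\in A}w_iS(\theta;y_i),\qquad \hat I_w(\theta)=\frac1N\sum_{i\in A}w_iI(\theta;y_i).$$ Bootstrap weights: given $A$, draw $(N_i^*)_{i\in A}\sim\mathrm{MN}(N;(p_i)_{i\in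 A})$ with $p_i=w_i/\sum_{j\in A}w_j$; given $(N_i^*)$, draw $m_i^*\sim\mathrm{Bin}(N_i^*,\pi_i)$ independently. Put $w_i^*=w_im_i^*$ and $l_w^*(\theta)=N^{-1}\sum_{i\in A}w_i^*\log f(y_i;\theta)$. **Assumptions.** Let $\mathcal B\subset\Theta$ be compact and convex with $\theta_0$ in its interior, and suppose that no $\theta\in\mathcal B\setminus\{\theta_0\}$ has $f(\cdot;\theta)=f(\cdot;\theta_0)$ $\mu$-a.e. Suppose the following. 1. $f(y;\cdot)$ is twice continuously differentiable near every point of $\Theta$, for every $y$. 2. $\sup_{\theta\in\mathcal B}E\|S(\theta;Y)\|^6<\infty$. 3. For $\theta\in\mathcal B$, $n_0\,\mathrm{var}\{\hat S_w(\theta)\}$ converges to a positive definite matrix $\Sigma_S(\theta)$. 4. For $\theta\in\mathcal B$, $\hat I_w(\theta)\to\mathcal I(\theta)$ in probability; the entries of $I(\theta;Y)$, $\theta\in\mathcal B$, are dominated in absolute value by one integrable function of $Y$; $\mathcal I(\theta_0)$ is nonsingular. 5. $\mathrm{var}\{\hat S_w(\theta_0)\}^{-1/2}\hat S_w(\theta_0)\to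 N(0,\mathrm{Id})$ in distribution. 6. $n_0\to\infty$, $n_0/N\to0$ and $C_1\le Nn_0^{-1}\pi_i\le C_2$ almost surely, with constants $C_1,C_2>0$. Here $n_0$ is a deterministic sequence with $n_0^{-1}\sum_{i=1}^N\pi_i\to1$ in probability (for instance $n_0=\sum_{i=1}^N\pi_i$ when this sum is nonrandom). Let $\hat\theta$ be a measurable estimator that, with probability tending to one, maximizes $l_w$ over $\Theta$ and lies in $\mathcal B$. Let $\hat\theta^*$ be a function of the data and of the $m_i^*$ that, with bootstrap probability given $A$ tending to one in probability, maximizes $l_w^*$ over $\Theta$ and lies in $\mathcal B$. **Theorem 1.** Put $\Sigma_\theta=\mathcal I(\theta_0)^{-1}\Sigma_S(\theta_0)\{\mathcal I(\theta_0)^{-1}\}^{T}$. The eigenvalues $c_1,\dots,c_p$ of $\Sigma_\theta\mathcal I(\theta_0)$, counted with algebraic multiplicity, are real. Let $\mathcal G=\sum_{i=1}^pc_iZ_i^2$ with $Z_1,\dots,Z_p$ independent standard normal. Then, conditionally on $A$, the bootstrap pseudo-likelihood ratio statistic $$W^*(\hat\theta)=-2n\{l_w^*(\hat\theta)-l_w^*(\hat\theta^*)\}$$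 converges in distribution to $\mathcal G$, in probability; that is, for every bounded continuous $g:\mathbb R\to\mathbb R$, $E_*[g\{W^*(\hat\theta)\}\mid A]\to E\{g(\mathcal G)\}$ in probability, where $E_*$ is expectation with respect to the bootstrap. This is also the limit of the survey-weighted Wilks statistic: $W(\theta_0)=-2n\{l_w(\theta_0)-l_w(\hat\theta)\}\to\mathcal G$ in distribution. -/

import Mathlib

open MeasureTheory ProbabilityTheory Filter Topology Set
open scoped ENNReal NNReal BoundedContinuousFunction MatrixOrder Polynomial

noncomputable section

namespace SurveyBootstrap

variable {p N : ℕ} {𝒴 : Type*}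

/-- The superpopulation law of one observation: the measure with density `f θ` with respect to the
dominating measure `μ`. -/
def modelLaw [MeasurableSpace 𝒴] (μ : Measure 𝒴) (f : EuclideanSpace ℝ (Fin p) → 𝒴 → ℝ)
    (θ : EuclideanSpace ℝ (Fin p)) : Measure 𝒴 :=
  μ.withDensity fun y ↦ ENNReal.ofReal (f θ y)

/-- The score `S(θ; y) = ∂ log f(y; θ) / ∂θ`. -/
def score (f : EuclideanSpace ℝ (Fin p) → 𝒴 → ℝ) (θ : EuclideanSpace ℝ (Fin p)) (y : 𝒴) :
    EuclideanSpace ℝ (Fin p) :=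
  gradient (fun t ↦ Real.log (f t y)) θ

/-- `I(θ; y) = - ∂² log f(y; θ) / ∂θ ∂θᵀ`. -/
def info (f : EuclideanSpace ℝ (Fin p) → 𝒴 → ℝ) (θ : EuclideanSpace ℝ (Fin p)) (y : 𝒴) :
    Matrix (Fin p) (Fin p) ℝ :=
  Matrix.of fun a b ↦ -(fderiv ℝ (fun t ↦ score f t y a) θ (EuclideanSpace.single b 1))

/-- `𝓘(θ) = E I(θ; Y)`, the expectation being taken under the true parameter `θ₀`. -/
def expInfo [MeasurableSpace 𝒴] (μ : Measure 𝒴) (f : EuclideanSpace ℝ (Fin p) → 𝒴 → ℝ)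
    (θ₀ θ : EuclideanSpace ℝ (Fin p)) : Matrix (Fin p) (Fin p) ℝ :=
  Matrix.of fun a b ↦ ∫ y, info f θ y a b ∂(modelLaw μ f θ₀)

/-- Weighted log-likelihood `N⁻¹ ∑_{i ∈ A} vᵢ log f(yᵢ; θ)` for unit weights `v`. -/
def logLik (f : EuclideanSpace ℝ (Fin p) → 𝒴 → ℝ) (v : Fin N → ℝ) (A : Finset (Fin N))
    (y : Fin N → 𝒴) (θ : EuclideanSpace ℝ (Fin p)) : ℝ :=
  (N : ℝ)⁻¹ * ∑ i ∈ A, v i * Real.log (f θ (y i))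

/-- Weighted score `N⁻¹ ∑_{i ∈ A} vᵢ S(θ; yᵢ)`. -/
def wScore (f : EuclideanSpace ℝ (Fin p) → 𝒴 → ℝ) (v : Fin N → ℝ) (A : Finset (Fin N))
    (y : Fin N → 𝒴) (θ : EuclideanSpace ℝ (Fin p)) : EuclideanSpace ℝ (Fin p) :=
  (N : ℝ)⁻¹ • ∑ i ∈ A, v i • score f θ (y i)

/-- Weighted information `N⁻¹ ∑_{i ∈ A} vᵢ I(θ; yᵢ)`. -/
def wInfo (f : EuclideanSpace ℝ (Fin p) → 𝒴 → ℝ) (v : Fin N → ℝ) (A : Finset (Fin N))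
    (y : Fin N → 𝒴) (θ : EuclideanSpace ℝ (Fin p)) : Matrix (Fin p) (Fin p) ℝ :=
  (N : ℝ)⁻¹ • ∑ i ∈ A, v i • info f θ (y i)

/-- Sampling weights `wᵢ = πᵢ⁻¹`. -/
def designWeight (π : Fin N → ℝ) (i : Fin N) : ℝ := (π i)⁻¹

/-- Bootstrap weights `wᵢ* = wᵢ mᵢ*`. -/
def bootWeight (π : Fin N → ℝ) (m : Fin N → ℕ) (i : Fin N) : ℝ := designWeight π i * m i

/-- `-2 n {l(θ) - l(θ')}`, where `n` is the realized sample size and `l` the log-likelihood with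
weights `v`. -/
def lrStat (f : EuclideanSpace ℝ (Fin p) → 𝒴 → ℝ) (v : Fin N → ℝ) (A : Finset (Fin N))
    (y : Fin N → 𝒴) (θ θ' : EuclideanSpace ℝ (Fin p)) : ℝ :=
  -2 * (A.card : ℝ) * (logLik f v A y θ - logLik f v A y θ')

/-- The covariance matrix of a random vector. -/
def covMat {Ω : Type*} [MeasurableSpace Ω] (P : Measure Ω) (X : Ω → EuclideanSpace ℝ (Fin p)) :
    Matrix (Fin p) (Fin p) ℝ :=
  Matrix.of fun a b ↦ covariance (fun ω ↦ X ω a) (fun ω ↦ X ω b) P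

/-- `A` is a Poisson sample with inclusion probabilities `π` from the finite population `Y`: given
`(Y, π)`, the inclusion indicators are independent Bernoulli variables, the one of unit `i` with
success probability `π i`. -/
def IsPoissonSample {Ω : Type*} [MeasurableSpace Ω] [MeasurableSpace 𝒴] (P : Measure Ω)
    (Y : Ω → Fin N → 𝒴) (π : Ω → Fin N → ℝ) (A : Ω → Finset (Fin N)) : Prop :=
  ∀ s : Finset (Fin N), MeasurableSet {ω | A ω = s} ∧
    P[{ω | A ω = s}.indicator (fun _ ↦ (1 : ℝ)) |
        MeasurableSpace.comap (fun ω ↦ (Y ω, π ω)) inferInstance]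
      =ᵐ[P] fun ω ↦ ∏ i, if i ∈ s then π ω i else 1 - π ω i

/-- Selection probabilities of the first bootstrap step, proportional to `wᵢ` on the sample `A`
and zero off it. -/
def selProb (π : Fin N → ℝ) (A : Finset (Fin N)) (i : Fin N) : ℝ :=
  if i ∈ A then designWeight π i / ∑ j ∈ A, designWeight π j else 0

/-- Probability mass function of the multinomial distribution with `N` trials and cell
probabilities `q`, at a count vector `k` with `∑ kᵢ = N`. -/
def multinomialProb (q : Fin N → ℝ) (k : Fin N → ℕ) : ℝ :=
  (Nat.multinomial Finset.univ k : ℝ) * ∏ i, q i ^ k i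

/-- The bootstrap distribution, given the sample `A`, of the vector `(mᵢ*)`: draw `(Nᵢ*)` from the
multinomial distribution with `N` trials and cell probabilities `selProb`, then, given `(Nᵢ*)`,
draw the `mᵢ*` independently from the binomial distributions with `Nᵢ*` trials and success
probabilities `πᵢ`. Units outside the sample get `mᵢ* = 0`. This is a probability measure when `A`
is nonempty (with positive weights), and the zero measure when `A` is empty and `N > 0`. -/
def bootLaw (π : Fin N → ℝ) (A : Finset (Fin N)) : Measure (Fin N → ℕ) :=
  ∑ k ∈ Finset.piAntidiag Finset.univ N,
    ENNReal.ofReal (multinomialProb (selProb π A) k) •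
      Measure.pi fun i ↦ binomial (k i) (Set.projIcc 0 1 zero_le_one (π i))

end SurveyBootstrap

end

open SurveyBootstrap

/-!
The proof treats convergence in probability as convergence along a filter: `probFilter 𝓕 κ` collects
the events whose `κ i`-probability tends to one. Convergence in bootstrap probability, in
probability, is then convergence along an iterated filter, and every deterministic asymptotic
argument can be run once for the design weights and once for the bootstrap weights.

*Laws of large numbers.* By Laplace transforms and the conditional independence of the inclusion
indicators, weighted sample means `N⁻¹ ∑_{i ∈ A} wᵢ g(yᵢ)` tend to `E g(Y)` for every integrable `g`
(`IsSamplingScheme.tendsto_weighted`). The generating function of the bootstrap counts is explicit: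
it is the `N`-th power of a mixture of Bernoulli generating functions, whence the same law with the bootstrap
weights (`IsSamplingScheme.tendsto_bootstrap`).

*Expansion of the likelihood.* The second derivatives are dominated by an integrable variable, so
the law of large numbers alone yields a quadratic approximation of the weighted log-likelihood,
uniformly near `θ₀`, and, with the information inequality and compactness of `𝓑`, consistency of
maximizers (`HasWeightedLLN.eventually_isMaxOn`). Hence `W(θ₀)` is asymptotically the quadratic form
`rᵀ 𝓘⁻¹ r` in the normalized weighted score `r = √n₀ Ŝ_w(θ₀)`, and `W*(θ̂)` is asymptotically
`r*ᵀ 𝓘⁻¹ r*` with `r* = √n₀ (Ŝ_w*(θ₀) - Ŝ_w(θ₀))`.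

*Central limit theorems.* The assumed central limit theorem and the convergence of the scaled
covariance give `r → N(0, Σ_S)`. For `r*`, the conditional characteristic function tends to
`exp (- tᵀ Ĥ t / 2)` with `Ĥ = n₀ N⁻² ∑_{i ∈ A} wᵢ² S(θ₀; yᵢ) S(θ₀; yᵢ)ᵀ`, and the point is that
`Ĥ → Σ_S` in probability although the inclusion probabilities depend on the population in an
arbitrary way (`IsSamplingScheme.tendsto_condVar`): given the population, `r` is nearly normal with
variance `X`, say, in a direction, where `E X` tends to the limit variance `x`, and
`E exp (-X / 2)` tends to `exp (-x / 2)` because the unconditional limit is normal; the equality case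
of Jensen's inequality forces `X → x`.

The law of the limiting quadratic form is read off from the spectral decomposition of
`Σ_S^{1/2} 𝓘⁻¹ Σ_S^{1/2}`, which has the same characteristic polynomial as `Σ_θ 𝓘`
(`exists_eigenvalues_integral_eq`).
-/

set_option linter.unusedSectionVars false

/-! ### Convergence in probability as convergence along a filter -/

section ProbFilter

variable {ι : Type*} {M : ι → Type*} [∀ i, MeasurableSpace (M i)]

/-- The filter of events whose probability under `κ i` tends to one as `i` runs along `𝓕`. A
function on the total space tends to `c` along this filter exactly when it tends to `c` in
probability. Outer measures are used, so no measurability is needed. -/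
def probFilter (𝓕 : Filter ι) (κ : ∀ i, Measure (M i)) : Filter (Σ i, M i) where
  sets := {s | Tendsto (fun i ↦ κ i {m | (⟨i, m⟩ : Σ i, M i) ∉ s}) 𝓕 (𝓝 0)}
  univ_sets := by simpa using tendsto_const_nhds
  sets_of_superset {s t} hs hst :=
    tendsto_of_tendsto_of_tendsto_of_le_of_le tendsto_const_nhds hs (fun _ ↦ zero_le)
      fun i ↦ measure_mono fun m hm h ↦ hm (hst h)
  inter_sets {s t} hs ht := by
    have h : Tendsto (fun i ↦ κ i {m | (⟨i, m⟩ : Σ i, M i) ∉ s} +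
        κ i {m | (⟨i, m⟩ : Σ i, M i) ∉ t}) 𝓕 (𝓝 0) := by
      simpa using Tendsto.add hs ht
    refine tendsto_of_tendsto_of_tendsto_of_le_of_le tendsto_const_nhds h (fun _ ↦ zero_le)
      fun i ↦ (measure_mono ?_).trans (measure_union_le _ _)
    intro m hm
    by_contra hc
    simp only [mem_union, mem_ofPred_eq, not_or, not_not] at hc
    exact hm ⟨hc.1, hc.2⟩

variable {𝓕 : Filter ι} {κ : ∀ i, Measure (M i)}

lemma eventually_probFilter {Q : (Σ i, M i) → Prop} :
    (∀ᶠ x in probFilter 𝓕 κ, Q x) ↔ Tendsto (fun i ↦ κ i {m | ¬ Q ⟨i, m⟩}) 𝓕 (𝓝 0) := Iff.rfl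

lemma tendsto_fst_probFilter : Tendsto Sigma.fst (probFilter 𝓕 κ) 𝓕 := by
  intro s hs
  change Tendsto _ _ _
  refine tendsto_const_nhds.congr' ?_
  filter_upwards [hs] with i hi
  simp [hi]

lemma probFilter_mono {𝓖 : Filter ι} (h : 𝓕 ≤ 𝓖) : probFilter 𝓕 κ ≤ probFilter 𝓖 κ :=
  fun _ hs ↦ Tendsto.mono_left hs h

lemma eventually_probFilter_of_ae {Q : (Σ i, M i) → Prop}
    (h : ∀ᶠ i in 𝓕, ∀ᵐ m ∂(κ i), Q ⟨i, m⟩) : ∀ᶠ x in probFilter 𝓕 κ, Q x := by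
  rw [eventually_probFilter]
  refine tendsto_const_nhds.congr' ?_
  filter_upwards [h] with i hi
  exact (ae_iff.1 hi).symm

lemma tendsto_probFilter_iff_tendstoInMeasure {Ω E : Type*} [MeasurableSpace Ω]
    [PseudoEMetricSpace E] {P : Measure Ω} {X : ι → Ω → E} {c : E} :
    Tendsto (fun x : Σ _ : ι, Ω ↦ X x.1 x.2) (probFilter 𝓕 fun _ ↦ P) (𝓝 c) ↔
      TendstoInMeasure P X 𝓕 (fun _ ↦ c) := by
  rw [EMetric.tendsto_nhds]
  refine forall₂_congr fun ε _ ↦ ?_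
  rw [eventually_probFilter]
  simp only [not_lt]

/-- Bounded convergence: expectations of uniformly bounded variables converging in probability to
a constant converge to that constant. -/
lemma tendsto_integral_of_tendsto_probFilter {E : Type*} [NormedAddCommGroup E] [NormedSpace ℝ E]
    [CompleteSpace E] {X : (Σ i, M i) → E} {c : E} {B : ℝ}
    (hκ : ∀ᶠ i in 𝓕, IsProbabilityMeasure (κ i))
    (hm : ∀ᶠ i in 𝓕, AEStronglyMeasurable (fun m ↦ X ⟨i, m⟩) (κ i))
    (hB : ∀ᶠ i in 𝓕, ∀ᵐ m ∂(κ i), ‖X ⟨i, m⟩‖ ≤ B)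
    (hX : Tendsto X (probFilter 𝓕 κ) (𝓝 c)) :
    Tendsto (fun i ↦ ∫ m, X ⟨i, m⟩ ∂(κ i)) 𝓕 (𝓝 c) := by
  rw [Metric.tendsto_nhds]
  intro ε hε
  have hev : ∀ᶠ x in probFilter 𝓕 κ, ‖X x - c‖ < ε / 2 := by
    simpa [dist_eq_norm] using (Metric.tendsto_nhds.1 hX) (ε / 2) (by positivity)
  rw [eventually_probFilter] at hev
  set D : ℝ := |B| + ‖c‖ + 1 with hD
  have hDpos : 0 < D := by positivity
  have hsmall := (tendsto_order.1 hev).2 (ENNReal.ofReal (ε / (4 * D)))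
    (by simp; positivity)
  filter_upwards [hκ, hm, hB, hsmall] with i h1 h2 h3 h4
  have hint : Integrable (fun m ↦ X ⟨i, m⟩) (κ i) := Integrable.of_bound h2 B h3
  have hintn : Integrable (fun m ↦ ‖X ⟨i, m⟩ - c‖) (κ i) := (hint.sub (integrable_const c)).norm
  rw [dist_eq_norm]
  have e1 : (∫ m, X ⟨i, m⟩ ∂(κ i)) - c = ∫ m, (X ⟨i, m⟩ - c) ∂(κ i) := by
    rw [integral_sub hint (integrable_const c)]; simp
  rw [e1]
  refine (norm_integral_le_integral_norm _).trans_lt ?_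
  set S : Set (M i) := toMeasurable (κ i) {m | ¬ ‖X ⟨i, m⟩ - c‖ < ε / 2}
  have hS : MeasurableSet S := measurableSet_toMeasurable _ _
  have hSm : (κ i).real S < ε / (4 * D) := by
    rw [measureReal_def, measure_toMeasurable]
    exact (ENNReal.toReal_lt_of_lt_ofReal h4)
  have hle : ∀ᵐ m ∂(κ i), ‖X ⟨i, m⟩ - c‖ ≤ ε / 2 + S.indicator (fun _ ↦ D) m := by
    filter_upwards [h3] with m hm
    by_cases hmS : m ∈ S
    · rw [indicator_of_mem hmS]
      have := norm_sub_le (X ⟨i, m⟩) c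
      have := le_abs_self B
      linarith
    · have : ‖X ⟨i, m⟩ - c‖ < ε / 2 := by
        by_contra hc
        exact hmS (subset_toMeasurable _ _ hc)
      rw [indicator_of_notMem hmS]
      linarith
  have hI : Integrable (S.indicator fun _ ↦ D) (κ i) := (integrable_const D).indicator hS
  calc ∫ m, ‖X ⟨i, m⟩ - c‖ ∂(κ i) ≤ ∫ m, (ε / 2 + S.indicator (fun _ ↦ D) m) ∂(κ i) :=
        integral_mono_ae hintn ((integrable_const _).add hI) hle
    _ = ε / 2 + (κ i).real S * D := by
        rw [integral_add (integrable_const _) hI, integral_indicator_const _ hS]; simp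
    _ < ε := by
        have := mul_lt_mul_of_pos_right hSm hDpos
        have e : ε / (4 * D) * D = ε / 4 := by field_simp
        linarith

/-- Convergence in mean to zero implies convergence in probability to zero. -/
lemma tendsto_probFilter_of_tendsto_integral {X : (Σ i, M i) → ℝ}
    (h0 : ∀ᶠ i in 𝓕, ∀ᵐ m ∂(κ i), 0 ≤ X ⟨i, m⟩)
    (hint : ∀ᶠ i in 𝓕, Integrable (fun m ↦ X ⟨i, m⟩) (κ i))
    (hX : Tendsto (fun i ↦ ∫ m, X ⟨i, m⟩ ∂(κ i)) 𝓕 (𝓝 0)) :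
    Tendsto X (probFilter 𝓕 κ) (𝓝 0) := by
  rw [Metric.tendsto_nhds]
  intro ε hε
  have h0' : ∀ᶠ x in probFilter 𝓕 κ, 0 ≤ X x := eventually_probFilter_of_ae h0
  suffices h : ∀ᶠ x in probFilter 𝓕 κ, X x < ε by
    filter_upwards [h, h0'] with x hx hx0
    rwa [Real.dist_eq, sub_zero, abs_of_nonneg hx0]
  rw [eventually_probFilter]
  have hlim : Tendsto (fun i ↦ ENNReal.ofReal (ε⁻¹ * ∫ m, X ⟨i, m⟩ ∂(κ i))) 𝓕 (𝓝 0) := by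
    have := ENNReal.tendsto_ofReal (hX.const_mul ε⁻¹)
    simpa using this
  refine tendsto_of_tendsto_of_tendsto_of_le_of_le' tendsto_const_nhds hlim
    (Eventually.of_forall fun _ ↦ zero_le) ?_
  filter_upwards [h0, hint] with i hi hi2
  have hl := meas_ge_le_lintegral_div (μ := κ i) (f := fun m ↦ ENNReal.ofReal (X ⟨i, m⟩))
    hi2.aemeasurable.ennreal_ofReal (ε := ENNReal.ofReal ε) (by simpa using hε) (by simp)
  rw [← ofReal_integral_eq_lintegral_ofReal hi2 hi, ← ENNReal.ofReal_div_of_pos hε,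
    div_eq_inv_mul] at hl
  refine le_trans (measure_mono ?_) hl
  intro m hm
  simp only [not_lt, mem_ofPred_eq] at hm ⊢
  exact ENNReal.ofReal_le_ofReal hm

/-- A law of large numbers through Laplace transforms: if `E exp (-X) → exp (-c)` and
`E exp (-2X) → exp (-2c)`, then `E (exp (-X) - exp (-c))² → 0`, whence `X → c` in probability. -/
lemma tendsto_probFilter_of_laplace {X : (Σ i, M i) → ℝ} {c : ℝ}
    (hκ : ∀ᶠ i in 𝓕, IsProbabilityMeasure (κ i))
    (hm : ∀ᶠ i in 𝓕, AEStronglyMeasurable (fun m ↦ X ⟨i, m⟩) (κ i))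
    (h0 : ∀ᶠ i in 𝓕, ∀ᵐ m ∂(κ i), 0 ≤ X ⟨i, m⟩)
    (hL : ∀ k : ℝ, 0 < k → Tendsto (fun i ↦ ∫ m, Real.exp (-(k * X ⟨i, m⟩)) ∂(κ i)) 𝓕
      (𝓝 (Real.exp (-(k * c))))) :
    Tendsto X (probFilter 𝓕 κ) (𝓝 c) := by
  have hexpi : ∀ k : ℝ, 0 < k → ∀ᶠ i in 𝓕,
      Integrable (fun m ↦ Real.exp (-(k * X ⟨i, m⟩))) (κ i) := by
    intro k hk
    filter_upwards [hκ, hm, h0] with i h1 h2 h3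
    refine Integrable.of_bound
      (Real.continuous_exp.comp_aestronglyMeasurable (h2.const_mul k).neg) 1 ?_
    filter_upwards [h3] with m hm
    rw [Real.norm_eq_abs, abs_of_pos (Real.exp_pos _), Real.exp_le_one_iff]
    have := mul_nonneg hk.le hm
    linarith
  have hsq : ∀ i m, (Real.exp (-(1 * X ⟨i, m⟩)) - Real.exp (-(1 * c))) ^ 2 =
      Real.exp (-(2 * X ⟨i, m⟩)) - 2 * Real.exp (-(1 * c)) * Real.exp (-(1 * X ⟨i, m⟩)) +
        Real.exp (-(2 * c)) := by
    intro i m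
    have e (u : ℝ) : Real.exp (-(2 * u)) = Real.exp (-(1 * u)) ^ 2 := by
      rw [← Real.exp_nat_mul]; congr 1; push_cast; ring
    rw [e, e]; ring
  have key : Tendsto (fun x ↦ (Real.exp (-(1 * X x)) - Real.exp (-(1 * c))) ^ 2)
      (probFilter 𝓕 κ) (𝓝 0) := by
    refine tendsto_probFilter_of_tendsto_integral
      (Eventually.of_forall fun i ↦ Eventually.of_forall fun m ↦ sq_nonneg _) ?_ ?_
    · filter_upwards [hexpi 1 one_pos, hexpi 2 two_pos, hκ] with i h1 h2 h3
      simp_rw [hsq]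
      exact (h2.sub (h1.const_mul _)).add (integrable_const _)
    · have hlim := ((hL 2 two_pos).sub ((hL 1 one_pos).const_mul (2 * Real.exp (-(1 * c))))).add
        (tendsto_const_nhds (x := Real.exp (-(2 * c))))
      have e0 : Real.exp (-(2 * c)) - 2 * Real.exp (-(1 * c)) * Real.exp (-(1 * c)) +
          Real.exp (-(2 * c)) = 0 := by
        have e : Real.exp (-(2 * c)) = Real.exp (-(1 * c)) ^ 2 := by
          rw [← Real.exp_nat_mul]; congr 1; push_cast; ring
        rw [e]; ring
      rw [e0] at hlim
      refine hlim.congr' ?_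
      filter_upwards [hexpi 1 one_pos, hexpi 2 two_pos, hκ] with i h1 h2 h3
      simp_rw [hsq]
      have h12 := h1.const_mul (2 * Real.exp (-(1 * c)))
      have hI : Integrable (fun m ↦ Real.exp (-(2 * X ⟨i, m⟩)) -
          2 * Real.exp (-(1 * c)) * Real.exp (-(1 * X ⟨i, m⟩))) (κ i) := h2.sub h12
      rw [integral_add hI (integrable_const _), integral_sub h2 h12, integral_const_mul]
      simp
  have h2 : Tendsto (fun x ↦ Real.exp (-(1 * X x)) - Real.exp (-(1 * c)))
      (probFilter 𝓕 κ) (𝓝 0) := by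
    rw [tendsto_zero_iff_abs_tendsto_zero]
    have := (Real.continuous_sqrt.tendsto 0).comp key
    rw [Real.sqrt_zero] at this
    refine this.congr fun x ↦ ?_
    simp [Real.sqrt_sq_eq_abs]
  have h3 : Tendsto (fun x ↦ Real.exp (-(1 * X x))) (probFilter 𝓕 κ) (𝓝 (Real.exp (-(1 * c)))) := by
    have := h2.add_const (Real.exp (-(1 * c)))
    simpa using this
  have h4 := (h3.log (Real.exp_pos _).ne').neg
  simpa using h4

/-- To prove convergence in probability it is enough to prove it on the events where a tight
sequence of variables stays bounded. -/
lemma tendsto_probFilter_of_tight {E : Type*} [TopologicalSpace E]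
    {r : (Σ i, M i) → ℝ} {Φ : (Σ i, M i) → E} {c : E}
    (htight : ∀ ε : ℝ≥0∞, 0 < ε → ∃ K : ℝ, ∀ᶠ i in 𝓕, κ i {m | K < r ⟨i, m⟩} ≤ ε)
    (hΦ : ∀ K : ℝ, Tendsto Φ (probFilter 𝓕 κ ⊓ 𝓟 {x | r x ≤ K}) (𝓝 c)) :
    Tendsto Φ (probFilter 𝓕 κ) (𝓝 c) := by
  intro s hs
  change Tendsto _ _ _
  rw [ENNReal.tendsto_nhds_zero]
  intro ε hε
  obtain ⟨K, hK⟩ := htight (ε / 2) (ENNReal.half_pos hε.ne')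
  have h1 := hΦ K hs
  rw [mem_map, mem_inf_principal] at h1
  have h2 : Tendsto _ _ _ := h1
  rw [ENNReal.tendsto_nhds_zero] at h2
  filter_upwards [hK, h2 (ε / 2) (ENNReal.half_pos hε.ne')] with i hi1 hi2
  rw [← ENNReal.add_halves ε]
  refine le_trans (measure_mono ?_) ((measure_union_le _ _).trans (add_le_add hi2 hi1))
  intro ω hω
  simp only [mem_preimage, mem_union, mem_ofPred_eq] at hω ⊢
  by_cases h : K < r ⟨i, ω⟩
  · exact Or.inr h
  · left
    intro hc
    exact hω (hc (not_lt.1 h))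

variable {E : Type*} [NormedAddCommGroup E] [MeasurableSpace E] [BorelSpace E]

/-- Weakly convergent random variables are tight. -/
lemma exists_measure_norm_le_of_weak {γ : Measure E} [IsProbabilityMeasure γ]
    {R : (Σ i, M i) → E}
    (hκ : ∀ᶠ i in 𝓕, IsProbabilityMeasure (κ i))
    (hRm : ∀ᶠ i in 𝓕, AEMeasurable (fun m ↦ R ⟨i, m⟩) (κ i))
    (hR : ∀ h : E →ᵇ ℝ, Tendsto (fun i ↦ ∫ m, h (R ⟨i, m⟩) ∂(κ i)) 𝓕 (𝓝 (∫ z, h z ∂γ)))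
    {ε : ℝ≥0∞} (hε : 0 < ε) :
    ∃ K : ℝ, ∀ᶠ i in 𝓕, κ i {m | K < ‖R ⟨i, m⟩‖} ≤ ε := by
  obtain ⟨δ, hδ0, hδ⟩ : ∃ δ : ℝ, 0 < δ ∧ ENNReal.ofReal δ ≤ ε := by
    rcases eq_or_ne ε ∞ with rfl | h
    · exact ⟨1, one_pos, le_top⟩
    · exact ⟨ε.toReal, ENNReal.toReal_pos hε.ne' h, ENNReal.ofReal_toReal_le⟩
  -- a continuous cut-off, vanishing on the ball of radius `K` and equal to one off a larger ball
  let c : ℝ → E → ℝ := fun K z ↦ min 1 (max 0 (‖z‖ - K))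
  have hcc : ∀ K, Continuous (c K) := fun K ↦ by fun_prop
  have hc0 : ∀ K z, 0 ≤ c K z := fun K z ↦ le_min zero_le_one (le_max_left _ _)
  have hc1 : ∀ K z, c K z ≤ 1 := fun K z ↦ min_le_left _ _
  have hcb : ∀ K z, ‖c K z‖ ≤ 1 := fun K z ↦ by
    rw [Real.norm_eq_abs, abs_of_nonneg (hc0 K z)]; exact hc1 K z
  have hlim : Tendsto (fun n : ℕ ↦ ∫ z, c n z ∂γ) atTop (𝓝 0) := by
    have := tendsto_integral_of_dominated_convergence (μ := γ) (F := fun (n : ℕ) z ↦ c n z)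
      (f := fun _ ↦ 0) (fun _ ↦ 1) (fun n ↦ (hcc n).aestronglyMeasurable) (integrable_const _)
      (fun n ↦ Eventually.of_forall fun z ↦ hcb n z)
      (Eventually.of_forall fun z ↦ by
        refine tendsto_const_nhds.congr' ?_
        filter_upwards [eventually_ge_atTop ⌈‖z‖⌉₊] with n hn
        have : ‖z‖ ≤ n := (Nat.le_ceil _).trans (by exact_mod_cast hn)
        simp [c, max_eq_left (sub_nonpos.2 this)])
    simpa using this
  obtain ⟨n, hn⟩ := ((tendsto_order.1 hlim).2 δ hδ0).exists
  let h : E →ᵇ ℝ := BoundedContinuousFunction.ofNormedAddCommGroup (c n) (hcc n) 1 (hcb n)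
  refine ⟨n + 1, ?_⟩
  filter_upwards [(tendsto_order.1 (hR h)).2 δ hn, hκ, hRm] with i hi h1 h2
  have hint : Integrable (fun m ↦ c n (R ⟨i, m⟩)) (κ i) :=
    Integrable.of_bound ((hcc n).measurable.comp_aemeasurable h2).aestronglyMeasurable 1
      (Eventually.of_forall fun m ↦ hcb n _)
  have hl := meas_ge_le_lintegral_div (μ := κ i) (f := fun m ↦ ENNReal.ofReal (c n (R ⟨i, m⟩)))
    hint.aemeasurable.ennreal_ofReal (ε := 1) one_ne_zero (by simp)
  rw [← ofReal_integral_eq_lintegral_ofReal hint (Eventually.of_forall fun m ↦ hc0 n _),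
    div_one] at hl
  refine (measure_mono ?_).trans (hl.trans ((ENNReal.ofReal_le_ofReal hi.le).trans hδ))
  intro m hm
  simp only [mem_ofPred_eq] at hm ⊢
  have : c n (R ⟨i, m⟩) = 1 := min_eq_left (le_max_of_le_right (by linarith))
  simp [this]

/-- Slutsky's lemma together with the continuous mapping theorem, for variables `R` converging
weakly and variables `W` that are close to `q (R)` in probability. -/
lemma tendsto_integral_of_slutsky {F : Type*} [PseudoMetricSpace F] [MeasurableSpace F]
    [OpensMeasurableSpace F] [ProperSpace E]
    {γ : Measure E} [IsProbabilityMeasure γ] {R : (Σ i, M i) → E} {W : (Σ i, M i) → F}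
    {q : E → F} (hq : Continuous q)
    (hκ : ∀ᶠ i in 𝓕, IsProbabilityMeasure (κ i))
    (hRm : ∀ᶠ i in 𝓕, AEMeasurable (fun m ↦ R ⟨i, m⟩) (κ i))
    (hWm : ∀ᶠ i in 𝓕, AEMeasurable (fun m ↦ W ⟨i, m⟩) (κ i))
    (hR : ∀ h : E →ᵇ ℝ, Tendsto (fun i ↦ ∫ m, h (R ⟨i, m⟩) ∂(κ i)) 𝓕 (𝓝 (∫ z, h z ∂γ)))
    (hW : ∀ η : ℝ, 0 < η → ∀ᶠ x in probFilter 𝓕 κ, dist (W x) (q (R x)) ≤ η * (1 + ‖R x‖ ^ 2))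
    (g : F →ᵇ ℝ) :
    Tendsto (fun i ↦ ∫ m, g (W ⟨i, m⟩) ∂(κ i)) 𝓕 (𝓝 (∫ z, g (q z) ∂γ)) := by
  have hdiff : Tendsto (fun x ↦ g (W x) - g (q (R x))) (probFilter 𝓕 κ) (𝓝 0) := by
    refine tendsto_probFilter_of_tight (r := fun x ↦ ‖R x‖)
      (fun ε hε ↦ exists_measure_norm_le_of_weak hκ hRm hR hε) fun K ↦ ?_
    rw [Metric.tendsto_nhds]
    intro e he
    have hcomp : IsCompact (q '' Metric.closedBall 0 K) := (isCompact_closedBall 0 K).image hq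
    have huc := hcomp.uniformContinuousAt_of_continuousAt g
      (fun a _ ↦ g.continuous.continuousAt) (Metric.dist_mem_uniformity he)
    obtain ⟨δ, hδ, hδs⟩ := Metric.mem_uniformity_dist.1 huc
    rw [eventually_inf_principal]
    filter_upwards [hW (δ / (2 * (1 + K ^ 2))) (by positivity)] with x hx hxK
    have hxK' : ‖R x‖ ≤ K := hxK
    have hb : dist (q (R x)) (W x) < δ := by
      rw [dist_comm]
      have h2 : ‖R x‖ ^ 2 ≤ K ^ 2 := pow_le_pow_left₀ (norm_nonneg _) hxK' 2
      calc dist (W x) (q (R x)) ≤ δ / (2 * (1 + K ^ 2)) * (1 + ‖R x‖ ^ 2) := hx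
        _ ≤ δ / (2 * (1 + K ^ 2)) * (1 + K ^ 2) := by gcongr
        _ = δ / 2 := by field_simp
        _ < δ := by linarith
    have := hδs hb (mem_image_of_mem q (by simpa using hxK'))
    rw [dist_zero_right, ← dist_eq_norm, dist_comm]
    exact this
  let gq : E →ᵇ ℝ := g.compContinuous ⟨q, hq⟩
  have hgW : ∀ᶠ i in 𝓕, AEStronglyMeasurable (fun m ↦ g (W ⟨i, m⟩)) (κ i) := by
    filter_upwards [hWm] with i hi
    exact (g.continuous.measurable.comp_aemeasurable hi).aestronglyMeasurable
  have hgR : ∀ᶠ i in 𝓕, AEStronglyMeasurable (fun m ↦ gq (R ⟨i, m⟩)) (κ i) := by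
    filter_upwards [hRm] with i hi
    exact (gq.continuous.measurable.comp_aemeasurable hi).aestronglyMeasurable
  have h1 := tendsto_integral_of_tendsto_probFilter (B := 2 * ‖g‖) hκ
    (by filter_upwards [hgW, hgR] with i h1 h2 using h1.sub h2)
    (Eventually.of_forall fun i ↦ Eventually.of_forall fun m ↦ by
      have h1 := g.norm_coe_le_norm (W ⟨i, m⟩)
      have h2 := g.norm_coe_le_norm (q (R ⟨i, m⟩))
      have := norm_sub_le (g (W ⟨i, m⟩)) (g (q (R ⟨i, m⟩)))
      linarith) hdiff
  have h2 := h1.add (hR gq)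
  rw [zero_add] at h2
  refine h2.congr' ?_
  filter_upwards [hgW, hgR, hκ] with i h1 h2 h3
  have i1 : Integrable (fun m ↦ g (W ⟨i, m⟩)) (κ i) :=
    Integrable.of_bound h1 ‖g‖ (Eventually.of_forall fun m ↦ g.norm_coe_le_norm _)
  have i2 : Integrable (fun m ↦ g (q (R ⟨i, m⟩))) (κ i) :=
    Integrable.of_bound h2 ‖g‖ (Eventually.of_forall fun m ↦ g.norm_coe_le_norm _)
  change ∫ m, (g (W ⟨i, m⟩) - g (q (R ⟨i, m⟩))) ∂(κ i) + ∫ m, g (q (R ⟨i, m⟩)) ∂(κ i) = _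
  rw [integral_sub i1 i2, sub_add_cancel]

end ProbFilter

/-! ### Elementary inequalities -/

section Inequalities

lemma norm_prod_sub_prod_le {ι : Type*} (s : Finset ι) (a b : ι → ℂ) (ha : ∀ i ∈ s, ‖a i‖ ≤ 1)
    (hb : ∀ i ∈ s, ‖b i‖ ≤ 1) : ‖∏ i ∈ s, a i - ∏ i ∈ s, b i‖ ≤ ∑ i ∈ s, ‖a i - b i‖ := by
  classical
  induction s using Finset.induction_on with
  | empty => simp
  | insert j s hj ih =>
    rw [Finset.prod_insert hj, Finset.prod_insert hj, Finset.sum_insert hj]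
    have h1 := ih (fun i hi ↦ ha i (Finset.mem_insert_of_mem hi))
      (fun i hi ↦ hb i (Finset.mem_insert_of_mem hi))
    have h2 : ‖∏ i ∈ s, b i‖ ≤ 1 := by
      rw [norm_prod]
      exact Finset.prod_le_one (fun i _ ↦ norm_nonneg _)
        fun i hi ↦ hb i (Finset.mem_insert_of_mem hi)
    have h3 : ‖a j‖ ≤ 1 := ha j (Finset.mem_insert_self _ _)
    calc ‖a j * ∏ i ∈ s, a i - b j * ∏ i ∈ s, b i‖
        = ‖a j * (∏ i ∈ s, a i - ∏ i ∈ s, b i) + (a j - b j) * ∏ i ∈ s, b i‖ := by ring_nf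
      _ ≤ ‖a j‖ * ‖∏ i ∈ s, a i - ∏ i ∈ s, b i‖ + ‖a j - b j‖ * ‖∏ i ∈ s, b i‖ := by
        refine (norm_add_le _ _).trans ?_
        rw [norm_mul, norm_mul]
      _ ≤ 1 * ‖∏ i ∈ s, a i - ∏ i ∈ s, b i‖ + ‖a j - b j‖ * 1 := by gcongr
      _ ≤ _ := by linarith

lemma norm_pow_sub_pow_le {a b : ℂ} (ha : ‖a‖ ≤ 1) (hb : ‖b‖ ≤ 1) (n : ℕ) :
    ‖a ^ n - b ^ n‖ ≤ n * ‖a - b‖ := by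
  simpa using norm_prod_sub_prod_le (Finset.range n) (fun _ ↦ a) (fun _ ↦ b)
    (fun _ _ ↦ ha) (fun _ _ ↦ hb)

lemma abs_exp_neg_sub_le {u : ℝ} (hu : 0 ≤ u) :
    |1 - Real.exp (-u) - u| ≤ min u (u ^ 2) := by
  have h1 : 1 - u ≤ Real.exp (-u) := Real.one_sub_le_exp_neg u
  have h2 : Real.exp (-u) ≤ 1 := Real.exp_le_one_iff.2 (by linarith)
  rw [abs_of_nonpos (by linarith)]
  refine le_min (by linarith) ?_
  rcases le_or_gt u 1 with h | h
  · have := (abs_le.1 (Real.abs_exp_sub_one_sub_id_le (x := -u) (by simpa [abs_of_nonneg hu]))).2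
    nlinarith
  · nlinarith

lemma norm_exp_sub_one_sub_le {ζ : ℂ} (h : ζ.re ≤ 0) :
    ‖Complex.exp ζ - 1 - ζ‖ ≤ 3 * ‖ζ‖ ^ 2 := by
  rcases le_or_gt ‖ζ‖ 1 with h1 | h1
  · have := Complex.norm_exp_sub_one_sub_id_le h1
    nlinarith [sq_nonneg ‖ζ‖]
  · have h2 : ‖Complex.exp ζ‖ ≤ 1 := by rw [Complex.norm_exp]; exact Real.exp_le_one_iff.2 h
    calc ‖Complex.exp ζ - 1 - ζ‖ ≤ ‖Complex.exp ζ - 1‖ + ‖ζ‖ := norm_sub_le _ _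
      _ ≤ ‖Complex.exp ζ‖ + ‖(1 : ℂ)‖ + ‖ζ‖ := by gcongr; exact norm_sub_le _ _
      _ ≤ 3 * ‖ζ‖ ^ 2 := by rw [norm_one]; nlinarith

lemma norm_exp_mul_I_sub_le (u : ℝ) :
    ‖Complex.exp (u * Complex.I) - 1 - u * Complex.I‖ ≤ 3 * u ^ 2 := by
  have := norm_exp_sub_one_sub_le (ζ := u * Complex.I) (by simp)
  simpa using this

lemma norm_exp_mul_I_sub_sub_le (u : ℝ) :
    ‖Complex.exp (u * Complex.I) - 1 - (u * Complex.I - (u : ℂ) ^ 2 / 2)‖ ≤ 4 * |u| ^ 3 := by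
  have hn : ‖(u : ℂ) * Complex.I‖ = |u| := by simp
  rcases le_or_gt |u| 1 with h1 | h1
  · have := Complex.exp_bound (x := u * Complex.I) (by rw [hn]; exact h1) (n := 3) (by norm_num)
    rw [hn] at this
    have e : ∑ m ∈ Finset.range 3, ((u : ℂ) * Complex.I) ^ m / (m.factorial : ℂ) =
        1 + (u * Complex.I - (u : ℂ) ^ 2 / 2) := by
      simp [Finset.sum_range_succ, mul_pow]; ring
    rw [e, ← sub_sub] at this
    refine this.trans ?_
    have : 0 ≤ |u| ^ 3 := by positivity
    norm_num [Nat.factorial]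
    linarith
  · have h2 : ‖Complex.exp (u * Complex.I)‖ = 1 := Complex.norm_exp_ofReal_mul_I u
    calc ‖Complex.exp (u * Complex.I) - 1 - (u * Complex.I - (u : ℂ) ^ 2 / 2)‖
        ≤ ‖Complex.exp (u * Complex.I)‖ + ‖(1 : ℂ)‖ + (‖(u : ℂ) * Complex.I‖ +
            ‖(u : ℂ) ^ 2 / 2‖) := by
          refine (norm_sub_le _ _).trans (add_le_add (norm_sub_le _ _) (norm_sub_le _ _))
      _ = 1 + 1 + (|u| + |u| ^ 2 / 2) := by rw [h2, hn]; simp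
      _ ≤ 4 * |u| ^ 3 := by
        have h3 : |u| ≤ |u| ^ 3 := by nlinarith [sq_nonneg |u|]
        have h4 : |u| ^ 2 ≤ |u| ^ 3 := by nlinarith [sq_nonneg |u|]
        linarith

end Inequalities

/-! ### Poisson sampling -/

section PoissonDesign

/-- The probability of the sample `s` under Poisson sampling with inclusion probabilities `π`. -/
def designProb {N : ℕ} (π : Fin N → ℝ) (s : Finset (Fin N)) : ℝ :=
  ∏ i, if i ∈ s then π i else 1 - π i

variable {N : ℕ} {π : Fin N → ℝ}

lemma designProb_nonneg (h0 : ∀ i, 0 ≤ π i) (h1 : ∀ i, π i ≤ 1) (s : Finset (Fin N)) :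
    0 ≤ designProb π s := by
  refine Finset.prod_nonneg fun i _ ↦ ?_
  split_ifs
  · exact h0 i
  · linarith [h1 i]

lemma designProb_le_one (h0 : ∀ i, 0 ≤ π i) (h1 : ∀ i, π i ≤ 1) (s : Finset (Fin N)) :
    designProb π s ≤ 1 := by
  refine Finset.prod_le_one (fun i _ ↦ ?_) fun i _ ↦ ?_
  · split_ifs
    · exact h0 i
    · linarith [h1 i]
  · split_ifs
    · exact h1 i
    · linarith [h0 i]

lemma sum_designProb_smul_prod (z : Fin N → ℂ) :
    ∑ s, designProb π s • ∏ i ∈ s, z i = ∏ i, (1 - (π i : ℂ) + π i * z i) := by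
  have h : ∀ i, 1 - (π i : ℂ) + π i * z i = π i * z i + (1 - π i) := fun i ↦ by ring
  simp_rw [h]
  rw [Finset.prod_add, Finset.powerset_univ]
  refine Finset.sum_congr rfl fun s _ ↦ ?_
  have e : (designProb π s : ℂ) = (∏ i ∈ s, (π i : ℂ)) * ∏ i ∈ Finset.univ \ s, (1 - (π i : ℂ)) := by
    rw [designProb, Finset.prod_ite]
    push_cast
    congr 1
    · exact Finset.prod_congr (by ext; simp) fun _ _ ↦ rfl
    · exact Finset.prod_congr (by ext; simp) fun _ _ ↦ rfl
  rw [Complex.real_smul, e, Finset.prod_mul_distrib]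
  ring

/-- Expectation over the Poisson samples from a subpopulation `t`, the device for inductions over
the units. -/
def designSum {ι : Type*} [DecidableEq ι] (π : ι → ℝ) (t : Finset ι) (φ : Finset ι → ℝ) : ℝ :=
  ∑ s ∈ t.powerset, (∏ i ∈ t, if i ∈ s then π i else 1 - π i) * φ s

lemma designSum_insert {ι : Type*} [DecidableEq ι] (π : ι → ℝ) {t : Finset ι} {j : ι} (hj : j ∉ t)
    (φ : Finset ι → ℝ) : designSum π (insert j t) φ =
      (1 - π j) * designSum π t φ + π j * designSum π t fun s ↦ φ (insert j s) := by
  unfold designSum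
  rw [Finset.sum_powerset_insert hj, Finset.mul_sum, Finset.mul_sum]
  congr 1
  · refine Finset.sum_congr rfl fun s hs ↦ ?_
    have hjs : j ∉ s := fun h ↦ hj (Finset.mem_powerset.1 hs h)
    rw [Finset.prod_insert hj, if_neg hjs]; ring
  · refine Finset.sum_congr rfl fun s hs ↦ ?_
    rw [Finset.prod_insert hj, if_pos (Finset.mem_insert_self _ _), mul_assoc]
    congr 2
    refine Finset.prod_congr rfl fun i hi ↦ ?_
    have hij : i ≠ j := fun h ↦ hj (h ▸ hi)
    simp [Finset.mem_insert, hij]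

lemma designSum_moments {ι : Type*} [DecidableEq ι] (π b : ι → ℝ) (t : Finset ι) :
    designSum π t (fun _ ↦ 1) = 1 ∧ designSum π t (fun s ↦ ∑ i ∈ s, b i) = ∑ i ∈ t, π i * b i ∧
      designSum π t (fun s ↦ (∑ i ∈ s, b i) ^ 2) =
        (∑ i ∈ t, π i * b i) ^ 2 + ∑ i ∈ t, π i * (1 - π i) * b i ^ 2 := by
  have hlin : ∀ (t : Finset ι) (φ ψ : Finset ι → ℝ) (c : ℝ),
      designSum π t (fun s ↦ c * φ s + ψ s) = c * designSum π t φ + designSum π t ψ := by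
    intro t φ ψ c
    unfold designSum
    rw [Finset.mul_sum, ← Finset.sum_add_distrib]
    exact Finset.sum_congr rfl fun s _ ↦ by ring
  have hcongr : ∀ (t : Finset ι) (φ ψ : Finset ι → ℝ), (∀ s ⊆ t, φ s = ψ s) →
      designSum π t φ = designSum π t ψ := fun t φ ψ h ↦
    Finset.sum_congr rfl fun s hs ↦ by rw [h s (Finset.mem_powerset.1 hs)]
  induction t using Finset.induction_on with
  | empty => simp [designSum]
  | insert j t hj ih =>
    obtain ⟨h1, h2, h3⟩ := ih
    have hs : ∀ s ⊆ t, ∑ i ∈ insert j s, b i = b j * 1 + ∑ i ∈ s, b i := fun s hs ↦ by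
      rw [Finset.sum_insert fun h ↦ hj (hs h), mul_one]
    refine ⟨?_, ?_, ?_⟩
    · rw [designSum_insert π hj, h1]; ring
    · rw [designSum_insert π hj, hcongr t _ _ hs, hlin, h1, h2, Finset.sum_insert hj]; ring
    · have hs2 : ∀ s ⊆ t, (∑ i ∈ insert j s, b i) ^ 2 =
          b j ^ 2 * 1 + (2 * b j * (∑ i ∈ s, b i) + (∑ i ∈ s, b i) ^ 2) := fun s h ↦ by
        rw [hs s h]; ring
      rw [designSum_insert π hj, hcongr t _ _ hs2, hlin, hlin, h1, h2, h3, Finset.sum_insert hj,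
        Finset.sum_insert hj]
      ring

lemma sum_designProb_mul_sum (b : Fin N → ℝ) :
    ∑ s, designProb π s * ∑ i ∈ s, b i = ∑ i, π i * b i := by
  simpa [designSum, designProb] using (designSum_moments π b Finset.univ).2.1

lemma sum_designProb_mul_sum_sq (b : Fin N → ℝ) :
    ∑ s, designProb π s * (∑ i ∈ s, b i) ^ 2 =
      (∑ i, π i * b i) ^ 2 + ∑ i, π i * (1 - π i) * b i ^ 2 := by
  simpa [designSum, designProb] using (designSum_moments π b Finset.univ).2.2

end PoissonDesign

section PoissonSample

variable {N : ℕ} {𝒴 Ω : Type*} [MeasurableSpace 𝒴] [MeasurableSpace Ω] {P : Measure Ω}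
  [IsProbabilityMeasure P] {Y : Ω → Fin N → 𝒴} {π : Ω → Fin N → ℝ} {A : Ω → Finset (Fin N)}

/-- A statistic of the sample is measurable when it is so for every fixed value of the sample. -/
lemma measurable_sample {E : Type*} [MeasurableSpace E] (hA : ∀ s, MeasurableSet {ω | A ω = s})
    {F : Ω → Finset (Fin N) → E} (hF : ∀ s, Measurable fun ω ↦ F ω s) :
    Measurable fun ω ↦ F ω (A ω) := by
  intro B hB
  have : (fun ω ↦ F ω (A ω)) ⁻¹' B = ⋃ s, {ω | A ω = s} ∩ (fun ω ↦ F ω s) ⁻¹' B := by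
    ext ω
    simp
  rw [this]
  exact MeasurableSet.iUnion fun s ↦ (hA s).inter (hF s hB)

/-- On the event that the sample is `s`, the law of the population and of the inclusion
probabilities has the design probability of `s` as density. -/
lemma map_restrict_sample_eq (hY : Measurable Y) (hπ : Measurable π)
    (hπ01 : ∀ᵐ ω ∂P, ∀ i, 0 < π ω i ∧ π ω i ≤ 1) (hA : IsPoissonSample P Y π A)
    (s : Finset (Fin N)) :
    (P.restrict {ω | A ω = s}).map (fun ω ↦ (Y ω, π ω)) =
      (P.map fun ω ↦ (Y ω, π ω)).withDensity fun x ↦ ENNReal.ofReal (designProb x.2 s) := by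
  have hX : Measurable fun ω ↦ (Y ω, π ω) := hY.prodMk hπ
  have hd : Measurable fun x : (Fin N → 𝒴) × (Fin N → ℝ) ↦ designProb x.2 s := by
    unfold designProb
    refine Finset.measurable_prod _ fun i _ ↦ ?_
    split_ifs <;> fun_prop
  obtain ⟨hAs, hce⟩ := hA s
  ext B hB
  rw [Measure.map_apply hX hB, Measure.restrict_apply (hX hB), withDensity_apply _ hB,
    setLIntegral_map hB hd.ennreal_ofReal hX]
  have hBm : MeasurableSet[MeasurableSpace.comap (fun ω ↦ (Y ω, π ω)) inferInstance]
      ((fun ω ↦ (Y ω, π ω)) ⁻¹' B) := ⟨B, hB, rfl⟩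
  have hint : Integrable ({ω | A ω = s}.indicator fun _ ↦ (1 : ℝ)) P :=
    (integrable_const _).indicator hAs
  have h1 := setIntegral_condExp hX.comap_le hint hBm
  have hpos : ∀ᵐ ω ∂P, 0 ≤ designProb (π ω) s ∧ designProb (π ω) s ≤ 1 := by
    filter_upwards [hπ01] with ω hω
    exact ⟨designProb_nonneg (fun i ↦ (hω i).1.le) (fun i ↦ (hω i).2) s,
      designProb_le_one (fun i ↦ (hω i).1.le) (fun i ↦ (hω i).2) s⟩
  have h2 : ∫ ω in (fun ω ↦ (Y ω, π ω)) ⁻¹' B, designProb (π ω) s ∂P =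
      P.real ((fun ω ↦ (Y ω, π ω)) ⁻¹' B ∩ {ω | A ω = s}) := by
    rw [integral_indicator hAs] at h1
    have hce' : ∀ᵐ ω ∂P, P[{ω | A ω = s}.indicator fun _ ↦ (1 : ℝ) |
        MeasurableSpace.comap (fun ω ↦ (Y ω, π ω)) inferInstance] ω = designProb (π ω) s := hce
    rw [← setIntegral_congr_ae (hX hB) (hce'.mono fun ω h _ ↦ h), h1,
      Measure.restrict_restrict hAs]
    simp [inter_comm]
  rw [← ofReal_integral_eq_lintegral_ofReal _ (ae_restrict_of_ae (hpos.mono fun ω h ↦ h.1)), h2,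
    measureReal_def, ENNReal.ofReal_toReal (measure_ne_top _ _)]
  refine Integrable.of_bound (hd.comp hX).aestronglyMeasurable 1 (ae_restrict_of_ae ?_)
  filter_upwards [hpos] with ω hω
  rw [Real.norm_eq_abs, abs_of_nonneg hω.1]
  exact hω.2

/-- Expectations under Poisson sampling are obtained by averaging over the design. -/
lemma integral_sample_eq {E : Type*} [NormedAddCommGroup E] [NormedSpace ℝ E] [CompleteSpace E]
    [MeasurableSpace E] [BorelSpace E] [SecondCountableTopology E]
    (hY : Measurable Y) (hπ : Measurable π)
    (hπ01 : ∀ᵐ ω ∂P, ∀ i, 0 < π ω i ∧ π ω i ≤ 1) (hA : IsPoissonSample P Y π A)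
    {F : (Fin N → 𝒴) × (Fin N → ℝ) → Finset (Fin N) → E} (hF : ∀ s, Measurable fun x ↦ F x s)
    (hint : ∀ s, Integrable (fun ω ↦ F (Y ω, π ω) s) P) :
    ∫ ω, F (Y ω, π ω) (A ω) ∂P = ∫ ω, ∑ s, designProb (π ω) s • F (Y ω, π ω) s ∂P := by
  have hX : Measurable fun ω ↦ (Y ω, π ω) := hY.prodMk hπ
  have hd : ∀ s, Measurable fun x : (Fin N → 𝒴) × (Fin N → ℝ) ↦ designProb x.2 s := by
    intro s
    unfold designProb
    refine Finset.measurable_prod _ fun i _ ↦ ?_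
    split_ifs <;> fun_prop
  have hpos : ∀ᵐ ω ∂P, ∀ s, 0 ≤ designProb (π ω) s ∧ designProb (π ω) s ≤ 1 := by
    filter_upwards [hπ01] with ω hω s
    exact ⟨designProb_nonneg (fun i ↦ (hω i).1.le) (fun i ↦ (hω i).2) s,
      designProb_le_one (fun i ↦ (hω i).1.le) (fun i ↦ (hω i).2) s⟩
  have h1 : ∀ ω, F (Y ω, π ω) (A ω) =
      ∑ s, ({ω | A ω = s}.indicator (fun ω ↦ F (Y ω, π ω) s)) ω := by
    intro ω
    rw [Finset.sum_eq_single (A ω)]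
    · simp
    · intro s _ hs
      exact indicator_of_notMem (fun h ↦ hs h.symm) _
    · simp
  have hds : ∀ s, Integrable (fun ω ↦ designProb (π ω) s • F (Y ω, π ω) s) P := by
    intro s
    refine Integrable.mono (hint s)
      (((hd s).comp hX).smul ((hF s).comp hX)).aestronglyMeasurable ?_
    filter_upwards [hpos] with ω hω
    rw [norm_smul, Real.norm_eq_abs, abs_of_nonneg (hω s).1]
    exact mul_le_of_le_one_left (norm_nonneg _) (hω s).2
  simp_rw [h1]
  rw [integral_finsetSum _ fun s _ ↦ (hint s).indicator (hA s).1,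
    integral_finsetSum _ fun s _ ↦ hds s]
  refine Finset.sum_congr rfl fun s _ ↦ ?_
  rw [integral_indicator (hA s).1]
  have h2 : ∫ ω in {ω | A ω = s}, F (Y ω, π ω) s ∂P =
      ∫ x, F x s ∂((P.restrict {ω | A ω = s}).map fun ω ↦ (Y ω, π ω)) :=
    (integral_map hX.aemeasurable (hF s).aestronglyMeasurable).symm
  rw [h2, map_restrict_sample_eq hY hπ hπ01 hA s,
    integral_withDensity_eq_integral_toReal_smul (hd s).ennreal_ofReal
      (Eventually.of_forall fun _ ↦ ENNReal.ofReal_lt_top),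
    integral_map hX.aemeasurable (show AEStronglyMeasurable (fun x ↦
      (ENNReal.ofReal (designProb x.2 s)).toReal • F x s) _ from
      ((hd s).ennreal_ofReal.ennreal_toReal.smul (hF s)).aestronglyMeasurable)]
  refine integral_congr_ae ?_
  filter_upwards [hpos] with ω hω
  simp only [ENNReal.toReal_ofReal (hω s).1]

/-- The generating function of a Poisson sample. -/
lemma integral_prod_sample (hY : Measurable Y) (hπ : Measurable π)
    (hπ01 : ∀ᵐ ω ∂P, ∀ i, 0 < π ω i ∧ π ω i ≤ 1) (hA : IsPoissonSample P Y π A)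
    {z : Fin N → (Fin N → 𝒴) × (Fin N → ℝ) → ℂ} (hz : ∀ i, Measurable (z i))
    (hz1 : ∀ᵐ ω ∂P, ∀ i, ‖z i (Y ω, π ω)‖ ≤ 1) :
    ∫ ω, ∏ i ∈ A ω, z i (Y ω, π ω) ∂P =
      ∫ ω, ∏ i, (1 - (π ω i : ℂ) + π ω i * z i (Y ω, π ω)) ∂P := by
  have hm : ∀ s : Finset (Fin N), Measurable fun x ↦ ∏ i ∈ s, z i x := fun s ↦
    Finset.measurable_prod _ fun i _ ↦ hz i
  rw [integral_sample_eq hY hπ hπ01 hA (F := fun x s ↦ ∏ i ∈ s, z i x) hm]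
  · simp_rw [sum_designProb_smul_prod]
  · intro s
    refine Integrable.of_bound ((hm s).comp (hY.prodMk hπ)).aestronglyMeasurable 1 ?_
    filter_upwards [hz1] with ω hω
    rw [norm_prod]
    exact Finset.prod_le_one (fun i _ ↦ norm_nonneg _) fun i _ ↦ hω i

end PoissonSample

/-! ### Laws of large numbers for the population and for the sample -/

section LawOfLargeNumbers

variable {𝒴 Ω : Type*} [MeasurableSpace 𝒴] [MeasurableSpace Ω]

/-- A sequence of i.i.d. populations with law `ρ`, sampled by Poisson sampling with inclusion
probabilities of exact order `n₀ / N`, in the regime of a vanishing sampling fraction. -/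
structure IsSamplingScheme (ρ : Measure 𝒴) (P : Measure Ω) (N : ℕ → ℕ) (n₀ : ℕ → ℝ)
    (Y : (ν : ℕ) → Ω → Fin (N ν) → 𝒴) (π : (ν : ℕ) → Ω → Fin (N ν) → ℝ)
    (A : (ν : ℕ) → Ω → Finset (Fin (N ν))) : Prop where
  measurable_Y : ∀ ν, Measurable (Y ν)
  measurable_π : ∀ ν, Measurable (π ν)
  iid : ∀ ν, P.map (Y ν) = Measure.pi fun _ ↦ ρ
  prob : ∀ ν, ∀ᵐ ω ∂P, ∀ i, 0 < π ν ω i ∧ π ν ω i ≤ 1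
  sample : ∀ ν, IsPoissonSample P (Y ν) (π ν) (A ν)
  tendsto_n₀ : Tendsto n₀ atTop atTop
  tendsto_fraction : Tendsto (fun ν ↦ n₀ ν / N ν) atTop (𝓝 0)
  tendsto_sum : TendstoInMeasure P (fun ν ω ↦ (∑ i, π ν ω i) / n₀ ν) atTop (fun _ ↦ 1)
  bounds : ∃ C₁ C₂ : ℝ, 0 < C₁ ∧ 0 < C₂ ∧ ∀ ν, ∀ᵐ ω ∂P, ∀ i,
      C₁ ≤ N ν * (n₀ ν)⁻¹ * π ν ω i ∧ N ν * (n₀ ν)⁻¹ * π ν ω i ≤ C₂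

/-- Convergence along this filter is convergence in `P`-probability of a sequence of variables. -/
abbrev inProb (P : Measure Ω) : Filter (Σ _ : ℕ, Ω) := probFilter atTop fun _ : ℕ ↦ P

/-- Laplace transforms of averages of `n` i.i.d. nonnegative integrable variables. -/
lemma tendsto_laplace_pow {ρ : Measure 𝒴} [IsProbabilityMeasure ρ] {g : 𝒴 → ℝ}
    (hg0 : ∀ y, 0 ≤ g y) (hg : Integrable g ρ) :
    Tendsto (fun n : ℕ ↦ (∫ y, Real.exp (-(g y / n)) ∂ρ) ^ n) atTop
      (𝓝 (Real.exp (-∫ y, g y ∂ρ))) := by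
  have hexp : ∀ n : ℕ, Integrable (fun y ↦ Real.exp (-(g y / n))) ρ := fun n ↦ by
    refine Integrable.of_bound
      (Real.measurable_exp.comp_aemeasurable (hg.aemeasurable.div_const _).neg).aestronglyMeasurable 1
      (Eventually.of_forall fun y ↦ ?_)
    rw [Real.norm_eq_abs, abs_of_pos (Real.exp_pos _), Real.exp_le_one_iff]
    have := div_nonneg (hg0 y) (Nat.cast_nonneg (α := ℝ) n)
    linarith
  have hlim : Tendsto (fun n : ℕ ↦ ∫ y, (n : ℝ) * (Real.exp (-(g y / n)) - 1) ∂ρ) atTop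
      (𝓝 (∫ y, -g y ∂ρ)) := by
    refine tendsto_integral_of_dominated_convergence g
      (fun n ↦ (((hexp n).sub (integrable_const 1)).const_mul (n : ℝ)).1) hg ?_ ?_
    · intro n
      refine Eventually.of_forall fun y ↦ ?_
      rcases Nat.eq_zero_or_pos n with rfl | hn
      · simpa using hg0 y
      have hn' : (0 : ℝ) < n := by exact_mod_cast hn
      have h0 := div_nonneg (hg0 y) hn'.le
      have h1 := Real.one_sub_le_exp_neg (g y / n)
      have h2 : Real.exp (-(g y / n)) ≤ 1 := Real.exp_le_one_iff.2 (by linarith)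
      rw [Real.norm_eq_abs, abs_mul, abs_of_pos hn', abs_of_nonpos (by linarith)]
      calc (n : ℝ) * -(Real.exp (-(g y / n)) - 1) ≤ n * (g y / n) := by gcongr; linarith
        _ = g y := by field_simp
    · refine Eventually.of_forall fun y ↦ ?_
      rw [← tendsto_sub_nhds_zero_iff]
      have hz : Tendsto (fun n : ℕ ↦ g y ^ 2 / (n : ℝ)) atTop (𝓝 0) :=
        tendsto_const_div_atTop_nhds_zero_nat _
      refine squeeze_zero_norm' ?_ hz
      filter_upwards [eventually_gt_atTop 0] with n hn
      have hn' : (0 : ℝ) < n := by exact_mod_cast hn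
      have h := (abs_exp_neg_sub_le (div_nonneg (hg0 y) hn'.le)).trans (min_le_right _ _)
      have e : (n : ℝ) * (Real.exp (-(g y / n)) - 1) - -g y =
          -(n * (1 - Real.exp (-(g y / n)) - g y / n)) := by field_simp; ring
      rw [e, norm_neg, Real.norm_eq_abs, abs_mul, abs_of_pos hn']
      calc (n : ℝ) * |1 - Real.exp (-(g y / n)) - g y / n| ≤ n * (g y / n) ^ 2 := by gcongr
        _ = g y ^ 2 / n := by field_simp
  rw [integral_neg] at hlim
  have := Real.tendsto_one_add_pow_exp_of_tendsto
    (g := fun n ↦ (∫ y, Real.exp (-(g y / n)) ∂ρ) - 1) (hlim.congr fun n ↦ by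
      rw [integral_const_mul, integral_sub (hexp n) (integrable_const 1)]; simp)
  simpa using this

/-- If a nonnegative quantity is dominated, as soon as a diverging scale `m` exceeds `M`, by a
weighted average `T` of `g min (1, K g / M)`, and if `T` satisfies a law of large numbers, then the
quantity tends to zero. -/
lemma tendsto_zero_of_truncation {Z : Type*} {𝓕 : Filter Z} {ρ : Measure 𝒴} {g : 𝒴 → ℝ}
    (hgm : Measurable g) (hg0 : ∀ y, 0 ≤ g y) (hg : Integrable g ρ) (T : (𝒴 → ℝ) → Z → ℝ)
    (hT : ∀ h : 𝒴 → ℝ, Measurable h → (∀ y, 0 ≤ h y) → Integrable h ρ →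
      Tendsto (T h) 𝓕 (𝓝 (∫ y, h y ∂ρ)))
    {m : Z → ℝ} (hm : Tendsto m 𝓕 atTop) {K : ℝ} (hK : 0 ≤ K) {U : Z → ℝ}
    (hU0 : ∀ᶠ z in 𝓕, 0 ≤ U z)
    (hU : ∀ M : ℝ, 0 < M → ∀ᶠ z in 𝓕, M ≤ m z →
      U z ≤ T (fun y ↦ g y * min 1 (K / M * g y)) z) :
    Tendsto U 𝓕 (𝓝 0) := by
  have hmeas : ∀ M : ℝ, Measurable fun y ↦ g y * min 1 (K / M * g y) := fun M ↦ by fun_prop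
  have hbd : ∀ M : ℝ, 0 < M → ∀ y, 0 ≤ g y * min 1 (K / M * g y) ∧
      g y * min 1 (K / M * g y) ≤ g y := fun M hM y ↦ by
    have h1 : 0 ≤ min 1 (K / M * g y) := le_min zero_le_one (by have := hg0 y; positivity)
    exact ⟨mul_nonneg (hg0 y) h1, mul_le_of_le_one_right (hg0 y) (min_le_left _ _)⟩
  have hint : ∀ M : ℝ, 0 < M → Integrable (fun y ↦ g y * min 1 (K / M * g y)) ρ := fun M hM ↦
    hg.mono' (hmeas M).aestronglyMeasurable (Eventually.of_forall fun y ↦ by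
      rw [Real.norm_eq_abs, abs_of_nonneg (hbd M hM y).1]; exact (hbd M hM y).2)
  have hlim : Tendsto (fun n : ℕ ↦ ∫ y, g y * min 1 (K / ((n : ℝ) + 1) * g y) ∂ρ) atTop
      (𝓝 0) := by
    have := tendsto_integral_of_dominated_convergence (μ := ρ)
      (F := fun (n : ℕ) y ↦ g y * min 1 (K / ((n : ℝ) + 1) * g y)) (f := fun _ ↦ 0) g
      (fun n ↦ (hmeas _).aestronglyMeasurable) hg
      (fun n ↦ Eventually.of_forall fun y ↦ by
        have hb := hbd ((n : ℝ) + 1) (by positivity) y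
        rw [Real.norm_eq_abs, abs_of_nonneg hb.1]; exact hb.2)
      (Eventually.of_forall fun y ↦ by
        have h1 : Tendsto (fun n : ℕ ↦ K / ((n : ℝ) + 1)) atTop (𝓝 0) :=
          tendsto_const_nhds.div_atTop
            (tendsto_atTop_add_const_right _ _ tendsto_natCast_atTop_atTop)
        have h2 := ((tendsto_const_nhds (x := (1 : ℝ))).min (h1.mul_const (g y))).const_mul (g y)
        simpa using h2)
    simpa using this
  rw [tendsto_order]
  refine ⟨fun a ha ↦ hU0.mono fun z hz ↦ ha.trans_le hz, fun a ha ↦ ?_⟩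
  obtain ⟨n, hn⟩ := ((tendsto_order.1 hlim).2 a ha).exists
  have hn0 : (0 : ℝ) < (n : ℝ) + 1 := by positivity
  filter_upwards [hU _ hn0, hm.eventually_ge_atTop ((n : ℝ) + 1),
    (tendsto_order.1 (hT _ (hmeas _) (fun y ↦ (hbd _ hn0 y).1) (hint _ hn0))).2 a hn]
    with z h1 h2 h3
  exact (h1 h2).trans_lt h3

namespace IsSamplingScheme

variable {ρ : Measure 𝒴} {P : Measure Ω} [IsProbabilityMeasure ρ] [IsProbabilityMeasure P]
  {N : ℕ → ℕ} {n₀ : ℕ → ℝ} {Y : (ν : ℕ) → Ω → Fin (N ν) → 𝒴} {π : (ν : ℕ) → Ω → Fin (N ν) → ℝ}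
  {A : (ν : ℕ) → Ω → Finset (Fin (N ν))}

lemma measurable_pair (S : IsSamplingScheme ρ P N n₀ Y π A) (ν : ℕ) :
    Measurable fun ω ↦ (Y ν ω, π ν ω) := (S.measurable_Y ν).prodMk (S.measurable_π ν)

lemma measurePreserving_unit (S : IsSamplingScheme ρ P N n₀ Y π A) (ν : ℕ) (i : Fin (N ν)) :
    MeasurePreserving (fun ω ↦ Y ν ω i) P ρ := by
  have h : MeasurePreserving (Y ν) P (Measure.pi fun _ ↦ ρ) := ⟨S.measurable_Y ν, S.iid ν⟩
  exact (measurePreserving_eval (fun _ : Fin (N ν) ↦ ρ) i).comp h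

lemma ae_units (S : IsSamplingScheme ρ P N n₀ Y π A) {Q : 𝒴 → Prop} (hQ : ∀ᵐ y ∂ρ, Q y) (ν : ℕ) :
    ∀ᵐ ω ∂P, ∀ i, Q (Y ν ω i) := by
  rw [ae_all_iff]
  exact fun i ↦ (S.measurePreserving_unit ν i).quasiMeasurePreserving.ae hQ

/-- The population sizes are eventually positive, since `∑ᵢ πᵢ / n₀ → 1`. -/
lemma eventually_pos_N (S : IsSamplingScheme ρ P N n₀ Y π A) : ∀ᶠ ν in atTop, 0 < N ν := by
  have h := (tendstoInMeasure_iff_dist.1 S.tendsto_sum) 1 one_pos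
  filter_upwards [(tendsto_order.1 h).2 1 one_pos] with ν hν
  by_contra h0
  have hN : N ν = 0 := by omega
  have : IsEmpty (Fin (N ν)) := by rw [hN]; infer_instance
  simp at hν

lemma eventually_pos_n₀ (S : IsSamplingScheme ρ P N n₀ Y π A) : ∀ᶠ ν in atTop, 0 < n₀ ν :=
  S.tendsto_n₀.eventually_gt_atTop 0

lemma tendsto_N (S : IsSamplingScheme ρ P N n₀ Y π A) : Tendsto N atTop atTop := by
  rw [← tendsto_natCast_atTop_iff (R := ℝ)]
  refine tendsto_atTop_mono' _ ?_ S.tendsto_n₀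
  filter_upwards [S.eventually_pos_N, S.eventually_pos_n₀,
    (tendsto_order.1 S.tendsto_fraction).2 1 one_pos] with ν h1 h2 h3
  have : (0 : ℝ) < N ν := by exact_mod_cast h1
  rw [div_lt_one this] at h3
  exact h3.le

/-- The law of large numbers for nonnegative functions of the population units. -/
lemma tendsto_mean_of_nonneg (S : IsSamplingScheme ρ P N n₀ Y π A) {g : 𝒴 → ℝ}
    (hgm : Measurable g) (hg0 : ∀ y, 0 ≤ g y) (hg : Integrable g ρ) :
    Tendsto (fun x : Σ _ : ℕ, Ω ↦ (N x.1 : ℝ)⁻¹ * ∑ i, g (Y x.1 x.2 i)) (inProb P)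
      (𝓝 (∫ y, g y ∂ρ)) := by
  have hmeas : ∀ ν, Measurable fun ω ↦ (N ν : ℝ)⁻¹ * ∑ i, g (Y ν ω i) := fun ν ↦
    (Finset.measurable_sum _ fun i _ ↦
      hgm.comp ((measurable_pi_apply i).comp (S.measurable_Y ν))).const_mul _
  refine tendsto_probFilter_of_laplace (Eventually.of_forall fun _ ↦ inferInstance)
    (Eventually.of_forall fun ν ↦ (hmeas ν).aestronglyMeasurable)
    (Eventually.of_forall fun ν ↦ Eventually.of_forall fun ω ↦
      mul_nonneg (by positivity) (Finset.sum_nonneg fun i _ ↦ hg0 _)) fun k hk ↦ ?_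
  have h := (tendsto_laplace_pow (g := fun y ↦ k * g y) (fun y ↦ mul_nonneg hk.le (hg0 y))
    (hg.const_mul k)).comp S.tendsto_N
  rw [integral_const_mul] at h
  refine h.congr fun ν ↦ ?_
  have e : ∀ ω, Real.exp (-(k * ((N ν : ℝ)⁻¹ * ∑ i, g (Y ν ω i)))) =
      ∏ i, Real.exp (-(k * g (Y ν ω i) / N ν)) := fun ω ↦ by
    rw [← Real.exp_sum]
    congr 1
    rw [Finset.mul_sum, Finset.mul_sum, ← Finset.sum_neg_distrib]
    exact Finset.sum_congr rfl fun i _ ↦ by ring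
  simp_rw [e]
  have h2 := integral_map (μ := P) (S.measurable_Y ν).aemeasurable
    (f := fun y : Fin (N ν) → 𝒴 ↦ ∏ i, Real.exp (-(k * g (y i) / N ν)))
    (Measurable.aestronglyMeasurable (by
      refine Finset.measurable_prod _ fun i _ ↦ ?_
      have := hgm.comp (measurable_pi_apply (X := fun _ ↦ 𝒴) i)
      exact Real.measurable_exp.comp ((this.const_mul k).div_const _).neg))
  rw [S.iid ν, integral_fintype_prod_eq_pow (𝕜 := ℝ)
    (fun y ↦ Real.exp (-(k * g y / N ν))), Fintype.card_fin] at h2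
  exact h2

lemma ae_inProb {Q : (Σ _ : ℕ, Ω) → Prop} (h : ∀ ν, ∀ᵐ ω ∂P, Q ⟨ν, ω⟩) :
    ∀ᶠ x in inProb P, Q x := eventually_probFilter_of_ae (Eventually.of_forall h)

lemma eventually_prob (S : IsSamplingScheme ρ P N n₀ Y π A) :
    ∀ᶠ x in inProb P, ∀ i, 0 < π x.1 x.2 i ∧ π x.1 x.2 i ≤ 1 :=
  ae_inProb (Q := fun x ↦ ∀ i, 0 < π x.1 x.2 i ∧ π x.1 x.2 i ≤ 1) S.prob

lemma eventually_fst {Q : ℕ → Prop} (h : ∀ᶠ ν in atTop, Q ν) : ∀ᶠ x in inProb P, Q x.1 :=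
  tendsto_fst_probFilter.eventually h

/-- A law of large numbers for sums over the sample of small nonnegative terms depending on the
population and on the inclusion probabilities. -/
lemma tendsto_sum_sample (S : IsSamplingScheme ρ P N n₀ Y π A)
    {a : ∀ ν, Fin (N ν) → (Fin (N ν) → 𝒴) × (Fin (N ν) → ℝ) → ℝ} {c : ℝ}
    (ha : ∀ ν i, Measurable (a ν i)) (h0 : ∀ ν, ∀ᵐ ω ∂P, ∀ i, 0 ≤ a ν i (Y ν ω, π ν ω))
    (h1 : Tendsto (fun x : Σ _ : ℕ, Ω ↦ ∑ i, π x.1 x.2 i * a x.1 i (Y x.1 x.2, π x.1 x.2))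
      (inProb P) (𝓝 c))
    (h2 : Tendsto (fun x : Σ _ : ℕ, Ω ↦ ∑ i, π x.1 x.2 i *
      min (a x.1 i (Y x.1 x.2, π x.1 x.2)) (a x.1 i (Y x.1 x.2, π x.1 x.2) ^ 2))
      (inProb P) (𝓝 0)) :
    Tendsto (fun x : Σ _ : ℕ, Ω ↦ ∑ i ∈ A x.1 x.2, a x.1 i (Y x.1 x.2, π x.1 x.2)) (inProb P)
      (𝓝 c) := by
  have hmeas : ∀ ν, Measurable fun ω ↦ ∑ i ∈ A ν ω, a ν i (Y ν ω, π ν ω) := fun ν ↦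
    measurable_sample (F := fun ω s ↦ ∑ i ∈ s, a ν i (Y ν ω, π ν ω)) (fun s ↦ (S.sample ν s).1)
      fun s ↦ Finset.measurable_sum _ fun i _ ↦ (ha ν i).comp (S.measurable_pair ν)
  refine tendsto_probFilter_of_laplace (Eventually.of_forall fun _ ↦ inferInstance)
    (Eventually.of_forall fun ν ↦ (hmeas ν).aestronglyMeasurable)
    (Eventually.of_forall fun ν ↦ (h0 ν).mono fun ω hω ↦ Finset.sum_nonneg fun i _ ↦ hω i)
    fun k hk ↦ ?_
  -- the conditional Laplace transform, given the population
  let Z : (Σ _ : ℕ, Ω) → ℂ := fun x ↦ ∏ i, (1 - (π x.1 x.2 i : ℂ) + π x.1 x.2 i *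
    (Real.exp (-(k * a x.1 i (Y x.1 x.2, π x.1 x.2))) : ℂ))
  have hcoef : ∀ ν, ∀ᵐ ω ∂P, ∀ i, ‖1 - (π ν ω i : ℂ) + π ν ω i *
      (Real.exp (-(k * a ν i (Y ν ω, π ν ω))) : ℂ)‖ ≤ 1 := by
    intro ν
    filter_upwards [S.prob ν, h0 ν] with ω hπ ha i
    have e1 : Real.exp (-(k * a ν i (Y ν ω, π ν ω))) ≤ 1 :=
      Real.exp_le_one_iff.2 (by have := mul_nonneg hk.le (ha i); linarith)
    have e0 := (Real.exp_pos (-(k * a ν i (Y ν ω, π ν ω)))).le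
    have hp := hπ i
    rw [show 1 - (π ν ω i : ℂ) + π ν ω i * (Real.exp (-(k * a ν i (Y ν ω, π ν ω))) : ℂ) =
      ((1 - π ν ω i + π ν ω i * Real.exp (-(k * a ν i (Y ν ω, π ν ω))) : ℝ) : ℂ) by push_cast; ring,
      Complex.norm_real, Real.norm_eq_abs, abs_of_nonneg
        (by have := mul_nonneg hp.1.le e0; linarith)]
    have := mul_le_mul_of_nonneg_left e1 hp.1.le
    linarith
  have hZlim : Tendsto Z (inProb P) (𝓝 (Real.exp (-(k * c)) : ℂ)) := by
    have hE : Tendsto (fun x : Σ _ : ℕ, Ω ↦ ((Real.exp (-(k * ∑ i, π x.1 x.2 i *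
        a x.1 i (Y x.1 x.2, π x.1 x.2))) : ℝ) : ℂ)) (inProb P) (𝓝 (Real.exp (-(k * c)) : ℂ)) :=
      (Complex.continuous_ofReal.tendsto _).comp
        ((Real.continuous_exp.tendsto _).comp (h1.const_mul k).neg)
    refine tendsto_of_tendsto_of_dist hE ?_
    have hb := h2.const_mul (2 * (k + k ^ 2))
    rw [mul_zero] at hb
    refine squeeze_zero' (Eventually.of_forall fun _ ↦ dist_nonneg) ?_ hb
    filter_upwards [S.eventually_prob, ae_inProb (Q := fun x ↦ ∀ i, 0 ≤ a x.1 i (Y x.1 x.2, π x.1 x.2)) h0,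
      ae_inProb (Q := fun x ↦
      ∀ i, ‖1 - (π x.1 x.2 i : ℂ) + π x.1 x.2 i *
        (Real.exp (-(k * a x.1 i (Y x.1 x.2, π x.1 x.2))) : ℂ)‖ ≤ 1) hcoef] with x hπ ha hc
    rw [dist_comm, dist_eq_norm]
    have e : ((Real.exp (-(k * ∑ i, π x.1 x.2 i * a x.1 i (Y x.1 x.2, π x.1 x.2))) : ℝ) : ℂ) =
        ∏ i, ((Real.exp (-(k * (π x.1 x.2 i * a x.1 i (Y x.1 x.2, π x.1 x.2)))) : ℝ) : ℂ) := by
      rw [← Complex.ofReal_prod, ← Real.exp_sum, Finset.mul_sum, Finset.sum_neg_distrib]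
    rw [e, Finset.mul_sum]
    refine (norm_prod_sub_prod_le _ _ _ (fun i _ ↦ hc i) fun i _ ↦ ?_).trans
      (Finset.sum_le_sum fun i _ ↦ ?_)
    · rw [Complex.norm_real, Real.norm_eq_abs, abs_of_pos (Real.exp_pos _), Real.exp_le_one_iff]
      have := mul_nonneg hk.le (mul_nonneg (hπ i).1.le (ha i))
      linarith
    · obtain ⟨hp0, hp1⟩ := hπ i
      have ha0 := ha i
      change 0 ≤ a x.1 i (Y x.1 x.2, π x.1 x.2) at ha0
      generalize a x.1 i (Y x.1 x.2, π x.1 x.2) = u at ha0 ⊢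
      change 0 < π x.1 x.2 i at hp0
      change π x.1 x.2 i ≤ 1 at hp1
      generalize π x.1 x.2 i = q at hp0 hp1 ⊢
      rw [show 1 - (q : ℂ) + q * (Real.exp (-(k * u)) : ℂ) - (Real.exp (-(k * (q * u))) : ℂ) =
        (((1 - Real.exp (-(k * (q * u))) - k * (q * u)) -
          q * (1 - Real.exp (-(k * u)) - k * u) : ℝ) : ℂ) by push_cast; ring, Complex.norm_real,
        Real.norm_eq_abs]
      have t1 := abs_exp_neg_sub_le (u := k * (q * u)) (by positivity)
      have t2 := abs_exp_neg_sub_le (u := k * u) (by positivity)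
      have hmin : min (k * u) ((k * u) ^ 2) ≤ (k + k ^ 2) * min u (u ^ 2) := by
        rcases le_total u (u ^ 2) with h | h
        · rw [min_eq_left h]
          refine (min_le_left _ _).trans ?_
          nlinarith [mul_nonneg (sq_nonneg k) ha0]
        · rw [min_eq_right h]
          refine (min_le_right _ _).trans ?_
          nlinarith [mul_nonneg hk.le (sq_nonneg u)]
      have hmin2 : min (k * (q * u)) ((k * (q * u)) ^ 2) ≤ q * min (k * u) ((k * u) ^ 2) := by
        rw [mul_min_of_nonneg _ _ hp0.le]
        refine min_le_min (by nlinarith) ?_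
        have : (k * (q * u)) ^ 2 = q * (q * (k * u) ^ 2) := by ring
        rw [this]
        exact mul_le_mul_of_nonneg_left (mul_le_of_le_one_left (sq_nonneg _) hp1) hp0.le
      have t3 := abs_sub (1 - Real.exp (-(k * (q * u))) - k * (q * u))
        (q * (1 - Real.exp (-(k * u)) - k * u))
      rw [abs_mul, abs_of_pos hp0] at t3
      have t4 := mul_le_mul_of_nonneg_left t2 hp0.le
      have t5 := mul_le_mul_of_nonneg_left hmin hp0.le
      linarith
  have hZm : ∀ ν, Measurable fun ω ↦ Z ⟨ν, ω⟩ := fun ν ↦ by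
    change Measurable fun ω ↦ ∏ i : Fin (N ν), (1 - (π ν ω i : ℂ) + π ν ω i *
      (Real.exp (-(k * a ν i (Y ν ω, π ν ω))) : ℂ))
    refine Finset.measurable_prod _ fun i _ ↦ ?_
    have hp : Measurable fun ω ↦ (π ν ω i : ℂ) :=
      Complex.measurable_ofReal.comp ((measurable_pi_apply i).comp (S.measurable_π ν))
    exact (measurable_const.sub hp).add (hp.mul (Complex.measurable_ofReal.comp
      (Real.measurable_exp.comp (((ha ν i).comp (S.measurable_pair ν)).const_mul k).neg)))
  have hlim := tendsto_integral_of_tendsto_probFilter (B := 1)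
    (Eventually.of_forall fun _ ↦ inferInstance)
    (Eventually.of_forall fun ν ↦ (hZm ν).aestronglyMeasurable)
    (Eventually.of_forall fun ν ↦ (hcoef ν).mono fun ω hω ↦ by
      rw [norm_prod]
      exact Finset.prod_le_one (fun i _ ↦ norm_nonneg _) fun i _ ↦ hω i) hZlim
  have hre := (Complex.continuous_re.tendsto _).comp hlim
  rw [Complex.ofReal_re] at hre
  refine hre.congr fun ν ↦ ?_
  have hform := integral_prod_sample (S.measurable_Y ν) (S.measurable_π ν) (S.prob ν) (S.sample ν)
    (z := fun i x ↦ ((Real.exp (-(k * a ν i x)) : ℝ) : ℂ))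
    (fun i ↦ Complex.measurable_ofReal.comp (Real.measurable_exp.comp ((ha ν i).const_mul k).neg))
    (by
      filter_upwards [h0 ν] with ω hω i
      rw [Complex.norm_real, Real.norm_eq_abs, abs_of_pos (Real.exp_pos _), Real.exp_le_one_iff]
      have := mul_nonneg hk.le (hω i)
      linarith)
  change (∫ ω, Z ⟨ν, ω⟩ ∂P).re = _
  rw [← hform]
  have e : ∀ ω, ∏ i ∈ A ν ω, ((Real.exp (-(k * a ν i (Y ν ω, π ν ω))) : ℝ) : ℂ) =
      ((Real.exp (-(k * ∑ i ∈ A ν ω, a ν i (Y ν ω, π ν ω))) : ℝ) : ℂ) := fun ω ↦ by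
    rw [← Complex.ofReal_prod, ← Real.exp_sum, Finset.mul_sum, Finset.sum_neg_distrib]
  simp_rw [e]
  rw [integral_complex_ofReal, Complex.ofReal_re]

end IsSamplingScheme

end LawOfLargeNumbers

/-! ### Weighted averages over the sample -/

section WeightedAverages

namespace IsSamplingScheme

variable {𝒴 Ω : Type*} [MeasurableSpace 𝒴] [MeasurableSpace Ω]
  {ρ : Measure 𝒴} {P : Measure Ω} [IsProbabilityMeasure ρ] [IsProbabilityMeasure P]
  {N : ℕ → ℕ} {n₀ : ℕ → ℝ} {Y : (ν : ℕ) → Ω → Fin (N ν) → 𝒴} {π : (ν : ℕ) → Ω → Fin (N ν) → ℝ}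
  {A : (ν : ℕ) → Ω → Finset (Fin (N ν))}

/-- The sampling weights are of order at most `N / n₀`. -/
lemma exists_weight_bound (S : IsSamplingScheme ρ P N n₀ Y π A) :
    ∃ C : ℝ, 0 < C ∧ ∀ᶠ ν in atTop, ∀ᵐ ω ∂P, ∀ i,
      0 ≤ (π ν ω i)⁻¹ ∧ n₀ ν * (N ν : ℝ)⁻¹ * (π ν ω i)⁻¹ ≤ C := by
  obtain ⟨C₁, C₂, h1, h2, hb⟩ := S.bounds
  refine ⟨C₁⁻¹, inv_pos.2 h1, ?_⟩
  filter_upwards [S.eventually_pos_n₀, S.eventually_pos_N] with ν hn hN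
  filter_upwards [hb ν, S.prob ν] with ω hω hp i
  have hN' : (0 : ℝ) < N ν := by exact_mod_cast hN
  refine ⟨(inv_pos.2 (hp i).1).le, ?_⟩
  have e : n₀ ν * (N ν : ℝ)⁻¹ * (π ν ω i)⁻¹ = (N ν * (n₀ ν)⁻¹ * π ν ω i)⁻¹ := by
    rw [mul_inv, mul_inv, inv_inv]; ring
  rw [e]
  exact inv_anti₀ h1 (hω i).1

/-- The law of large numbers for sample averages of `rᵢ wᵢ g(yᵢ)`, where the bounded factors `rᵢ`
may depend on the population and on the inclusion probabilities. -/
lemma tendsto_weighted_of_nonneg (S : IsSamplingScheme ρ P N n₀ Y π A) {g : 𝒴 → ℝ}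
    (hgm : Measurable g) (hg0 : ∀ y, 0 ≤ g y) (hg : Integrable g ρ)
    {r : ∀ ν, Fin (N ν) → (Fin (N ν) → 𝒴) × (Fin (N ν) → ℝ) → ℝ} {B c : ℝ}
    (hr : ∀ ν i, Measurable (r ν i)) (hB : 0 ≤ B) (hr0 : ∀ ν, ∀ᵐ ω ∂P, ∀ i, 0 ≤ r ν i (Y ν ω, π ν ω))
    (hrB : ∀ᶠ ν in atTop, ∀ᵐ ω ∂P, ∀ i, r ν i (Y ν ω, π ν ω) ≤ B)
    (h : Tendsto (fun x : Σ _ : ℕ, Ω ↦ (N x.1 : ℝ)⁻¹ * ∑ i, r x.1 i (Y x.1 x.2, π x.1 x.2) *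
      g (Y x.1 x.2 i)) (inProb P) (𝓝 c)) :
    Tendsto (fun x : Σ _ : ℕ, Ω ↦ (N x.1 : ℝ)⁻¹ * ∑ i ∈ A x.1 x.2,
      r x.1 i (Y x.1 x.2, π x.1 x.2) * (designWeight (π x.1 x.2) i * g (Y x.1 x.2 i)))
      (inProb P) (𝓝 c) := by
  obtain ⟨C, hC, hCb⟩ := S.exists_weight_bound
  let a : ∀ ν, Fin (N ν) → (Fin (N ν) → 𝒴) × (Fin (N ν) → ℝ) → ℝ :=
    fun ν i x ↦ (N ν : ℝ)⁻¹ * (r ν i x * ((x.2 i)⁻¹ * g (x.1 i)))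
  have ha : ∀ ν i, Measurable (a ν i) := fun ν i ↦ by
    have h1 : Measurable fun x : (Fin (N ν) → 𝒴) × (Fin (N ν) → ℝ) ↦ g (x.1 i) :=
      hgm.comp ((measurable_pi_apply i).comp measurable_fst)
    have h2 : Measurable fun x : (Fin (N ν) → 𝒴) × (Fin (N ν) → ℝ) ↦ (x.2 i)⁻¹ :=
      ((measurable_pi_apply i).comp measurable_snd).inv
    exact ((hr ν i).mul (h2.mul h1)).const_mul _
  have ha0 : ∀ ν, ∀ᵐ ω ∂P, ∀ i, 0 ≤ a ν i (Y ν ω, π ν ω) := fun ν ↦ by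
    filter_upwards [S.prob ν, hr0 ν] with ω hp hr i
    exact mul_nonneg (by positivity) (mul_nonneg (hr i) (mul_nonneg (inv_pos.2 (hp i).1).le (hg0 _)))
  have hcancel : ∀ᶠ x in inProb P, ∀ i, π x.1 x.2 i * a x.1 i (Y x.1 x.2, π x.1 x.2) =
      (N x.1 : ℝ)⁻¹ * (r x.1 i (Y x.1 x.2, π x.1 x.2) * g (Y x.1 x.2 i)) := by
    filter_upwards [S.eventually_prob] with x hx i
    have := (hx i).1.ne'
    simp only [a]
    field_simp
  have key := S.tendsto_sum_sample (a := a) (c := c) ha ha0 ?_ ?_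
  · refine key.congr fun x ↦ ?_
    rw [Finset.mul_sum]
    rfl
  · refine h.congr' ?_
    filter_upwards [hcancel] with x hx
    rw [Finset.mul_sum]
    exact Finset.sum_congr rfl fun i _ ↦ (hx i).symm
  · have hrB' : ∀ᶠ x in inProb P, ∀ i, r x.1 i (Y x.1 x.2, π x.1 x.2) ≤ B :=
      eventually_probFilter_of_ae (Q := fun x : Σ _ : ℕ, Ω ↦
        ∀ i, r x.1 i (Y x.1 x.2, π x.1 x.2) ≤ B) hrB
    have hr0' : ∀ᶠ x in inProb P, ∀ i, 0 ≤ r x.1 i (Y x.1 x.2, π x.1 x.2) :=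
      ae_inProb (Q := fun x : Σ _ : ℕ, Ω ↦ ∀ i, 0 ≤ r x.1 i (Y x.1 x.2, π x.1 x.2)) hr0
    have ha0' : ∀ᶠ x in inProb P, ∀ i, 0 ≤ a x.1 i (Y x.1 x.2, π x.1 x.2) :=
      ae_inProb (Q := fun x : Σ _ : ℕ, Ω ↦ ∀ i, 0 ≤ a x.1 i (Y x.1 x.2, π x.1 x.2)) ha0
    have hCb' : ∀ᶠ x in inProb P, ∀ i, 0 ≤ (π x.1 x.2 i)⁻¹ ∧
        n₀ x.1 * (N x.1 : ℝ)⁻¹ * (π x.1 x.2 i)⁻¹ ≤ C :=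
      eventually_probFilter_of_ae (Q := fun x : Σ _ : ℕ, Ω ↦ ∀ i, 0 ≤ (π x.1 x.2 i)⁻¹ ∧
        n₀ x.1 * (N x.1 : ℝ)⁻¹ * (π x.1 x.2 i)⁻¹ ≤ C) hCb
    refine tendsto_zero_of_truncation (ρ := ρ) (g := fun y ↦ B * g y) (by fun_prop)
      (fun y ↦ mul_nonneg hB (hg0 y)) (hg.const_mul B)
      (fun (h : 𝒴 → ℝ) (x : Σ _ : ℕ, Ω) ↦ (N x.1 : ℝ)⁻¹ * ∑ i, h (Y x.1 x.2 i))
      (fun h hm h0 hi ↦ S.tendsto_mean_of_nonneg hm h0 hi)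
      (m := fun x ↦ n₀ x.1) (S.tendsto_n₀.comp tendsto_fst_probFilter) hC.le ?_ fun M hM ↦ ?_
    · filter_upwards [S.eventually_prob, ha0'] with x hp h0
      exact Finset.sum_nonneg fun i _ ↦ mul_nonneg (hp i).1.le (le_min (h0 i) (sq_nonneg _))
    · filter_upwards [S.eventually_prob, ha0', hr0', hrB', hCb', hcancel] with x hp h0 hr hrb hw hc hMx
      rw [Finset.mul_sum]
      refine Finset.sum_le_sum fun i _ ↦ ?_
      have e1 : π x.1 x.2 i * min (a x.1 i (Y x.1 x.2, π x.1 x.2))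
          (a x.1 i (Y x.1 x.2, π x.1 x.2) ^ 2) = (π x.1 x.2 i * a x.1 i (Y x.1 x.2, π x.1 x.2)) *
          min 1 (a x.1 i (Y x.1 x.2, π x.1 x.2)) := by
        rw [mul_assoc, mul_min_of_nonneg _ _ (h0 i), mul_one, sq]
      rw [e1, hc i, mul_assoc]
      have hb1 : r x.1 i (Y x.1 x.2, π x.1 x.2) * g (Y x.1 x.2 i) ≤ B * g (Y x.1 x.2 i) :=
        mul_le_mul_of_nonneg_right (hrb i) (hg0 _)
      have hb2 : a x.1 i (Y x.1 x.2, π x.1 x.2) ≤ C / M * (B * g (Y x.1 x.2 i)) := by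
        have hw' : (N x.1 : ℝ)⁻¹ * (π x.1 x.2 i)⁻¹ ≤ C / M := by
          rw [le_div_iff₀ hM]
          refine le_trans ?_ (hw i).2
          rw [mul_comm, mul_assoc]
          exact mul_le_mul_of_nonneg_right hMx (mul_nonneg (by positivity) (hw i).1)
        calc a x.1 i (Y x.1 x.2, π x.1 x.2)
            = ((N x.1 : ℝ)⁻¹ * (π x.1 x.2 i)⁻¹) *
              (r x.1 i (Y x.1 x.2, π x.1 x.2) * g (Y x.1 x.2 i)) := by simp only [a]; ring
          _ ≤ C / M * (B * g (Y x.1 x.2 i)) :=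
            mul_le_mul hw' hb1 (mul_nonneg (hr i) (hg0 _)) (by positivity)
      refine mul_le_mul_of_nonneg_left ?_ (by positivity)
      exact mul_le_mul hb1 (min_le_min le_rfl hb2) (le_min zero_le_one (h0 i))
        (mul_nonneg hB (hg0 _))

/-- Decompose an integrable function, up to a null set of units, into two nonnegative measurable
ones, to pass from laws of large numbers for nonnegative functions to the general ones. -/
lemma tendsto_of_nonneg_measurable {Z : Type*} {𝓕 : Filter Z} (T : (𝒴 → ℝ) → Z → ℝ)
    (hsub : ∀ g h : 𝒴 → ℝ, ∀ z, T (fun y ↦ g y - h y) z = T g z - T h z)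
    (hae : ∀ g h : 𝒴 → ℝ, g =ᵐ[ρ] h → T g =ᶠ[𝓕] T h)
    (hT : ∀ h : 𝒴 → ℝ, Measurable h → (∀ y, 0 ≤ h y) → Integrable h ρ →
      Tendsto (T h) 𝓕 (𝓝 (∫ y, h y ∂ρ)))
    {g : 𝒴 → ℝ} (hg : Integrable g ρ) : Tendsto (T g) 𝓕 (𝓝 (∫ y, g y ∂ρ)) := by
  obtain ⟨g', hg'm, hgg'⟩ := hg.aemeasurable
  have hg' : Integrable g' ρ := hg.congr hgg'
  have h1 := hT (fun y ↦ max (g' y) 0) (by fun_prop) (fun y ↦ le_max_right _ _) hg'.pos_part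
  have h2 := hT (fun y ↦ max (-g' y) 0) (by fun_prop) (fun y ↦ le_max_right _ _) hg'.neg_part
  have h3 := h1.sub h2
  rw [← integral_sub hg'.pos_part hg'.neg_part] at h3
  have e : ∀ y, max (g' y) 0 - max (-g' y) 0 = g' y := fun y ↦ by
    rcases le_total 0 (g' y) with h | h
    · rw [max_eq_left h, max_eq_right (by linarith)]; ring
    · rw [max_eq_right h, max_eq_left (by linarith)]; ring
  simp_rw [e] at h3
  rw [integral_congr_ae hgg']
  refine h3.congr' ?_
  filter_upwards [hae g g' hgg'] with z hz
  rw [hz, ← hsub]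
  simp_rw [e]

/-- The law of large numbers for the population. -/
lemma tendsto_mean (S : IsSamplingScheme ρ P N n₀ Y π A) {g : 𝒴 → ℝ} (hg : Integrable g ρ) :
    Tendsto (fun x : Σ _ : ℕ, Ω ↦ (N x.1 : ℝ)⁻¹ * ∑ i, g (Y x.1 x.2 i)) (inProb P)
      (𝓝 (∫ y, g y ∂ρ)) := by
  refine tendsto_of_nonneg_measurable
    (fun (h : 𝒴 → ℝ) (x : Σ _ : ℕ, Ω) ↦ (N x.1 : ℝ)⁻¹ * ∑ i, h (Y x.1 x.2 i))
    (fun g h x ↦ ?_) (fun g h hgh ↦ ?_) (fun h hm h0 hi ↦ S.tendsto_mean_of_nonneg hm h0 hi) hg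
  · simp only [Finset.sum_sub_distrib, mul_sub]
  · have := ae_inProb (Q := fun x : Σ _ : ℕ, Ω ↦ ∀ i, g (Y x.1 x.2 i) = h (Y x.1 x.2 i))
      fun ν ↦ S.ae_units hgh ν
    filter_upwards [this] with x hx
    simp_rw [hx]

/-- The law of large numbers for the weighted sample. -/
lemma tendsto_weighted (S : IsSamplingScheme ρ P N n₀ Y π A) {g : 𝒴 → ℝ} (hg : Integrable g ρ) :
    Tendsto (fun x : Σ _ : ℕ, Ω ↦ (N x.1 : ℝ)⁻¹ * ∑ i ∈ A x.1 x.2,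
      designWeight (π x.1 x.2) i * g (Y x.1 x.2 i)) (inProb P) (𝓝 (∫ y, g y ∂ρ)) := by
  refine tendsto_of_nonneg_measurable
    (fun (h : 𝒴 → ℝ) (x : Σ _ : ℕ, Ω) ↦ (N x.1 : ℝ)⁻¹ * ∑ i ∈ A x.1 x.2,
      designWeight (π x.1 x.2) i * h (Y x.1 x.2 i))
    (fun g h x ↦ ?_) (fun g h hgh ↦ ?_) (fun h hm h0 hi ↦ ?_) hg
  · simp only [Finset.sum_sub_distrib, mul_sub]
  · have := ae_inProb (Q := fun x : Σ _ : ℕ, Ω ↦ ∀ i, g (Y x.1 x.2 i) = h (Y x.1 x.2 i))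
      fun ν ↦ S.ae_units hgh ν
    filter_upwards [this] with x hx
    simp_rw [hx]
  · have := S.tendsto_weighted_of_nonneg hm h0 hi (r := fun _ _ _ ↦ 1) (B := 1)
      (c := ∫ y, h y ∂ρ) (fun _ _ ↦ measurable_const) zero_le_one
      (fun _ ↦ Eventually.of_forall fun _ _ ↦ zero_le_one)
      (Eventually.of_forall fun _ ↦ Eventually.of_forall fun _ _ ↦ le_rfl)
      (by simpa using S.tendsto_mean_of_nonneg hm h0 hi)
    simpa using this

/-- The estimated population size is consistent. -/
lemma tendsto_sum_weight (S : IsSamplingScheme ρ P N n₀ Y π A) :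
    Tendsto (fun x : Σ _ : ℕ, Ω ↦ (N x.1 : ℝ)⁻¹ * ∑ i ∈ A x.1 x.2, designWeight (π x.1 x.2) i)
      (inProb P) (𝓝 1) := by
  simpa using S.tendsto_weighted (integrable_const (1 : ℝ))

/-- The realized sample size is asymptotically equivalent to `n₀`. -/
lemma tendsto_card_div (S : IsSamplingScheme ρ P N n₀ Y π A) :
    Tendsto (fun x : Σ _ : ℕ, Ω ↦ ((A x.1 x.2).card : ℝ) / n₀ x.1) (inProb P) (𝓝 1) := by
  have hsum : Tendsto (fun x : Σ _ : ℕ, Ω ↦ (∑ i, π x.1 x.2 i) / n₀ x.1) (inProb P) (𝓝 1) :=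
    tendsto_probFilter_iff_tendstoInMeasure (X := fun ν ω ↦ (∑ i, π ν ω i) / n₀ ν).2 S.tendsto_sum
  have hinv : Tendsto (fun x : Σ _ : ℕ, Ω ↦ |n₀ x.1|⁻¹) (inProb P) (𝓝 0) :=
    (tendsto_inv_atTop_zero.comp (tendsto_abs_atTop_atTop.comp S.tendsto_n₀)).comp
      tendsto_fst_probFilter
  have hsum' : Tendsto (fun x : Σ _ : ℕ, Ω ↦ ∑ i, π x.1 x.2 i * |n₀ x.1|⁻¹) (inProb P) (𝓝 1) := by
    refine hsum.congr' ?_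
    filter_upwards [eventually_fst S.eventually_pos_n₀] with x hx
    rw [← Finset.sum_mul, abs_of_pos hx, div_eq_mul_inv]
  have key := S.tendsto_sum_sample (a := fun ν _ _ ↦ |n₀ ν|⁻¹) (c := 1)
    (fun _ _ ↦ measurable_const) (fun ν ↦ Eventually.of_forall fun _ _ ↦ by positivity) hsum' ?_
  · refine key.congr' ?_
    filter_upwards [eventually_fst S.eventually_pos_n₀] with x hx
    rw [Finset.sum_const, nsmul_eq_mul, abs_of_pos hx, div_eq_mul_inv]
  · have hz := hsum'.mul hinv
    rw [mul_zero] at hz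
    refine squeeze_zero' ?_ ?_ hz
    · filter_upwards [S.eventually_prob] with x hx
      exact Finset.sum_nonneg fun i _ ↦ mul_nonneg (hx i).1.le (le_min (by positivity) (by positivity))
    · filter_upwards [S.eventually_prob] with x hx
      rw [Finset.sum_mul]
      refine Finset.sum_le_sum fun i _ ↦ ?_
      rw [mul_assoc, ← sq]
      exact mul_le_mul_of_nonneg_left (min_le_right _ _) (hx i).1.le

end IsSamplingScheme

end WeightedAverages

/-! ### The conditional variance of a weighted total -/

section ConditionalVariance

lemma lower_bound_exp_neg_sub {ε u : ℝ} (hε : 0 < ε) (hu : ε ≤ |u|) :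
    min (Real.exp (-ε) - 1 + ε) (Real.exp ε - 1 - ε) ≤ Real.exp (-u) - 1 + u := by
  rcases le_total 0 u with h | h
  · rw [abs_of_nonneg h] at hu
    refine (min_le_left _ _).trans ?_
    have h1 : Real.exp (-u) = Real.exp (-ε) * Real.exp (-(u - ε)) := by
      rw [← Real.exp_add]; congr 1; ring
    have h2 := Real.one_sub_le_exp_neg (u - ε)
    have h3 : Real.exp (-ε) ≤ 1 := Real.exp_le_one_iff.2 (by linarith)
    have h4 := mul_le_mul_of_nonneg_left h2 (Real.exp_pos (-ε)).le
    nlinarith [mul_nonneg (sub_nonneg.2 hu) (sub_nonneg.2 h3)]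
  · rw [abs_of_nonpos h] at hu
    refine (min_le_right _ _).trans ?_
    have h1 : Real.exp (-u) = Real.exp ε * Real.exp (-u - ε) := by
      rw [← Real.exp_add]; congr 1; ring
    have h2 := Real.add_one_le_exp (-u - ε)
    have h3 : 1 ≤ Real.exp ε := Real.one_le_exp hε.le
    have h4 := mul_le_mul_of_nonneg_left h2 (Real.exp_pos ε).le
    nlinarith [mul_nonneg (sub_nonneg.2 hu) (sub_nonneg.2 h3)]

/-- Strict convexity of `exp (-·)`: if `E exp (-X) → exp (-c)` while `limsup E X ≤ c`, there is
asymptotic equality in Jensen's inequality, hence `X → c` in probability. -/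
lemma tendsto_probFilter_of_jensen {ι : Type*} {M : ι → Type*} [∀ i, MeasurableSpace (M i)]
    {𝓕 : Filter ι} {κ : ∀ i, Measure (M i)} {X : (Σ i, M i) → ℝ} {c : ℝ} {b : ι → ℝ}
    (hκ : ∀ᶠ i in 𝓕, IsProbabilityMeasure (κ i))
    (hX : ∀ᶠ i in 𝓕, Integrable (fun m ↦ X ⟨i, m⟩) (κ i))
    (hX0 : ∀ᶠ i in 𝓕, ∀ᵐ m ∂(κ i), 0 ≤ X ⟨i, m⟩)
    (hexp : Tendsto (fun i ↦ ∫ m, Real.exp (-X ⟨i, m⟩) ∂(κ i)) 𝓕 (𝓝 (Real.exp (-c))))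
    (hmean : ∀ᶠ i in 𝓕, ∫ m, X ⟨i, m⟩ ∂(κ i) ≤ b i) (hb : Tendsto b 𝓕 (𝓝 c)) :
    Tendsto X (probFilter 𝓕 κ) (𝓝 c) := by
  have hnn : ∀ u : ℝ, 0 ≤ Real.exp (-u) - 1 + u := fun u ↦ by
    have := Real.one_sub_le_exp_neg u; linarith
  have hei : ∀ᶠ i in 𝓕, Integrable (fun m ↦ Real.exp (-X ⟨i, m⟩)) (κ i) := by
    filter_upwards [hκ, hX, hX0] with i h1 h2 h3
    refine Integrable.of_bound (Real.continuous_exp.comp_aestronglyMeasurable h2.1.neg) 1 ?_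
    filter_upwards [h3] with m hm
    rw [Real.norm_eq_abs, abs_of_pos (Real.exp_pos _), Real.exp_le_one_iff]
    linarith
  have hsplit : ∀ i m, Real.exp (-(X ⟨i, m⟩ - c)) - 1 + (X ⟨i, m⟩ - c) =
      Real.exp c * Real.exp (-X ⟨i, m⟩) + (X ⟨i, m⟩ + (-1 - c)) := fun i m ↦ by
    rw [← Real.exp_add]; ring_nf
  have hint : ∀ᶠ i in 𝓕, Integrable
      (fun m ↦ Real.exp (-(X ⟨i, m⟩ - c)) - 1 + (X ⟨i, m⟩ - c)) (κ i) := by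
    filter_upwards [hκ, hX, hei] with i h1 h2 h3
    simp_rw [hsplit]
    exact (h3.const_mul _).add (h2.add (integrable_const _))
  have key : Tendsto (fun x ↦ Real.exp (-(X x - c)) - 1 + (X x - c)) (probFilter 𝓕 κ) (𝓝 0) := by
    refine tendsto_probFilter_of_tendsto_integral
      (Eventually.of_forall fun i ↦ Eventually.of_forall fun m ↦ hnn _) hint ?_
    have hup : Tendsto (fun i ↦ Real.exp c * ∫ m, Real.exp (-X ⟨i, m⟩) ∂(κ i) +
        (b i + (-1 - c))) 𝓕 (𝓝 0) := by
      have := (hexp.const_mul (Real.exp c)).add (hb.add_const (-1 - c))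
      rw [← Real.exp_add, add_neg_cancel, Real.exp_zero] at this
      convert this using 2
      ring
    refine squeeze_zero' (Eventually.of_forall fun i ↦ integral_nonneg fun m ↦ hnn _) ?_ hup
    filter_upwards [hκ, hX, hei, hmean] with i h1 h2 h3 h4
    simp_rw [hsplit]
    have h23 : Integrable (fun m ↦ X ⟨i, m⟩ + (-1 - c)) (κ i) := h2.add (integrable_const _)
    rw [integral_add (h3.const_mul _) h23, integral_const_mul, integral_add h2 (integrable_const _)]
    simpa using h4
  rw [Metric.tendsto_nhds]
  intro ε hε
  have hpos : 0 < min (Real.exp (-ε) - 1 + ε) (Real.exp ε - 1 - ε) := by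
    have h1 := Real.add_one_lt_exp (x := -ε) (by linarith)
    have h2 := Real.add_one_lt_exp (x := ε) (by linarith)
    exact lt_min (by linarith) (by linarith)
  filter_upwards [(tendsto_order.1 key).2 _ hpos] with x hx
  by_contra hc
  rw [Real.dist_eq, not_lt] at hc
  exact absurd (lower_bound_exp_neg_sub hε hc) (not_le.2 hx)

namespace IsSamplingScheme

variable {𝒴 Ω : Type*} [MeasurableSpace 𝒴] [MeasurableSpace Ω]
  {ρ : Measure 𝒴} {P : Measure Ω} [IsProbabilityMeasure ρ] [IsProbabilityMeasure P]
  {N : ℕ → ℕ} {n₀ : ℕ → ℝ} {Y : (ν : ℕ) → Ω → Fin (N ν) → 𝒴} {π : (ν : ℕ) → Ω → Fin (N ν) → ℝ}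
  {A : (ν : ℕ) → Ω → Finset (Fin (N ν))} {u : 𝒴 → ℝ}

lemma memLp_weighted (S : IsSamplingScheme ρ P N n₀ Y π A) (hum : Measurable u)
    (hu : MemLp u 2 ρ) : ∀ᶠ ν in atTop, ∀ i, MemLp (fun ω ↦ (π ν ω i)⁻¹ * u (Y ν ω i)) 2 P := by
  obtain ⟨C, hC, hb⟩ := S.exists_weight_bound
  filter_upwards [hb, S.eventually_pos_n₀, S.eventually_pos_N] with ν h hn hN i
  have hN' : (0 : ℝ) < N ν := by exact_mod_cast hN
  have h1 : MemLp (fun ω ↦ u (Y ν ω i)) 2 P := hu.comp_measurePreserving (S.measurePreserving_unit ν i)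
  have hπ : Measurable fun ω ↦ π ν ω i := (measurable_pi_apply i).comp (S.measurable_π ν)
  have hY : Measurable fun ω ↦ Y ν ω i := (measurable_pi_apply i).comp (S.measurable_Y ν)
  refine h1.of_le_mul (c := C * (n₀ ν * (N ν : ℝ)⁻¹)⁻¹)
    (hπ.inv.mul (hum.comp hY)).aestronglyMeasurable ?_
  filter_upwards [h] with ω hω
  rw [norm_mul, Real.norm_eq_abs, abs_of_nonneg (hω i).1]
  refine mul_le_mul_of_nonneg_right ?_ (norm_nonneg _)
  rw [← div_eq_mul_inv, le_div_iff₀ (by positivity), mul_comm]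
  exact (hω i).2

/-- Weighted totals are design unbiased. -/
lemma integral_weighted (S : IsSamplingScheme ρ P N n₀ Y π A) (hum : Measurable u)
    (hu : MemLp u 2 ρ) : ∀ᶠ ν in atTop,
      ∫ ω, (N ν : ℝ)⁻¹ * ∑ i ∈ A ν ω, (π ν ω i)⁻¹ * u (Y ν ω i) ∂P = ∫ y, u y ∂ρ := by
  filter_upwards [S.memLp_weighted hum hu, S.eventually_pos_N] with ν h hN
  have hN' : (N ν : ℝ) ≠ 0 := by exact_mod_cast hN.ne'
  have hmeas : ∀ i : Fin (N ν), Measurable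
      fun x : (Fin (N ν) → 𝒴) × (Fin (N ν) → ℝ) ↦ (x.2 i)⁻¹ * u (x.1 i) := fun i ↦
    ((measurable_pi_apply i).comp measurable_snd).inv.mul
      (hum.comp ((measurable_pi_apply i).comp measurable_fst))
  rw [integral_sample_eq (S.measurable_Y ν) (S.measurable_π ν) (S.prob ν) (S.sample ν)
    (F := fun x s ↦ (N ν : ℝ)⁻¹ * ∑ i ∈ s, (x.2 i)⁻¹ * u (x.1 i))
    (fun s ↦ (Finset.measurable_sum _ fun i _ ↦ hmeas i).const_mul _)
    (fun s ↦ (integrable_finsetSum _ fun i _ ↦ (h i).integrable one_le_two).const_mul _)]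
  have e : ∀ᵐ ω ∂P, ∑ s, designProb (π ν ω) s •
      ((N ν : ℝ)⁻¹ * ∑ i ∈ s, (π ν ω i)⁻¹ * u (Y ν ω i)) = (N ν : ℝ)⁻¹ * ∑ i, u (Y ν ω i) := by
    filter_upwards [S.prob ν] with ω hp
    simp_rw [smul_eq_mul, mul_left_comm _ (N ν : ℝ)⁻¹]
    rw [← Finset.mul_sum, sum_designProb_mul_sum]
    congr 1
    exact Finset.sum_congr rfl fun i _ ↦ mul_inv_cancel_left₀ (hp i).1.ne' _
  rw [integral_congr_ae e, integral_const_mul, integral_finsetSum]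
  · have : ∀ i : Fin (N ν), ∫ ω, u (Y ν ω i) ∂P = ∫ y, u y ∂ρ := fun i ↦ by
      rw [← (S.measurePreserving_unit ν i).map_eq, integral_map
        (S.measurePreserving_unit ν i).measurable.aemeasurable hum.aestronglyMeasurable]
    simp only [this, Finset.sum_const, Finset.card_univ, Fintype.card_fin, nsmul_eq_mul]
    field_simp
  · intro i _
    exact (hu.comp_measurePreserving (S.measurePreserving_unit ν i)).integrable one_le_two

/-- The second moment of a weighted total dominates, up to a term of order `1 / N`, the mean of its
conditional variance given the population. -/
lemma integral_condVar_le (S : IsSamplingScheme ρ P N n₀ Y π A) (hum : Measurable u)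
    (hu : MemLp u 2 ρ) : ∀ᶠ ν in atTop,
      Integrable (fun ω ↦ (N ν : ℝ)⁻¹ ^ 2 * ∑ i, (π ν ω i)⁻¹ * u (Y ν ω i) ^ 2) P ∧
      ∫ ω, (N ν : ℝ)⁻¹ ^ 2 * ∑ i, (π ν ω i)⁻¹ * u (Y ν ω i) ^ 2 ∂P ≤
      ∫ ω, ((N ν : ℝ)⁻¹ * ∑ i ∈ A ν ω, (π ν ω i)⁻¹ * u (Y ν ω i)) ^ 2 ∂P +
        (N ν : ℝ)⁻¹ * ∫ y, u y ^ 2 ∂ρ := by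
  obtain ⟨C, hC, hb⟩ := S.exists_weight_bound
  filter_upwards [S.memLp_weighted hum hu, S.eventually_pos_N, hb, S.eventually_pos_n₀]
    with ν h hN hb hn
  have hN' : (0 : ℝ) < N ν := by exact_mod_cast hN
  have hmeas : ∀ i : Fin (N ν), Measurable
      fun x : (Fin (N ν) → 𝒴) × (Fin (N ν) → ℝ) ↦ (x.2 i)⁻¹ * u (x.1 i) := fun i ↦
    ((measurable_pi_apply i).comp measurable_snd).inv.mul
      (hum.comp ((measurable_pi_apply i).comp measurable_fst))
  have husq : ∀ i : Fin (N ν), Integrable (fun ω ↦ u (Y ν ω i) ^ 2) P := fun i ↦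
    (hu.comp_measurePreserving (S.measurePreserving_unit ν i)).integrable_sq
  have husqw : ∀ i : Fin (N ν), Integrable (fun ω ↦ (π ν ω i)⁻¹ * u (Y ν ω i) ^ 2) P := fun i ↦ by
    have hπ : Measurable fun ω ↦ π ν ω i := (measurable_pi_apply i).comp (S.measurable_π ν)
    have hY : Measurable fun ω ↦ Y ν ω i := (measurable_pi_apply i).comp (S.measurable_Y ν)
    refine ((husq i).const_mul (C * (n₀ ν * (N ν : ℝ)⁻¹)⁻¹)).mono'
      (hπ.inv.mul ((hum.comp hY).pow_const 2)).aestronglyMeasurable ?_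
    filter_upwards [hb] with ω hω
    rw [norm_mul, Real.norm_eq_abs, abs_of_nonneg (hω i).1, Real.norm_eq_abs,
      abs_of_nonneg (sq_nonneg _)]
    refine mul_le_mul_of_nonneg_right ?_ (sq_nonneg _)
    rw [← div_eq_mul_inv, le_div_iff₀ (by positivity), mul_comm]
    exact (hω i).2
  have hXint : Integrable (fun ω ↦ (N ν : ℝ)⁻¹ ^ 2 * ∑ i, (π ν ω i)⁻¹ * u (Y ν ω i) ^ 2) P :=
    (integrable_finsetSum _ fun i _ ↦ husqw i).const_mul _
  refine ⟨hXint, ?_⟩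
  have hmem : ∀ s : Finset (Fin (N ν)),
      MemLp (fun ω ↦ (N ν : ℝ)⁻¹ * ∑ i ∈ s, (π ν ω i)⁻¹ * u (Y ν ω i)) 2 P := fun s ↦
    (memLp_finsetSum s fun i _ ↦ h i).const_mul _
  rw [integral_sample_eq (S.measurable_Y ν) (S.measurable_π ν) (S.prob ν) (S.sample ν)
    (F := fun x s ↦ ((N ν : ℝ)⁻¹ * ∑ i ∈ s, (x.2 i)⁻¹ * u (x.1 i)) ^ 2)
    (fun s ↦ ((Finset.measurable_sum _ fun i _ ↦ hmeas i).const_mul _).pow_const 2)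
    (fun s ↦ (hmem s).integrable_sq)]
  have e : ∀ᵐ ω ∂P, ∑ s, designProb (π ν ω) s •
      ((N ν : ℝ)⁻¹ * ∑ i ∈ s, (π ν ω i)⁻¹ * u (Y ν ω i)) ^ 2 =
      (N ν : ℝ)⁻¹ ^ 2 * (∑ i, u (Y ν ω i)) ^ 2 + ((N ν : ℝ)⁻¹ ^ 2 * ∑ i, (π ν ω i)⁻¹ * u (Y ν ω i) ^ 2 -
        (N ν : ℝ)⁻¹ ^ 2 * ∑ i, u (Y ν ω i) ^ 2) := by
    filter_upwards [S.prob ν] with ω hp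
    simp_rw [smul_eq_mul, mul_pow, mul_left_comm _ ((N ν : ℝ)⁻¹ ^ 2)]
    rw [← Finset.mul_sum, sum_designProb_mul_sum_sq]
    have s1 : ∑ i, π ν ω i * ((π ν ω i)⁻¹ * u (Y ν ω i)) = ∑ i, u (Y ν ω i) :=
      Finset.sum_congr rfl fun i _ ↦ mul_inv_cancel_left₀ (hp i).1.ne' _
    have s2 : ∑ i, π ν ω i * (1 - π ν ω i) * ((π ν ω i)⁻¹ * u (Y ν ω i)) ^ 2 =
        ∑ i, (π ν ω i)⁻¹ * u (Y ν ω i) ^ 2 - ∑ i, u (Y ν ω i) ^ 2 := by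
      rw [← Finset.sum_sub_distrib]
      refine Finset.sum_congr rfl fun i _ ↦ ?_
      have := (hp i).1.ne'
      field_simp
    rw [s1, s2]
    ring
  have hsq1 : Integrable (fun ω ↦ (N ν : ℝ)⁻¹ ^ 2 * (∑ i, u (Y ν ω i)) ^ 2) P :=
    (memLp_finsetSum Finset.univ fun i _ ↦
      hu.comp_measurePreserving (S.measurePreserving_unit ν i)).integrable_sq.const_mul _
  have hsq2 : Integrable (fun ω ↦ (N ν : ℝ)⁻¹ ^ 2 * ∑ i, u (Y ν ω i) ^ 2) P :=
    (integrable_finsetSum _ fun i _ ↦ husq i).const_mul _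
  have hval : ∫ ω, (N ν : ℝ)⁻¹ ^ 2 * ∑ i, u (Y ν ω i) ^ 2 ∂P = (N ν : ℝ)⁻¹ * ∫ y, u y ^ 2 ∂ρ := by
    rw [integral_const_mul, integral_finsetSum _ fun i _ ↦ husq i]
    have : ∀ i : Fin (N ν), ∫ ω, u (Y ν ω i) ^ 2 ∂P = ∫ y, u y ^ 2 ∂ρ := fun i ↦ by
      rw [← (S.measurePreserving_unit ν i).map_eq, integral_map
        (S.measurePreserving_unit ν i).measurable.aemeasurable
        (hum.pow_const 2).aestronglyMeasurable]
    simp only [this, Finset.sum_const, Finset.card_univ, Fintype.card_fin, nsmul_eq_mul]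
    field_simp
  have hnn : 0 ≤ ∫ ω, (N ν : ℝ)⁻¹ ^ 2 * (∑ i, u (Y ν ω i)) ^ 2 ∂P :=
    integral_nonneg fun ω ↦ by positivity
  have hdiff : Integrable (fun ω ↦ (N ν : ℝ)⁻¹ ^ 2 * ∑ i, (π ν ω i)⁻¹ * u (Y ν ω i) ^ 2 -
      (N ν : ℝ)⁻¹ ^ 2 * ∑ i, u (Y ν ω i) ^ 2) P := hXint.sub hsq2
  rw [integral_congr_ae e, integral_add hsq1 hdiff, integral_sub hXint hsq2, hval]
  linarith

end IsSamplingScheme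

end ConditionalVariance

section ConditionalCharacteristicFunction

namespace IsSamplingScheme

variable {𝒴 Ω : Type*} [MeasurableSpace 𝒴] [MeasurableSpace Ω]
  {ρ : Measure 𝒴} {P : Measure Ω} [IsProbabilityMeasure ρ] [IsProbabilityMeasure P]
  {N : ℕ → ℕ} {n₀ : ℕ → ℝ} {Y : (ν : ℕ) → Ω → Fin (N ν) → 𝒴} {π : (ν : ℕ) → Ω → Fin (N ν) → ℝ}
  {A : (ν : ℕ) → Ω → Finset (Fin (N ν))} {u : 𝒴 → ℝ}

/-- Since `n₀ / N → 0`, the population total of a centred variable is negligible on the scale of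
the sampling error. -/
lemma tendsto_exp_population_total (S : IsSamplingScheme ρ P N n₀ Y π A) (hum : Measurable u)
    (hu : MemLp u 2 ρ) (hu0 : ∫ y, u y ∂ρ = 0) :
    Tendsto (fun x : Σ _ : ℕ, Ω ↦ ‖Complex.exp
      (((√(n₀ x.1) * (N x.1 : ℝ)⁻¹ * ∑ i, u (Y x.1 x.2 i) : ℝ) : ℂ) * Complex.I) - 1‖)
      (inProb P) (𝓝 0) := by
  have hui : Integrable u ρ := hu.integrable one_le_two
  let a : ℕ → ℂ := fun ν ↦ ∫ y, Complex.exp (((√(n₀ ν) * (N ν : ℝ)⁻¹ * u y : ℝ) : ℂ) * Complex.I) ∂ρ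
  have hexpi : ∀ c : ℝ, Integrable (fun y ↦ Complex.exp (((c * u y : ℝ) : ℂ) * Complex.I)) ρ :=
    fun c ↦ Integrable.of_bound (Measurable.aestronglyMeasurable (by fun_prop)) 1
      (Eventually.of_forall fun y ↦ (Complex.norm_exp_ofReal_mul_I _).le)
  have ha1 : ∀ ν, ‖a ν‖ ≤ 1 := fun ν ↦ by
    refine (norm_integral_le_integral_norm _).trans ?_
    simp only [Complex.norm_exp_ofReal_mul_I, integral_const, probReal_univ, smul_eq_mul, mul_one,
      le_refl]
  have ha : ∀ ν, ‖a ν - 1‖ ≤ 3 * ((√(n₀ ν) * (N ν : ℝ)⁻¹) ^ 2 * ∫ y, u y ^ 2 ∂ρ) := fun ν ↦ by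
    have h0 : ∫ y, (((√(n₀ ν) * (N ν : ℝ)⁻¹ * u y : ℝ) : ℂ) * Complex.I) ∂ρ = 0 := by
      rw [integral_mul_const, integral_complex_ofReal, integral_const_mul, hu0]; simp
    have hi : Integrable (fun y ↦ ((√(n₀ ν) * (N ν : ℝ)⁻¹ * u y : ℝ) : ℂ) * Complex.I) ρ :=
      ((hui.const_mul _).ofReal).mul_const _
    have hi1 : Integrable (fun y ↦
        Complex.exp (((√(n₀ ν) * (N ν : ℝ)⁻¹ * u y : ℝ) : ℂ) * Complex.I) - 1) ρ :=
      (hexpi (√(n₀ ν) * (N ν : ℝ)⁻¹)).sub (integrable_const (1 : ℂ))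
    have e : a ν - 1 = ∫ y, (Complex.exp (((√(n₀ ν) * (N ν : ℝ)⁻¹ * u y : ℝ) : ℂ) * Complex.I) - 1 -
        ((√(n₀ ν) * (N ν : ℝ)⁻¹ * u y : ℝ) : ℂ) * Complex.I) ∂ρ := by
      rw [integral_sub hi1 hi, h0, integral_sub (hexpi _) (integrable_const _)]
      simp [a]
    rw [e, ← integral_const_mul, ← integral_const_mul]
    refine norm_integral_le_of_norm_le ((hu.integrable_sq.const_mul _).const_mul _)
      (Eventually.of_forall fun y ↦ ?_)
    refine (norm_exp_mul_I_sub_le _).trans (le_of_eq ?_)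
    ring
  have hpow : Tendsto (fun ν ↦ a ν ^ N ν) atTop (𝓝 1) := by
    rw [tendsto_iff_norm_sub_tendsto_zero]
    have hz : Tendsto (fun ν ↦ 3 * ((n₀ ν / N ν) * ∫ y, u y ^ 2 ∂ρ)) atTop (𝓝 0) := by
      have := ((S.tendsto_fraction.mul_const (∫ y, u y ^ 2 ∂ρ)).const_mul 3)
      simpa using this
    refine squeeze_zero' (Eventually.of_forall fun _ ↦ norm_nonneg _) ?_ hz
    filter_upwards [S.eventually_pos_N, S.eventually_pos_n₀] with ν hN hn
    have hN' : (0 : ℝ) < N ν := by exact_mod_cast hN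
    have h := norm_pow_sub_pow_le (ha1 ν) (b := 1) (by simp) (N ν)
    rw [one_pow] at h
    refine h.trans ((mul_le_mul_of_nonneg_left (ha ν) hN'.le).trans (le_of_eq ?_))
    rw [mul_pow, Real.sq_sqrt hn.le]
    field_simp
  have hchar : ∀ ν, ∫ ω, Complex.exp
      (((√(n₀ ν) * (N ν : ℝ)⁻¹ * ∑ i, u (Y ν ω i) : ℝ) : ℂ) * Complex.I) ∂P = a ν ^ N ν := by
    intro ν
    have e : ∀ ω, Complex.exp (((√(n₀ ν) * (N ν : ℝ)⁻¹ * ∑ i, u (Y ν ω i) : ℝ) : ℂ) * Complex.I) =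
        ∏ i, Complex.exp (((√(n₀ ν) * (N ν : ℝ)⁻¹ * u (Y ν ω i) : ℝ) : ℂ) * Complex.I) := fun ω ↦ by
      rw [← Complex.exp_sum, ← Finset.sum_mul, ← Complex.ofReal_sum, Finset.mul_sum]
    simp_rw [e]
    have h2 := integral_map (μ := P) (S.measurable_Y ν).aemeasurable
      (f := fun y : Fin (N ν) → 𝒴 ↦ ∏ i,
        Complex.exp (((√(n₀ ν) * (N ν : ℝ)⁻¹ * u (y i) : ℝ) : ℂ) * Complex.I))
      (Measurable.aestronglyMeasurable (by fun_prop))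
    rw [S.iid ν, integral_fintype_prod_eq_pow (𝕜 := ℂ)
      (fun y ↦ Complex.exp (((√(n₀ ν) * (N ν : ℝ)⁻¹ * u y : ℝ) : ℂ) * Complex.I)),
      Fintype.card_fin] at h2
    exact h2.symm
  have hYm : ∀ ν, Measurable fun ω ↦ Complex.exp
      (((√(n₀ ν) * (N ν : ℝ)⁻¹ * ∑ i, u (Y ν ω i) : ℝ) : ℂ) * Complex.I) := fun ν ↦ by
    have := S.measurable_Y ν
    fun_prop
  have hsq : Tendsto (fun x : Σ _ : ℕ, Ω ↦ ‖Complex.exp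
      (((√(n₀ x.1) * (N x.1 : ℝ)⁻¹ * ∑ i, u (Y x.1 x.2 i) : ℝ) : ℂ) * Complex.I) - 1‖ ^ 2)
      (inProb P) (𝓝 0) := by
    have hval : ∀ t : ℝ, ‖Complex.exp ((t : ℂ) * Complex.I) - 1‖ ^ 2 =
        2 - 2 * (Complex.exp ((t : ℂ) * Complex.I)).re := fun t ↦ by
      rw [← Complex.normSq_eq_norm_sq, Complex.normSq_apply]
      simp only [Complex.sub_re, Complex.sub_im, Complex.exp_ofReal_mul_I_re,
        Complex.exp_ofReal_mul_I_im, Complex.one_re, Complex.one_im, sub_zero]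
      nlinarith [Real.sin_sq_add_cos_sq t]
    have hI : ∀ ν, Integrable (fun ω ↦ Complex.exp
        (((√(n₀ ν) * (N ν : ℝ)⁻¹ * ∑ i, u (Y ν ω i) : ℝ) : ℂ) * Complex.I)) P := fun ν ↦
      Integrable.of_bound (hYm ν).aestronglyMeasurable 1
        (Eventually.of_forall fun y ↦ (Complex.norm_exp_ofReal_mul_I _).le)
    have hIre : ∀ ν, Integrable (fun ω ↦ (Complex.exp
        (((√(n₀ ν) * (N ν : ℝ)⁻¹ * ∑ i, u (Y ν ω i) : ℝ) : ℂ) * Complex.I)).re) P :=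
      fun ν ↦ (hI ν).re
    refine tendsto_probFilter_of_tendsto_integral
      (Eventually.of_forall fun ν ↦ Eventually.of_forall fun ω ↦ by positivity) ?_ ?_
    · refine Eventually.of_forall fun ν ↦ ?_
      simp only [hval]
      exact (integrable_const _).sub ((hIre ν).const_mul 2)
    · have hlim : Tendsto (fun ν ↦ 2 - 2 * (a ν ^ N ν).re) atTop (𝓝 0) := by
        have := (((Complex.continuous_re.tendsto _).comp hpow).const_mul 2).const_sub 2
        simpa using this
      refine hlim.congr fun ν ↦ ?_
      simp only [hval]
      rw [integral_sub (integrable_const _) ((hIre ν).const_mul 2), integral_const_mul, ← hchar ν,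
        show ∫ ω, (Complex.exp (((√(n₀ ν) * (N ν : ℝ)⁻¹ * ∑ i, u (Y ν ω i) : ℝ) : ℂ) *
          Complex.I)).re ∂P = (∫ ω, Complex.exp (((√(n₀ ν) * (N ν : ℝ)⁻¹ *
          ∑ i, u (Y ν ω i) : ℝ) : ℂ) * Complex.I) ∂P).re from integral_re (hI ν)]
      simp
  have := (Real.continuous_sqrt.tendsto 0).comp hsq
  rw [Real.sqrt_zero] at this
  refine this.congr fun x ↦ ?_
  simp [Real.sqrt_sq]

lemma integrable_abs_pow (hu : MemLp u 4 ρ) {k : ℕ} (hk : k ≠ 0) (hk4 : k ≤ 4) :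
    Integrable (fun y ↦ |u y| ^ k) ρ := by
  have h : MemLp u k ρ := hu.mono_exponent (by exact_mod_cast hk4)
  simpa [Real.norm_eq_abs] using h.integrable_norm_pow hk

/-- Given the population, a weighted total of a centred variable is asymptotically normal with the
conditional variance `∑ᵢ πᵢ bᵢ²`; this is the averaged form of that statement. -/
lemma tendsto_charFun_sub_laplace (S : IsSamplingScheme ρ P N n₀ Y π A) (hum : Measurable u)
    (hu : MemLp u 4 ρ) (hu0 : ∫ y, u y ∂ρ = 0) :
    Tendsto (fun ν ↦ ∫ ω, Complex.exp (((√(n₀ ν) * ((N ν : ℝ)⁻¹ * ∑ i ∈ A ν ω,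
        (π ν ω i)⁻¹ * u (Y ν ω i)) : ℝ) : ℂ) * Complex.I) ∂P -
      ∫ ω, ((Real.exp (-(n₀ ν * ((N ν : ℝ)⁻¹ ^ 2 * ∑ i, (π ν ω i)⁻¹ * u (Y ν ω i) ^ 2) / 2)) : ℝ) : ℂ)
        ∂P) atTop (𝓝 0) := by
  obtain ⟨C, hC, hCb⟩ := S.exists_weight_bound
  have hu2 : MemLp u 2 ρ := hu.mono_exponent (by norm_num)
  let b : ∀ ν, Fin (N ν) → (Fin (N ν) → 𝒴) × (Fin (N ν) → ℝ) → ℝ :=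
    fun ν i x ↦ √(n₀ ν) * (N ν : ℝ)⁻¹ * ((x.2 i)⁻¹ * u (x.1 i))
  have hbm : ∀ ν i, Measurable (b ν i) := fun ν i ↦
    (((measurable_pi_apply i).comp measurable_snd).inv.mul
      (hum.comp ((measurable_pi_apply i).comp measurable_fst))).const_mul _
  let V : (Σ _ : ℕ, Ω) → ℝ := fun x ↦ √(n₀ x.1) * (N x.1 : ℝ)⁻¹ * ∑ i, u (Y x.1 x.2 i)
  let X : (Σ _ : ℕ, Ω) → ℝ := fun x ↦
    n₀ x.1 * ((N x.1 : ℝ)⁻¹ ^ 2 * ∑ i, (π x.1 x.2 i)⁻¹ * u (Y x.1 x.2 i) ^ 2)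
  let D : (Σ _ : ℕ, Ω) → ℂ := fun x ↦ ∏ i, (1 - (π x.1 x.2 i : ℂ) + π x.1 x.2 i *
    Complex.exp (((b x.1 i (Y x.1 x.2, π x.1 x.2) : ℝ) : ℂ) * Complex.I))
  have hcoef : ∀ᶠ x in inProb P, ∀ i, ‖1 - (π x.1 x.2 i : ℂ) + π x.1 x.2 i *
      Complex.exp (((b x.1 i (Y x.1 x.2, π x.1 x.2) : ℝ) : ℂ) * Complex.I)‖ ≤ 1 := by
    filter_upwards [S.eventually_prob] with x hp i
    refine (norm_add_le _ _).trans ?_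
    rw [norm_mul, Complex.norm_exp_ofReal_mul_I, mul_one, ← Complex.ofReal_one, ← Complex.ofReal_sub,
      Complex.norm_real, Complex.norm_real, Real.norm_eq_abs, Real.norm_eq_abs,
      abs_of_nonneg (hp i).1.le, abs_of_nonneg (sub_nonneg.2 (hp i).2)]
    linarith
  have hCb' : ∀ᶠ x in inProb P, ∀ i, 0 ≤ (π x.1 x.2 i)⁻¹ ∧
      n₀ x.1 * (N x.1 : ℝ)⁻¹ * (π x.1 x.2 i)⁻¹ ≤ C :=
    eventually_probFilter_of_ae (Q := fun x : Σ _ : ℕ, Ω ↦ ∀ i, 0 ≤ (π x.1 x.2 i)⁻¹ ∧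
      n₀ x.1 * (N x.1 : ℝ)⁻¹ * (π x.1 x.2 i)⁻¹ ≤ C) hCb
  -- the conditional characteristic function is close to the Gaussian one
  have hDE : Tendsto (fun x ↦ ‖D x - Complex.exp (V x * Complex.I - (X x : ℂ) / 2)‖)
      (inProb P) (𝓝 0) := by
    have hinv : Tendsto (fun x : Σ _ : ℕ, Ω ↦ (√(n₀ x.1))⁻¹) (inProb P) (𝓝 0) :=
      (tendsto_inv_atTop_zero.comp (Real.tendsto_sqrt_atTop.comp S.tendsto_n₀)).comp
        tendsto_fst_probFilter
    have hfrac : Tendsto (fun x : Σ _ : ℕ, Ω ↦ n₀ x.1 / N x.1) (inProb P) (𝓝 0) :=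
      S.tendsto_fraction.comp tendsto_fst_probFilter
    have hNinv : Tendsto (fun x : Σ _ : ℕ, Ω ↦ (N x.1 : ℝ)⁻¹) (inProb P) (𝓝 0) :=
      (tendsto_inv_atTop_zero.comp (tendsto_natCast_atTop_atTop.comp S.tendsto_N)).comp
        tendsto_fst_probFilter
    have m2 := S.tendsto_mean (integrable_abs_pow hu two_ne_zero (by norm_num))
    have m3 := S.tendsto_mean (integrable_abs_pow hu three_ne_zero (by norm_num))
    have m4 := S.tendsto_mean (integrable_abs_pow hu four_ne_zero le_rfl)
    have hz := (((hinv.mul m3).const_mul (4 * C ^ 2)).add ((hfrac.mul m2).const_mul 3)).add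
      ((hNinv.mul m4).const_mul (3 * C ^ 2))
    simp only [zero_mul, mul_zero, add_zero] at hz
    refine squeeze_zero' (Eventually.of_forall fun _ ↦ norm_nonneg _) ?_ hz
    filter_upwards [S.eventually_prob, hcoef, hCb', eventually_fst S.eventually_pos_n₀,
      eventually_fst S.eventually_pos_N] with x hp hc hw hn hN
    have hN' : (0 : ℝ) < N x.1 := by exact_mod_cast hN
    have hsn : √(n₀ x.1) ^ 2 = n₀ x.1 := Real.sq_sqrt hn.le
    have hsp : 0 < √(n₀ x.1) := Real.sqrt_pos.2 hn
    have hE : Complex.exp (V x * Complex.I - (X x : ℂ) / 2) = ∏ i, Complex.exp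
        (((π x.1 x.2 i * b x.1 i (Y x.1 x.2, π x.1 x.2) : ℝ) : ℂ) * Complex.I -
          ((π x.1 x.2 i * b x.1 i (Y x.1 x.2, π x.1 x.2) ^ 2 / 2 : ℝ) : ℂ)) := by
      rw [← Complex.exp_sum]
      congr 1
      rw [Finset.sum_sub_distrib, ← Finset.sum_mul, ← Complex.ofReal_sum, ← Complex.ofReal_sum,
        ← Complex.ofReal_ofNat, ← Complex.ofReal_div]
      congr 3
      · simp only [V, Finset.mul_sum]
        refine Finset.sum_congr rfl fun i _ ↦ ?_
        have := (hp i).1.ne'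
        simp only [b]
        field_simp
      · simp only [X, Finset.mul_sum, Finset.sum_div]
        refine Finset.sum_congr rfl fun i _ ↦ ?_
        have := (hp i).1.ne'
        simp only [b, mul_pow, hsn]
        field_simp
    rw [hE]
    refine (norm_prod_sub_prod_le _ _ _ (fun i _ ↦ hc i) fun i _ ↦ ?_).trans ?_
    · rw [Complex.norm_exp]
      refine Real.exp_le_one_iff.2 ?_
      simp only [Complex.sub_re, Complex.mul_re, Complex.ofReal_re, Complex.I_re, mul_zero,
        Complex.ofReal_im, Complex.I_im, mul_one, sub_self, zero_sub, Left.neg_nonpos_iff]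
      have := (hp i).1.le
      positivity
    · simp only [Finset.mul_sum, ← Finset.sum_add_distrib]
      refine Finset.sum_le_sum fun i _ ↦ ?_
      obtain ⟨hp0, hp1⟩ := hp i
      have hb1 : π x.1 x.2 i * b x.1 i (Y x.1 x.2, π x.1 x.2) =
          √(n₀ x.1) * (N x.1 : ℝ)⁻¹ * u (Y x.1 x.2 i) := by
        have := hp0.ne'
        simp only [b]
        field_simp
      have hb2 : |b x.1 i (Y x.1 x.2, π x.1 x.2)| ≤ C * (√(n₀ x.1))⁻¹ * |u (Y x.1 x.2 i)| := by
        simp only [b, abs_mul]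
        rw [abs_of_pos hsp, abs_of_nonneg (hw i).1, abs_of_pos (inv_pos.2 hN'), ← mul_assoc]
        refine mul_le_mul_of_nonneg_right ?_ (abs_nonneg _)
        rw [← div_eq_mul_inv C, le_div_iff₀ hsp]
        calc √(n₀ x.1) * (N x.1 : ℝ)⁻¹ * (π x.1 x.2 i)⁻¹ * √(n₀ x.1)
            = √(n₀ x.1) ^ 2 * (N x.1 : ℝ)⁻¹ * (π x.1 x.2 i)⁻¹ := by ring
          _ ≤ C := by rw [hsn]; exact (hw i).2
      generalize b x.1 i (Y x.1 x.2, π x.1 x.2) = v at hb1 hb2 ⊢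
      generalize π x.1 x.2 i = q at hp0 hp1 hb1 ⊢
      generalize u (Y x.1 x.2 i) = t at hb1 hb2 ⊢
      have hv : q * |v| = √(n₀ x.1) * (N x.1 : ℝ)⁻¹ * |t| := by
        have := congrArg abs hb1
        rw [abs_mul, abs_mul, abs_of_pos hp0,
          abs_of_pos (mul_pos hsp (inv_pos.2 hN'))] at this
        exact this
      have hvsq : |v| ^ 2 ≤ C ^ 2 * (n₀ x.1)⁻¹ * |t| ^ 2 := by
        calc |v| ^ 2 ≤ (C * (√(n₀ x.1))⁻¹ * |t|) ^ 2 := pow_le_pow_left₀ (abs_nonneg _) hb2 2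
          _ = C ^ 2 * (√(n₀ x.1) ^ 2)⁻¹ * |t| ^ 2 := by rw [mul_pow, mul_pow, inv_pow]
          _ = _ := by rw [hsn]
      set ζ : ℂ := ((q * v : ℝ) : ℂ) * Complex.I - ((q * v ^ 2 / 2 : ℝ) : ℂ) with hζ
      have hζn : ‖ζ‖ ^ 2 = (q * |v|) ^ 2 + (q * |v| ^ 2 / 2) ^ 2 := by
        rw [← Complex.normSq_eq_norm_sq, Complex.normSq_apply, hζ]
        simp only [Complex.sub_re, Complex.mul_re, Complex.ofReal_re, Complex.I_re, mul_zero,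
          Complex.ofReal_im, Complex.I_im, mul_one, sub_self, zero_sub, Complex.sub_im,
          Complex.mul_im, sub_zero, add_zero]
        rw [mul_pow q |v|, sq_abs]
        ring
      have hζre : ζ.re ≤ 0 := by
        simp only [hζ, Complex.sub_re, Complex.mul_re, Complex.ofReal_re, Complex.I_re, mul_zero,
          Complex.ofReal_im, Complex.I_im, mul_one, sub_self, zero_sub, Left.neg_nonpos_iff]
        positivity
      have e : 1 - (q : ℂ) + q * Complex.exp ((v : ℂ) * Complex.I) - Complex.exp ζ =
          q * (Complex.exp ((v : ℂ) * Complex.I) - 1 - (v * Complex.I - (v : ℂ) ^ 2 / 2)) -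
            (Complex.exp ζ - 1 - ζ) := by
        rw [hζ]; push_cast; ring
      rw [e]
      refine (norm_sub_le _ _).trans ?_
      rw [norm_mul, Complex.norm_real, Real.norm_eq_abs, abs_of_pos hp0]
      have t1 := mul_le_mul_of_nonneg_left (norm_exp_mul_I_sub_sub_le v) hp0.le
      have t2 := norm_exp_sub_one_sub_le hζre
      rw [hζn] at t2
      have t3 : q * (4 * |v| ^ 3) ≤ 4 * C ^ 2 * ((√(n₀ x.1))⁻¹ * ((N x.1 : ℝ)⁻¹ * |t| ^ 3)) := by
        calc q * (4 * |v| ^ 3) = 4 * (q * |v|) * |v| ^ 2 := by ring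
          _ ≤ 4 * (√(n₀ x.1) * (N x.1 : ℝ)⁻¹ * |t|) * (C ^ 2 * (n₀ x.1)⁻¹ * |t| ^ 2) := by
            rw [hv]; gcongr
          _ = 4 * C ^ 2 * ((√(n₀ x.1))⁻¹ * ((N x.1 : ℝ)⁻¹ * |t| ^ 3)) := by
            rw [← Real.sq_sqrt hn.le, Real.sqrt_sq hsp.le]; field_simp
      have t4 : (q * |v|) ^ 2 = n₀ x.1 / N x.1 * ((N x.1 : ℝ)⁻¹ * |t| ^ 2) := by
        rw [hv, mul_pow, mul_pow, hsn]; field_simp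
      have t5 : (q * |v| ^ 2 / 2) ^ 2 ≤ C ^ 2 * ((N x.1 : ℝ)⁻¹ * ((N x.1 : ℝ)⁻¹ * |t| ^ 4)) := by
        calc (q * |v| ^ 2 / 2) ^ 2 = (q * |v|) ^ 2 * |v| ^ 2 / 4 := by ring
          _ ≤ (q * |v|) ^ 2 * |v| ^ 2 := by
            have : 0 ≤ (q * |v|) ^ 2 * |v| ^ 2 := by positivity
            linarith
          _ ≤ n₀ x.1 / N x.1 * ((N x.1 : ℝ)⁻¹ * |t| ^ 2) * (C ^ 2 * (n₀ x.1)⁻¹ * |t| ^ 2) := by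
            rw [t4]; gcongr
          _ = C ^ 2 * ((N x.1 : ℝ)⁻¹ * ((N x.1 : ℝ)⁻¹ * |t| ^ 4)) := by field_simp
      rw [t4] at t2
      linarith
  have hXm : ∀ ν, Measurable fun ω ↦ X ⟨ν, ω⟩ := fun ν ↦ by
    change Measurable fun ω ↦ n₀ ν * ((N ν : ℝ)⁻¹ ^ 2 * ∑ i, (π ν ω i)⁻¹ * u (Y ν ω i) ^ 2)
    have h1 := S.measurable_Y ν
    have h2 := S.measurable_π ν
    fun_prop
  have hDm : ∀ ν, Measurable fun ω ↦ D ⟨ν, ω⟩ := fun ν ↦ by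
    change Measurable fun ω ↦ ∏ i, (1 - (π ν ω i : ℂ) + π ν ω i *
      Complex.exp (((b ν i (Y ν ω, π ν ω) : ℝ) : ℂ) * Complex.I))
    have h1 := S.measurable_π ν
    have h2 : ∀ i, Measurable fun ω ↦ b ν i (Y ν ω, π ν ω) := fun i ↦
      (hbm ν i).comp (S.measurable_pair ν)
    refine Finset.measurable_prod _ fun i _ ↦ ?_
    have h3 : Measurable fun ω ↦ (π ν ω i : ℂ) := by fun_prop
    exact (measurable_const.sub h3).add (h3.mul (Complex.measurable_exp.comp
      ((Complex.measurable_ofReal.comp (h2 i)).mul_const _)))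
  have hX0 : ∀ᶠ ν in atTop, ∀ᵐ ω ∂P, 0 ≤ X ⟨ν, ω⟩ := by
    filter_upwards [S.eventually_pos_n₀] with ν hn
    filter_upwards [S.prob ν] with ω hp
    refine mul_nonneg hn.le (mul_nonneg (by positivity) (Finset.sum_nonneg fun i _ ↦ ?_))
    exact mul_nonneg (inv_pos.2 (hp i).1).le (sq_nonneg _)
  have hexpX : ∀ᶠ ν in atTop, ∀ᵐ ω ∂P, ‖((Real.exp (-(X ⟨ν, ω⟩ / 2)) : ℝ) : ℂ)‖ ≤ 1 := by
    filter_upwards [hX0] with ν h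
    filter_upwards [h] with ω hω
    rw [Complex.norm_real, Real.norm_eq_abs, abs_of_pos (Real.exp_pos _), Real.exp_le_one_iff]
    linarith
  have hdiff : Tendsto (fun x ↦ D x - ((Real.exp (-(X x / 2)) : ℝ) : ℂ)) (inProb P) (𝓝 0) := by
    rw [tendsto_zero_iff_norm_tendsto_zero]
    have hz := hDE.add (S.tendsto_exp_population_total hum hu2 hu0)
    rw [add_zero] at hz
    refine squeeze_zero' (Eventually.of_forall fun _ ↦ norm_nonneg _) ?_ hz
    filter_upwards [eventually_probFilter_of_ae (Q := fun x : Σ _ : ℕ, Ω ↦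
      ‖((Real.exp (-(X x / 2)) : ℝ) : ℂ)‖ ≤ 1) hexpX] with x hx
    have e : D x - ((Real.exp (-(X x / 2)) : ℝ) : ℂ) =
        (D x - Complex.exp (V x * Complex.I - (X x : ℂ) / 2)) +
          (Complex.exp (V x * Complex.I) - 1) * ((Real.exp (-(X x / 2)) : ℝ) : ℂ) := by
      rw [sub_mul, Complex.ofReal_exp, ← Complex.exp_add]
      push_cast
      ring_nf
    rw [e]
    refine (norm_add_le _ _).trans (add_le_add le_rfl ?_)
    rw [norm_mul]
    exact mul_le_of_le_one_right (norm_nonneg _) hx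
  have hcoef' : ∀ ν, ∀ᵐ ω ∂P, ‖D ⟨ν, ω⟩‖ ≤ 1 := fun ν ↦ by
    filter_upwards [S.prob ν] with ω hp
    change ‖∏ i, (1 - (π ν ω i : ℂ) + π ν ω i *
      Complex.exp (((b ν i (Y ν ω, π ν ω) : ℝ) : ℂ) * Complex.I))‖ ≤ 1
    rw [norm_prod]
    refine Finset.prod_le_one (fun i _ ↦ norm_nonneg _) fun i _ ↦ (norm_add_le _ _).trans ?_
    rw [norm_mul, Complex.norm_exp_ofReal_mul_I, mul_one, ← Complex.ofReal_one, ← Complex.ofReal_sub,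
      Complex.norm_real, Complex.norm_real, Real.norm_eq_abs, Real.norm_eq_abs,
      abs_of_nonneg (hp i).1.le, abs_of_nonneg (sub_nonneg.2 (hp i).2)]
    linarith
  have hEm : ∀ ν, Measurable fun ω ↦ ((Real.exp (-(X ⟨ν, ω⟩ / 2)) : ℝ) : ℂ) := fun ν ↦ by
    exact Complex.measurable_ofReal.comp (Real.measurable_exp.comp ((hXm ν).div_const 2).neg)
  have hlim := tendsto_integral_of_tendsto_probFilter (B := 2)
    (Eventually.of_forall fun _ ↦ inferInstance)
    (Eventually.of_forall fun ν ↦ ((hDm ν).sub (hEm ν)).aestronglyMeasurable)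
    (by
      filter_upwards [hexpX] with ν h
      filter_upwards [h, hcoef' ν] with ω h1 h2
      exact (norm_sub_le _ _).trans (by linarith)) hdiff
  refine hlim.congr' ?_
  filter_upwards [hexpX] with ν hν
  rw [integral_sub (Integrable.of_bound (hDm ν).aestronglyMeasurable 1 (hcoef' ν))
    (Integrable.of_bound (hEm ν).aestronglyMeasurable 1 hν)]
  congr 1
  have hform := integral_prod_sample (S.measurable_Y ν) (S.measurable_π ν) (S.prob ν) (S.sample ν)
    (z := fun i x ↦ Complex.exp (((b ν i x : ℝ) : ℂ) * Complex.I))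
    (fun i ↦ by have := hbm ν i; fun_prop)
    (Eventually.of_forall fun ω i ↦ (Complex.norm_exp_ofReal_mul_I _).le)
  change ∫ ω, ∏ i, (1 - (π ν ω i : ℂ) + π ν ω i *
      Complex.exp (((b ν i (Y ν ω, π ν ω) : ℝ) : ℂ) * Complex.I)) ∂P = _
  rw [← hform]
  congr 1
  funext ω
  rw [← Complex.exp_sum, ← Finset.sum_mul, ← Complex.ofReal_sum]
  congr 3
  simp only [b, Finset.mul_sum, mul_assoc]

/-- The conditional variance, given the population, of a weighted total of a centred variable
converges in probability. Since the inclusion probabilities may depend on the population in an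
arbitrary way, this is not a law of large numbers: it is forced by the asymptotic normality of the
total, a nondegenerate mixture of centred normal laws not being normal. -/
lemma tendsto_condVar (S : IsSamplingScheme ρ P N n₀ Y π A) (hum : Measurable u)
    (hu : MemLp u 4 ρ) (hu0 : ∫ y, u y ∂ρ = 0) {c : ℝ}
    (hvar : Tendsto (fun ν ↦ n₀ ν * ∫ ω, ((N ν : ℝ)⁻¹ * ∑ i ∈ A ν ω,
      (π ν ω i)⁻¹ * u (Y ν ω i)) ^ 2 ∂P) atTop (𝓝 c))
    (hchar : Tendsto (fun ν ↦ ∫ ω, Complex.exp (((√(n₀ ν) * ((N ν : ℝ)⁻¹ * ∑ i ∈ A ν ω,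
      (π ν ω i)⁻¹ * u (Y ν ω i)) : ℝ) : ℂ) * Complex.I) ∂P) atTop
      (𝓝 ((Real.exp (-(c / 2)) : ℝ) : ℂ))) :
    Tendsto (fun x : Σ _ : ℕ, Ω ↦ n₀ x.1 * ((N x.1 : ℝ)⁻¹ ^ 2 *
      ∑ i, (π x.1 x.2 i)⁻¹ * u (Y x.1 x.2 i) ^ 2)) (inProb P) (𝓝 c) := by
  have hu2 : MemLp u 2 ρ := hu.mono_exponent (by norm_num)
  have hlap : Tendsto (fun ν ↦ ∫ ω, Real.exp (-(n₀ ν * ((N ν : ℝ)⁻¹ ^ 2 *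
      ∑ i, (π ν ω i)⁻¹ * u (Y ν ω i) ^ 2) / 2)) ∂P) atTop (𝓝 (Real.exp (-(c / 2)))) := by
    have h := hchar.sub (S.tendsto_charFun_sub_laplace hum hu hu0)
    rw [sub_zero] at h
    have h2 := (Complex.continuous_re.tendsto _).comp h
    rw [Complex.ofReal_re] at h2
    refine h2.congr fun ν ↦ ?_
    simp only [Function.comp_apply, sub_sub_cancel]
    rw [integral_complex_ofReal, Complex.ofReal_re]
  have hvar2 := S.integral_condVar_le hum hu2
  have key := tendsto_probFilter_of_jensen (κ := fun _ ↦ P) (𝓕 := atTop)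
    (X := fun x : Σ _ : ℕ, Ω ↦ n₀ x.1 * ((N x.1 : ℝ)⁻¹ ^ 2 *
      ∑ i, (π x.1 x.2 i)⁻¹ * u (Y x.1 x.2 i) ^ 2) / 2) (c := c / 2)
    (b := fun ν ↦ (n₀ ν * ∫ ω, ((N ν : ℝ)⁻¹ * ∑ i ∈ A ν ω, (π ν ω i)⁻¹ * u (Y ν ω i)) ^ 2 ∂P +
      n₀ ν / N ν * ∫ y, u y ^ 2 ∂ρ) / 2)
    (Eventually.of_forall fun _ ↦ inferInstance) ?_ ?_ hlap ?_ ?_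
  · have := key.mul_const 2
    simpa using this
  · filter_upwards [hvar2] with ν h
    exact (h.1.const_mul _).div_const _
  · filter_upwards [S.eventually_pos_n₀] with ν hn
    filter_upwards [S.prob ν] with ω hp
    refine div_nonneg (mul_nonneg hn.le (mul_nonneg (by positivity)
      (Finset.sum_nonneg fun i _ ↦ ?_))) zero_le_two
    exact mul_nonneg (inv_pos.2 (hp i).1).le (sq_nonneg _)
  · filter_upwards [hvar2, S.eventually_pos_n₀] with ν h hn
    rw [integral_div, integral_const_mul]
    have := mul_le_mul_of_nonneg_left h.2 hn.le
    have e : n₀ ν / N ν * ∫ y, u y ^ 2 ∂ρ = n₀ ν * ((N ν : ℝ)⁻¹ * ∫ y, u y ^ 2 ∂ρ) := by ring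
    rw [e]
    linarith
  · have := (hvar.add (S.tendsto_fraction.mul_const (∫ y, u y ^ 2 ∂ρ))).div_const 2
    simpa using this

/-- The sample version of `tendsto_condVar`. -/
lemma tendsto_sample_condVar (S : IsSamplingScheme ρ P N n₀ Y π A) (hum : Measurable u)
    (hu : MemLp u 2 ρ) {c : ℝ}
    (h : Tendsto (fun x : Σ _ : ℕ, Ω ↦ n₀ x.1 * ((N x.1 : ℝ)⁻¹ ^ 2 *
      ∑ i, (π x.1 x.2 i)⁻¹ * u (Y x.1 x.2 i) ^ 2)) (inProb P) (𝓝 c)) :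
    Tendsto (fun x : Σ _ : ℕ, Ω ↦ n₀ x.1 * ((N x.1 : ℝ)⁻¹ ^ 2 *
      ∑ i ∈ A x.1 x.2, designWeight (π x.1 x.2) i ^ 2 * u (Y x.1 x.2 i) ^ 2)) (inProb P)
      (𝓝 c) := by
  obtain ⟨C, hC, hCb⟩ := S.exists_weight_bound
  have key := S.tendsto_weighted_of_nonneg (g := fun y ↦ u y ^ 2) (hum.pow_const 2)
    (fun y ↦ sq_nonneg _) hu.integrable_sq
    (r := fun ν i x ↦ |n₀ ν| * (N ν : ℝ)⁻¹ * (x.2 i)⁻¹) (B := C) (c := c)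
    (fun ν i ↦ by fun_prop) hC.le
    (fun ν ↦ (S.prob ν).mono fun ω hω i ↦
      mul_nonneg (by positivity) (inv_pos.2 (hω i).1).le)
    (by
      filter_upwards [hCb, S.eventually_pos_n₀] with ν h1 h2
      filter_upwards [h1] with ω hω i
      rw [abs_of_pos h2]
      exact (hω i).2)
    (by
      refine h.congr' ?_
      filter_upwards [eventually_fst S.eventually_pos_n₀] with x hx
      rw [abs_of_pos hx]
      simp only [Finset.mul_sum]
      exact Finset.sum_congr rfl fun i _ ↦ by ring)
  refine key.congr' ?_
  filter_upwards [eventually_fst S.eventually_pos_n₀] with x hx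
  rw [abs_of_pos hx]
  simp only [Finset.mul_sum, designWeight]
  exact Finset.sum_congr rfl fun i _ ↦ by ring

end IsSamplingScheme

end ConditionalCharacteristicFunction

/-! ### The bootstrap distribution -/

section BootLaw

variable {N : ℕ} {π : Fin N → ℝ} {A : Finset (Fin N)}

lemma selProb_nonneg (hπ : ∀ i, 0 < π i) (i : Fin N) : 0 ≤ selProb π A i := by
  unfold selProb designWeight
  split_ifs
  · exact div_nonneg (inv_pos.2 (hπ i)).le (Finset.sum_nonneg fun j _ ↦ (inv_pos.2 (hπ j)).le)
  · exact le_rfl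

lemma integral_binomial_pow (n : ℕ) (q : unitInterval) (z : ℂ) :
    ∫ m, z ^ m ∂(binomial n q) = (1 - (q : ℂ) + q * z) ^ n := by
  rw [integral_binomial, add_comm, add_pow, Nat.range_succ_eq_Iic]
  refine Finset.sum_congr rfl fun j _ ↦ ?_
  rw [Complex.real_smul]
  push_cast
  ring

/-- The generating function of the bootstrap counts. -/
lemma integral_bootLaw_prod (hπ : ∀ i, 0 < π i ∧ π i ≤ 1) {z : Fin N → ℂ} (hz : ∀ i, ‖z i‖ ≤ 1) :
    ∫ m, ∏ i, z i ^ m i ∂(bootLaw π A) =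
      (∑ i, (selProb π A i : ℂ) * (1 - (π i : ℂ) + π i * z i)) ^ N := by
  have hint : ∀ k : Fin N → ℕ, Integrable (fun m : Fin N → ℕ ↦ ∏ i, z i ^ m i)
      (Measure.pi fun i ↦ binomial (k i) (Set.projIcc 0 1 zero_le_one (π i))) := fun k ↦
    Integrable.of_bound (Measurable.of_discrete.aestronglyMeasurable) 1
      (Eventually.of_forall fun m ↦ by
        rw [norm_prod]
        refine Finset.prod_le_one (fun i _ ↦ norm_nonneg _) fun i _ ↦ ?_
        rw [norm_pow]
        exact pow_le_one₀ (norm_nonneg _) (hz i))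
  rw [bootLaw, integral_finsetSum_measure fun k _ ↦ (hint k).smul_measure ENNReal.ofReal_ne_top,
    Finset.sum_pow_eq_sum_piAntidiag]
  refine Finset.sum_congr rfl fun k _ ↦ ?_
  have hnn : 0 ≤ multinomialProb (selProb π A) k :=
    mul_nonneg (Nat.cast_nonneg _) (Finset.prod_nonneg fun i _ ↦
      pow_nonneg (selProb_nonneg (fun i ↦ (hπ i).1) i) _)
  have hproj : ∀ i, ((Set.projIcc (0 : ℝ) 1 zero_le_one (π i) : unitInterval) : ℝ) = π i := fun i ↦ by
    rw [Set.projIcc_of_mem zero_le_one ⟨(hπ i).1.le, (hπ i).2⟩]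
  rw [integral_smul_measure, ENNReal.toReal_ofReal hnn,
    integral_fintype_prod_eq_prod (𝕜 := ℂ) (fun i (m : ℕ) ↦ z i ^ m)]
  simp_rw [integral_binomial_pow, hproj]
  rw [Complex.real_smul, multinomialProb]
  push_cast
  simp_rw [mul_pow]
  rw [Finset.prod_mul_distrib]
  ring

lemma sum_designWeight_pos (hπ : ∀ i, 0 < π i) (hA : A.Nonempty) :
    0 < ∑ i ∈ A, designWeight π i :=
  Finset.sum_pos (fun i _ ↦ inv_pos.2 (hπ i)) hA

lemma sum_selProb_mul (hπ : ∀ i, 0 < π i) (hA : A.Nonempty) (z : Fin N → ℂ) :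
    ∑ i, (selProb π A i : ℂ) * (1 - (π i : ℂ) + π i * z i) =
      1 + ((∑ i ∈ A, designWeight π i : ℝ) : ℂ)⁻¹ * ∑ i ∈ A, (z i - 1) := by
  have hW := sum_designWeight_pos hπ hA
  have hW' : ((∑ i ∈ A, designWeight π i : ℝ) : ℂ) ≠ 0 := by exact_mod_cast hW.ne'
  rw [← Finset.sum_subset (Finset.subset_univ A) fun i _ hi ↦ by simp [selProb, hi]]
  have e : ∀ i ∈ A, (selProb π A i : ℂ) * (1 - (π i : ℂ) + π i * z i) =
      ((∑ i ∈ A, designWeight π i : ℝ) : ℂ)⁻¹ * (designWeight π i : ℂ) +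
        ((∑ i ∈ A, designWeight π i : ℝ) : ℂ)⁻¹ * (z i - 1) := by
    intro i hi
    have h0 : (π i : ℂ) ≠ 0 := by exact_mod_cast (hπ i).ne'
    simp only [selProb, if_pos hi]
    generalize (∑ i ∈ A, designWeight π i) = W at hW'
    simp only [designWeight]
    push_cast
    field_simp
    ring
  rw [Finset.sum_congr rfl e, Finset.sum_add_distrib, ← Finset.mul_sum, ← Finset.mul_sum,
    ← Complex.ofReal_sum, inv_mul_cancel₀ hW']

lemma norm_one_add_mean_le (hπ : ∀ i, 0 < π i ∧ π i ≤ 1) (hA : A.Nonempty) {z : Fin N → ℂ}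
    (hz : ∀ i ∈ A, ‖z i‖ ≤ 1) :
    ‖1 + ((∑ i ∈ A, designWeight π i : ℝ) : ℂ)⁻¹ * ∑ i ∈ A, (z i - 1)‖ ≤ 1 := by
  have hW := sum_designWeight_pos (fun i ↦ (hπ i).1) hA
  have hsel : ∑ i ∈ A, selProb π A i = 1 := by
    have : ∀ i ∈ A, selProb π A i = designWeight π i / ∑ j ∈ A, designWeight π j :=
      fun i hi ↦ by simp [selProb, hi]
    rw [Finset.sum_congr rfl this, ← Finset.sum_div, div_self hW.ne']
  rw [← sum_selProb_mul (fun i ↦ (hπ i).1) hA,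
    ← Finset.sum_subset (Finset.subset_univ A) fun i _ hi ↦ by simp [selProb, hi], ← hsel]
  refine (norm_sum_le _ _).trans (Finset.sum_le_sum fun i hi ↦ ?_)
  have h0 := selProb_nonneg (A := A) (fun i ↦ (hπ i).1) i
  rw [norm_mul, Complex.norm_real, Real.norm_eq_abs, abs_of_nonneg h0]
  refine mul_le_of_le_one_right h0 ((norm_add_le _ _).trans ?_)
  rw [norm_mul, ← Complex.ofReal_one, ← Complex.ofReal_sub, Complex.norm_real, Complex.norm_real,
    Real.norm_eq_abs, Real.norm_eq_abs, abs_of_nonneg (hπ i).1.le,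
    abs_of_nonneg (sub_nonneg.2 (hπ i).2)]
  have := mul_le_mul_of_nonneg_left (hz i hi) (hπ i).1.le
  linarith

/-- The Fourier–Laplace transform of linear statistics of the bootstrap counts. -/
lemma integral_exp_bootLaw (hπ : ∀ i, 0 < π i ∧ π i ≤ 1) (hA : A.Nonempty) {c : Fin N → ℂ}
    (hc : ∀ i ∈ A, (c i).re ≤ 0) :
    ∫ m, Complex.exp (∑ i ∈ A, c i * m i) ∂(bootLaw π A) =
      (1 + ((∑ i ∈ A, designWeight π i : ℝ) : ℂ)⁻¹ * ∑ i ∈ A, (Complex.exp (c i) - 1)) ^ N := by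
  have hz : ∀ i, ‖if i ∈ A then Complex.exp (c i) else 1‖ ≤ 1 := fun i ↦ by
    split_ifs with h
    · rw [Complex.norm_exp]; exact Real.exp_le_one_iff.2 (hc i h)
    · simp
  have h := integral_bootLaw_prod (A := A) hπ hz
  rw [sum_selProb_mul (fun i ↦ (hπ i).1) hA] at h
  have e : ∑ i ∈ A, ((if i ∈ A then Complex.exp (c i) else 1) - 1) =
      ∑ i ∈ A, (Complex.exp (c i) - 1) := Finset.sum_congr rfl fun i hi ↦ by rw [if_pos hi]
  rw [e] at h
  rw [← h]
  congr 1
  funext m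
  rw [Complex.exp_sum, ← Finset.prod_subset (Finset.subset_univ A) fun i _ hi ↦ by simp [hi]]
  refine Finset.prod_congr rfl fun i hi ↦ ?_
  rw [if_pos hi, mul_comm, Complex.exp_nat_mul]

instance isFiniteMeasure_bootLaw (π : Fin N → ℝ) (A : Finset (Fin N)) :
    IsFiniteMeasure (bootLaw π A) := by
  refine ⟨?_⟩
  rw [bootLaw, Measure.finsetSum_apply]
  exact ENNReal.sum_lt_top.2 fun k _ ↦ by
    rw [Measure.smul_apply, smul_eq_mul]
    exact ENNReal.mul_lt_top ENNReal.ofReal_lt_top (measure_lt_top _ _)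

lemma isProbabilityMeasure_bootLaw (hπ : ∀ i, 0 < π i ∧ π i ≤ 1) (hA : A.Nonempty) :
    IsProbabilityMeasure (bootLaw π A) := by
  have h := integral_exp_bootLaw hπ hA (c := fun _ ↦ 0) (fun _ _ ↦ by simp)
  simp only [zero_mul, Finset.sum_const_zero, Complex.exp_zero, integral_const, sub_self, mul_zero,
    add_zero, one_pow, Complex.real_smul, mul_one] at h
  have h1 : (bootLaw π A).real univ = 1 := by exact_mod_cast h
  refine ⟨?_⟩
  rw [← ENNReal.toReal_eq_one_iff]
  exact h1

/-- The limit of Fourier–Laplace transforms of linear statistics of the bootstrap counts: the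
multinomial and binomial draws behave like compound Poisson variables. -/
lemma tendsto_integral_exp_bootLaw {Z : Type*} {𝓕 : Filter Z} {N : Z → ℕ}
    {π : ∀ z, Fin (N z) → ℝ} {A : ∀ z, Finset (Fin (N z))} {c : ∀ z, Fin (N z) → ℂ} {ζ : Z → ℂ}
    {K : ℝ} (hN : Tendsto N 𝓕 atTop) (hπ : ∀ᶠ z in 𝓕, ∀ i, 0 < π z i ∧ π z i ≤ 1)
    (hA : ∀ᶠ z in 𝓕, (A z).Nonempty) (hc : ∀ᶠ z in 𝓕, ∀ i ∈ A z, (c z i).re ≤ 0)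
    (hζ : ∀ᶠ z in 𝓕, (ζ z).re ≤ 0 ∧ ‖ζ z‖ ≤ K)
    (hlim : Tendsto (fun z ↦ (N z : ℂ) * (((∑ i ∈ A z, designWeight (π z) i : ℝ) : ℂ)⁻¹ *
      ∑ i ∈ A z, (Complex.exp (c z i) - 1)) - ζ z) 𝓕 (𝓝 0)) :
    Tendsto (fun z ↦ ∫ m, Complex.exp (∑ i ∈ A z, c z i * m i) ∂(bootLaw (π z) (A z)) -
      Complex.exp (ζ z)) 𝓕 (𝓝 0) := by
  rw [tendsto_zero_iff_norm_tendsto_zero] at hlim ⊢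
  have hNinv : Tendsto (fun z ↦ 3 * K ^ 2 * (N z : ℝ)⁻¹) 𝓕 (𝓝 0) := by
    have := ((tendsto_inv_atTop_zero.comp
      (tendsto_natCast_atTop_atTop (R := ℝ))).comp hN).const_mul (3 * K ^ 2)
    simpa using this
  have hz := hlim.add hNinv
  rw [add_zero] at hz
  refine squeeze_zero' (Eventually.of_forall fun _ ↦ norm_nonneg _) ?_ hz
  filter_upwards [hπ, hA, hc, hζ, hN.eventually_gt_atTop 0] with z h1 h2 h3 h4 h5
  have hN' : (0 : ℝ) < N z := by exact_mod_cast h5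
  have hNc : (N z : ℂ) ≠ 0 := by exact_mod_cast h5.ne'
  rw [integral_exp_bootLaw h1 h2 h3]
  have e1 : Complex.exp (ζ z) = Complex.exp (ζ z / N z) ^ N z := by
    rw [← Complex.exp_nat_mul]; congr 1; field_simp
  have hre : (ζ z / N z).re ≤ 0 := by
    rw [Complex.div_natCast_re]
    exact div_nonpos_of_nonpos_of_nonneg h4.1 hN'.le
  have hb : ‖Complex.exp (ζ z / N z)‖ ≤ 1 := by
    rw [Complex.norm_exp]; exact Real.exp_le_one_iff.2 hre
  have ha := norm_one_add_mean_le h1 h2 (z := fun i ↦ Complex.exp (c z i)) fun i hi ↦ by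
    rw [Complex.norm_exp]; exact Real.exp_le_one_iff.2 (h3 i hi)
  rw [e1]
  refine (norm_pow_sub_pow_le ha hb (N z)).trans ?_
  set D := ((∑ i ∈ A z, designWeight (π z) i : ℝ) : ℂ)⁻¹ * ∑ i ∈ A z, (Complex.exp (c z i) - 1)
  have e2 : 1 + D - Complex.exp (ζ z / N z) = (N z : ℂ)⁻¹ * (N z * D - ζ z) -
      (Complex.exp (ζ z / N z) - 1 - ζ z / N z) := by
    field_simp
    ring
  rw [e2]
  have t1 := norm_exp_sub_one_sub_le hre
  have t2 : ‖(N z : ℂ)⁻¹ * (N z * D - ζ z)‖ = (N z : ℝ)⁻¹ * ‖N z * D - ζ z‖ := by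
    rw [norm_mul, norm_inv, Complex.norm_natCast]
  have t3 : ‖ζ z / N z‖ ^ 2 ≤ K ^ 2 * (N z : ℝ)⁻¹ ^ 2 := by
    rw [norm_div, Complex.norm_natCast, div_pow, div_eq_mul_inv, inv_pow]
    gcongr
    exact h4.2
  calc (N z : ℝ) * ‖(N z : ℂ)⁻¹ * (N z * D - ζ z) - (Complex.exp (ζ z / N z) - 1 - ζ z / N z)‖
      ≤ N z * ((N z : ℝ)⁻¹ * ‖N z * D - ζ z‖ + 3 * (K ^ 2 * (N z : ℝ)⁻¹ ^ 2)) := by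
        refine mul_le_mul_of_nonneg_left ((norm_sub_le _ _).trans ?_) hN'.le
        rw [t2]
        linarith
    _ = ‖N z * D - ζ z‖ + 3 * K ^ 2 * (N z : ℝ)⁻¹ := by field_simp

end BootLaw

section BootstrapLawOfLargeNumbers

namespace IsSamplingScheme

variable {𝒴 Ω : Type*} [MeasurableSpace 𝒴] [MeasurableSpace Ω]
  {ρ : Measure 𝒴} {P : Measure Ω} [IsProbabilityMeasure ρ] [IsProbabilityMeasure P]
  {N : ℕ → ℕ} {n₀ : ℕ → ℝ} {Y : (ν : ℕ) → Ω → Fin (N ν) → 𝒴} {π : (ν : ℕ) → Ω → Fin (N ν) → ℝ}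
  {A : (ν : ℕ) → Ω → Finset (Fin (N ν))}

lemma eventually_nonempty (S : IsSamplingScheme ρ P N n₀ Y π A) :
    ∀ᶠ x in inProb P, (A x.1 x.2).Nonempty := by
  filter_upwards [(tendsto_order.1 S.tendsto_sum_weight).1 0 one_pos] with x hx
  by_contra h
  rw [Finset.not_nonempty_iff_eq_empty] at h
  simp [h] at hx

lemma eventually_isProbabilityMeasure (S : IsSamplingScheme ρ P N n₀ Y π A) :
    ∀ᶠ x in inProb P, IsProbabilityMeasure (bootLaw (π x.1 x.2) (A x.1 x.2)) := by
  filter_upwards [S.eventually_prob, S.eventually_nonempty] with x h1 h2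
  exact isProbabilityMeasure_bootLaw h1 h2

lemma tendsto_N_inProb (S : IsSamplingScheme ρ P N n₀ Y π A) :
    Tendsto (fun x : Σ _ : ℕ, Ω ↦ N x.1) (inProb P) atTop := S.tendsto_N.comp tendsto_fst_probFilter

lemma tendsto_n₀_inProb (S : IsSamplingScheme ρ P N n₀ Y π A) :
    Tendsto (fun x : Σ _ : ℕ, Ω ↦ n₀ x.1) (inProb P) atTop :=
  S.tendsto_n₀.comp tendsto_fst_probFilter

lemma exists_weight_bound_inProb (S : IsSamplingScheme ρ P N n₀ Y π A) :
    ∃ C : ℝ, 0 < C ∧ ∀ᶠ x in inProb P, ∀ i, 0 ≤ (π x.1 x.2 i)⁻¹ ∧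
      n₀ x.1 * (N x.1 : ℝ)⁻¹ * (π x.1 x.2 i)⁻¹ ≤ C := by
  obtain ⟨C, hC, h⟩ := S.exists_weight_bound
  exact ⟨C, hC, eventually_probFilter_of_ae (Q := fun x : Σ _ : ℕ, Ω ↦ ∀ i, 0 ≤ (π x.1 x.2 i)⁻¹ ∧
    n₀ x.1 * (N x.1 : ℝ)⁻¹ * (π x.1 x.2 i)⁻¹ ≤ C) h⟩

/-- The law of large numbers for the bootstrap, in bootstrap probability. -/
lemma tendsto_bootstrap (S : IsSamplingScheme ρ P N n₀ Y π A) {g : 𝒴 → ℝ} (hg : Integrable g ρ) :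
    Tendsto (fun x : Σ z : (Σ _ : ℕ, Ω), (Fin (N z.1) → ℕ) ↦ (N x.1.1 : ℝ)⁻¹ *
        ∑ i ∈ A x.1.1 x.1.2, bootWeight (π x.1.1 x.1.2) x.2 i * g (Y x.1.1 x.1.2 i))
      (probFilter (inProb P) fun z ↦ bootLaw (π z.1 z.2) (A z.1 z.2)) (𝓝 (∫ y, g y ∂ρ)) := by
  refine tendsto_of_nonneg_measurable
    (fun (h : 𝒴 → ℝ) (x : Σ z : (Σ _ : ℕ, Ω), (Fin (N z.1) → ℕ)) ↦ (N x.1.1 : ℝ)⁻¹ *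
        ∑ i ∈ A x.1.1 x.1.2, bootWeight (π x.1.1 x.1.2) x.2 i * h (Y x.1.1 x.1.2 i))
    (fun g h x ↦ ?_) (fun g h hgh ↦ ?_) (fun g hgm hg0 hg ↦ ?_) hg
  · simp only [Finset.sum_sub_distrib, mul_sub]
  · have := tendsto_fst_probFilter (κ := fun z : (Σ _ : ℕ, Ω) ↦ bootLaw (π z.1 z.2) (A z.1 z.2))
      |>.eventually (ae_inProb (Q := fun x : Σ _ : ℕ, Ω ↦ ∀ i, g (Y x.1 x.2 i) = h (Y x.1 x.2 i))
      fun ν ↦ S.ae_units hgh ν)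
    filter_upwards [this] with x hx
    simp_rw [hx]
  refine tendsto_probFilter_of_laplace S.eventually_isProbabilityMeasure
    (Eventually.of_forall fun z ↦ Measurable.of_discrete.aestronglyMeasurable)
    ?_ fun k hk ↦ ?_
  · filter_upwards [S.eventually_prob] with z hz
    refine Eventually.of_forall fun m ↦ mul_nonneg (by positivity) (Finset.sum_nonneg fun i _ ↦ ?_)
    exact mul_nonneg (mul_nonneg (inv_pos.2 (hz i).1).le (by positivity)) (hg0 _)
  obtain ⟨C, hC, hCb⟩ := S.exists_weight_bound_inProb
  let a : ∀ z : (Σ _ : ℕ, Ω), Fin (N z.1) → ℝ := fun z i ↦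
    k * ((N z.1 : ℝ)⁻¹ * (designWeight (π z.1 z.2) i * g (Y z.1 z.2 i)))
  have ha0 : ∀ᶠ z in inProb P, ∀ i, 0 ≤ a z i := by
    filter_upwards [S.eventually_prob] with z hz i
    exact mul_nonneg hk.le (mul_nonneg (by positivity)
      (mul_nonneg (inv_pos.2 (hz i).1).le (hg0 _)))
  have hsum : Tendsto (fun z ↦ ∑ i ∈ A z.1 z.2, a z i) (inProb P) (𝓝 (k * ∫ y, g y ∂ρ)) := by
    refine ((S.tendsto_weighted hg).const_mul k).congr fun z ↦ ?_
    simp only [a, Finset.mul_sum]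
  -- the Laplace exponent is asymptotically linear
  have herr : Tendsto (fun z ↦ ∑ i ∈ A z.1 z.2, |1 - Real.exp (-(a z i)) - a z i|)
      (inProb P) (𝓝 0) := by
    refine tendsto_zero_of_truncation (ρ := ρ) (g := fun y ↦ k * g y) (by fun_prop)
      (fun y ↦ mul_nonneg hk.le (hg0 y)) (hg.const_mul k)
      (fun (h : 𝒴 → ℝ) (x : Σ _ : ℕ, Ω) ↦ (N x.1 : ℝ)⁻¹ * ∑ i ∈ A x.1 x.2,
        designWeight (π x.1 x.2) i * h (Y x.1 x.2 i))
      (fun h hm h0 hi ↦ S.tendsto_weighted hi)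
      (m := fun x ↦ n₀ x.1) S.tendsto_n₀_inProb hC.le
      (Eventually.of_forall fun z ↦ Finset.sum_nonneg fun i _ ↦ abs_nonneg _) fun M hM ↦ ?_
    filter_upwards [S.eventually_prob, ha0, hCb] with z hp h0 hw hMz
    rw [Finset.mul_sum]
    refine Finset.sum_le_sum fun i _ ↦ (abs_exp_neg_sub_le (h0 i)).trans ?_
    have e1 : min (a z i) (a z i ^ 2) = a z i * min 1 (a z i) := by
      rw [mul_min_of_nonneg _ _ (h0 i), mul_one, sq]
    have hb : a z i ≤ C / M * (k * g (Y z.1 z.2 i)) := by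
      have hw' : (N z.1 : ℝ)⁻¹ * (π z.1 z.2 i)⁻¹ ≤ C / M := by
        rw [le_div_iff₀ hM]
        refine le_trans ?_ (hw i).2
        rw [mul_comm, mul_assoc]
        exact mul_le_mul_of_nonneg_right hMz (mul_nonneg (by positivity) (hw i).1)
      calc a z i = ((N z.1 : ℝ)⁻¹ * (π z.1 z.2 i)⁻¹) * (k * g (Y z.1 z.2 i)) := by
            simp only [a, designWeight]; ring
        _ ≤ _ := mul_le_mul_of_nonneg_right hw' (mul_nonneg hk.le (hg0 _))
    rw [e1]
    calc a z i * min 1 (a z i) ≤ a z i * min 1 (C / M * (k * g (Y z.1 z.2 i))) :=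
          mul_le_mul_of_nonneg_left (min_le_min le_rfl hb) (h0 i)
      _ = _ := by simp only [a]; ring
  have hlin : Tendsto (fun z ↦ ∑ i ∈ A z.1 z.2, (Real.exp (-(a z i)) - 1)) (inProb P)
      (𝓝 (-(k * ∫ y, g y ∂ρ))) := by
    refine tendsto_of_tendsto_of_dist hsum.neg ?_
    refine squeeze_zero (fun _ ↦ dist_nonneg) (fun z ↦ ?_) herr
    rw [Real.dist_eq, ← Finset.sum_neg_distrib, ← Finset.sum_sub_distrib]
    refine (Finset.abs_sum_le_sum_abs _ _).trans (Finset.sum_le_sum fun i _ ↦ le_of_eq ?_)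
    congr 1
    ring
  have hW : Tendsto (fun z : Σ _ : ℕ, Ω ↦ (N z.1 : ℝ) *
      (∑ i ∈ A z.1 z.2, designWeight (π z.1 z.2) i)⁻¹) (inProb P) (𝓝 1) := by
    have := S.tendsto_sum_weight.inv₀ one_ne_zero
    simpa [mul_inv, mul_comm] using this
  have hlim := tendsto_integral_exp_bootLaw (𝓕 := inProb P) (N := fun z ↦ N z.1)
    (π := fun z ↦ π z.1 z.2) (A := fun z ↦ A z.1 z.2) (c := fun z i ↦ ((-(a z i) : ℝ) : ℂ))
    (ζ := fun _ ↦ ((-(k * ∫ y, g y ∂ρ) : ℝ) : ℂ)) (K := |k * ∫ y, g y ∂ρ|) S.tendsto_N_inProb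
    S.eventually_prob S.eventually_nonempty
    (by
      filter_upwards [ha0] with z hz i _
      rw [Complex.ofReal_re]
      linarith [hz i])
    (Eventually.of_forall fun z ↦ by
      rw [Complex.ofReal_re, Complex.norm_real, Real.norm_eq_abs, abs_neg]
      exact ⟨by have : 0 ≤ ∫ y, g y ∂ρ := integral_nonneg hg0; simp only [Left.neg_nonpos_iff]; positivity,
        le_rfl⟩)
    (by
      have h := (hW.mul hlin).sub_const (-(k * ∫ y, g y ∂ρ))
      rw [one_mul, sub_self] at h
      have h2 := (Complex.continuous_ofReal.tendsto _).comp h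
      rw [Complex.ofReal_zero] at h2
      refine h2.congr fun z ↦ ?_
      simp only [Function.comp_apply]
      push_cast
      ring)
  have hre := (Complex.continuous_re.tendsto _).comp (hlim.add_const
    (Complex.exp ((-(k * ∫ y, g y ∂ρ) : ℝ) : ℂ)))
  rw [zero_add, ← Complex.ofReal_exp, Complex.ofReal_re] at hre
  refine hre.congr fun z ↦ ?_
  simp only [Function.comp_apply, sub_add_cancel]
  have e : ∀ m : Fin (N z.1) → ℕ, Complex.exp (∑ i ∈ A z.1 z.2, ((-(a z i) : ℝ) : ℂ) * m i) =
      ((Real.exp (-(k * ((N z.1 : ℝ)⁻¹ * ∑ i ∈ A z.1 z.2,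
        bootWeight (π z.1 z.2) m i * g (Y z.1 z.2 i)))) : ℝ) : ℂ) := fun m ↦ by
    rw [Complex.ofReal_exp]
    congr 1
    simp only [Finset.mul_sum, ← Finset.sum_neg_distrib]
    push_cast
    refine Finset.sum_congr rfl fun i _ ↦ ?_
    simp only [a, bootWeight]
    push_cast
    ring
  simp_rw [e]
  rw [integral_complex_ofReal, Complex.ofReal_re]

end IsSamplingScheme

end BootstrapLawOfLargeNumbers

/-! ### The bootstrap central limit theorem -/

section BootstrapCentralLimit

variable {p : ℕ}

/-- The bootstrap fluctuation `√n₀ N⁻¹ ∑_{i ∈ A} (wᵢ* - wᵢ) vᵢ` of a weighted sum of vectors. -/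
noncomputable def bootFluct {N : ℕ} (n₀ : ℝ) (π : Fin N → ℝ) (A : Finset (Fin N))
    (v : Fin N → EuclideanSpace ℝ (Fin p)) (m : Fin N → ℕ) : EuclideanSpace ℝ (Fin p) :=
  √n₀ • ((N : ℝ)⁻¹ • ∑ i ∈ A, bootWeight π m i • v i -
    (N : ℝ)⁻¹ • ∑ i ∈ A, designWeight π i • v i)

variable {Z : Type*} {𝓕 : Filter Z} {N : Z → ℕ} {n₀ : Z → ℝ} {π : ∀ z, Fin (N z) → ℝ}
  {A : ∀ z, Finset (Fin (N z))} {v : ∀ z, Fin (N z) → EuclideanSpace ℝ (Fin p)}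

lemma integral_exp_bootFluct {N : ℕ} (n₀ : ℝ) (π : Fin N → ℝ) (A : Finset (Fin N))
    (v : Fin N → EuclideanSpace ℝ (Fin p)) (t : EuclideanSpace ℝ (Fin p)) :
    ∫ m, Complex.exp (inner ℝ (bootFluct n₀ π A v m) t * Complex.I) ∂(bootLaw π A) =
      Complex.exp (-(inner ℝ (√n₀ • (N : ℝ)⁻¹ • ∑ i ∈ A, designWeight π i • v i) t
        * Complex.I)) *
      ∫ m, Complex.exp (∑ i ∈ A, ((√n₀ * ((N : ℝ)⁻¹ * (designWeight π i * inner ℝ (v i) t)) : ℝ) *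
        Complex.I) * m i) ∂(bootLaw π A) := by
  rw [← integral_const_mul]
  congr 1
  funext m
  rw [← Complex.exp_add]
  congr 1
  simp only [bootFluct, inner_smul_left, inner_sub_left, sum_inner, bootWeight, smul_sub,
    conj_trivial]
  push_cast
  simp only [Finset.mul_sum, Finset.sum_mul, sub_mul]
  rw [sub_eq_add_neg, add_comm]
  congr 1
  exact Finset.sum_congr rfl fun i _ ↦ by ring

lemma tendsto_charFun_bootFluct {q C T K : ℝ} (t : EuclideanSpace ℝ (Fin p))
    (hN : Tendsto N 𝓕 atTop) (hn₀ : Tendsto n₀ 𝓕 atTop)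
    (hπ : ∀ᶠ z in 𝓕, ∀ i, 0 < π z i ∧ π z i ≤ 1)
    (hC : ∀ᶠ z in 𝓕, ∀ i, n₀ z * (N z : ℝ)⁻¹ * (π z i)⁻¹ ≤ C)
    (hA : ∀ᶠ z in 𝓕, (A z).Nonempty)
    (hW : Tendsto (fun z ↦ (N z : ℝ)⁻¹ * ∑ i ∈ A z, designWeight (π z) i) 𝓕 (𝓝 1))
    (hT : Tendsto (fun z ↦ (N z : ℝ)⁻¹ * ∑ i ∈ A z, designWeight (π z) i * ‖v z i‖ ^ 3) 𝓕 (𝓝 T))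
    (hr : ∀ᶠ z in 𝓕, ‖√(n₀ z) • (N z : ℝ)⁻¹ • ∑ i ∈ A z, designWeight (π z) i • v z i‖ ≤ K)
    (hq0 : 0 ≤ q)
    (hq : Tendsto (fun z ↦ n₀ z * ((N z : ℝ)⁻¹ ^ 2 *
      ∑ i ∈ A z, designWeight (π z) i ^ 2 * inner ℝ (v z i) t ^ 2)) 𝓕 (𝓝 q)) :
    Tendsto (fun z ↦ ∫ m, Complex.exp (inner ℝ (bootFluct (n₀ z) (π z) (A z) (v z) m) t *
      Complex.I) ∂(bootLaw (π z) (A z))) 𝓕 (𝓝 (Complex.exp (-(q / 2) : ℝ))) := by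
  set r : Z → EuclideanSpace ℝ (Fin p) := fun z ↦
    √(n₀ z) • (N z : ℝ)⁻¹ • ∑ i ∈ A z, designWeight (π z) i • v z i with hrdef
  let b : ∀ z, Fin (N z) → ℝ := fun z i ↦
    √(n₀ z) * ((N z : ℝ)⁻¹ * (designWeight (π z) i * inner ℝ (v z i) t))
  have hb1 : ∀ z, ∑ i ∈ A z, b z i = inner ℝ (r z) t := fun z ↦ by
    simp only [b, hrdef, inner_smul_left, sum_inner, conj_trivial, Finset.mul_sum]
  have hb2 : ∀ᶠ z in 𝓕, ∑ i ∈ A z, b z i ^ 2 = n₀ z * ((N z : ℝ)⁻¹ ^ 2 *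
      ∑ i ∈ A z, designWeight (π z) i ^ 2 * inner ℝ (v z i) t ^ 2) := by
    filter_upwards [hn₀.eventually_ge_atTop 0] with z hz
    simp only [Finset.mul_sum, b]
    refine Finset.sum_congr rfl fun i _ ↦ ?_
    rw [mul_pow, Real.sq_sqrt hz]
    ring
  -- the third absolute moments are negligible, by boundedness of the weights
  have hb3 : Tendsto (fun z ↦ ∑ i ∈ A z, |b z i| ^ 3) 𝓕 (𝓝 0) := by
    have hs : Tendsto (fun z ↦ (√(n₀ z))⁻¹) 𝓕 (𝓝 0) :=
      tendsto_inv_atTop_zero.comp (Real.tendsto_sqrt_atTop.comp hn₀)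
    have hlim := (hs.mul hT).const_mul (C ^ 2 * ‖t‖ ^ 3)
    rw [zero_mul, mul_zero] at hlim
    refine squeeze_zero' (Eventually.of_forall fun z ↦ Finset.sum_nonneg fun i _ ↦ by positivity)
      ?_ hlim
    filter_upwards [hn₀.eventually_gt_atTop 0, hπ, hC] with z h0 hp hCz
    simp only [Finset.mul_sum]
    refine Finset.sum_le_sum fun i _ ↦ ?_
    have hw : 0 < designWeight (π z) i := inv_pos.2 (hp i).1
    have hs0 : 0 < √(n₀ z) := Real.sqrt_pos.2 h0
    have hx : |inner ℝ (v z i) t| ≤ ‖v z i‖ * ‖t‖ := abs_real_inner_le_norm _ _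
    have hcw : (n₀ z * (N z : ℝ)⁻¹ * designWeight (π z) i) ^ 2 ≤ C ^ 2 :=
      pow_le_pow_left₀ (by positivity) (hCz i) 2
    have e : |b z i| ^ 3 = (n₀ z * (N z : ℝ)⁻¹ * designWeight (π z) i) ^ 2 * ((√(n₀ z))⁻¹ *
        ((N z : ℝ)⁻¹ * (designWeight (π z) i * |inner ℝ (v z i) t| ^ 3))) := by
      simp only [b, abs_mul, abs_of_pos hw, abs_of_pos hs0, abs_inv, Nat.abs_cast]
      have : n₀ z = √(n₀ z) ^ 2 := (Real.sq_sqrt h0.le).symm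
      rw [show n₀ z * (N z : ℝ)⁻¹ * designWeight (π z) i =
        √(n₀ z) ^ 2 * (N z : ℝ)⁻¹ * designWeight (π z) i by rw [← this]]
      field_simp
    rw [e]
    calc _ ≤ C ^ 2 * ((√(n₀ z))⁻¹ * ((N z : ℝ)⁻¹ * (designWeight (π z) i *
          (‖v z i‖ * ‖t‖) ^ 3))) := by gcongr
      _ = _ := by ring
  have ha : Tendsto (fun z ↦ (N z : ℝ) * (∑ i ∈ A z, designWeight (π z) i)⁻¹) 𝓕 (𝓝 1) := by
    have := hW.inv₀ one_ne_zero
    simpa [mul_inv, mul_comm] using this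
  have hrt : ∀ᶠ z in 𝓕, |inner ℝ (r z) t| ≤ K * ‖t‖ := by
    filter_upwards [hr] with z hz
    exact (abs_real_inner_le_norm _ _).trans (mul_le_mul_of_nonneg_right hz (norm_nonneg _))
  let ζ : Z → ℂ := fun z ↦ (inner ℝ (r z) t : ℝ) * Complex.I - ((q / 2 : ℝ) : ℂ)
  have hE : Tendsto (fun z ↦ ∑ i ∈ A z, (Complex.exp (b z i * Complex.I) - 1 -
      (b z i * Complex.I - (b z i : ℂ) ^ 2 / 2))) 𝓕 (𝓝 0) := by
    refine squeeze_zero_norm (fun z ↦ ?_) (by simpa using hb3.const_mul 4)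
    rw [Finset.mul_sum]
    exact (norm_sum_le _ _).trans (Finset.sum_le_sum fun i _ ↦ norm_exp_mul_I_sub_sub_le _)
  have hlim : Tendsto (fun z ↦ (N z : ℂ) * (((∑ i ∈ A z, designWeight (π z) i : ℝ) : ℂ)⁻¹ *
      ∑ i ∈ A z, (Complex.exp (b z i * Complex.I) - 1)) - ζ z) 𝓕 (𝓝 0) := by
    have hac := (Complex.continuous_ofReal.tendsto _).comp ha
    have h1 := hac.mul hE
    have h2 : Tendsto (fun z ↦ (((N z : ℝ) * (∑ i ∈ A z, designWeight (π z) i)⁻¹ - 1) *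
        inner ℝ (r z) t)) 𝓕 (𝓝 0) := by
      refine (show Tendsto _ 𝓕 (𝓝 (0 : ℝ)) from by simpa using ha.sub_const 1)
        |>.zero_mul_isBoundedUnder_le ?_
      exact isBoundedUnder_of_eventually_le (a := K * ‖t‖) hrt
    have h3 := (ha.mul (hq.congr' (hb2.mono fun z hz ↦ hz.symm))).sub_const q
    rw [one_mul, sub_self] at h3
    have h2c := ((Complex.continuous_ofReal.tendsto _).comp h2).mul_const Complex.I
    have h3c := ((Complex.continuous_ofReal.tendsto _).comp h3).div_const 2
    have h4 := (h1.add h2c).sub h3c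
    simp only [Complex.ofReal_zero, mul_zero, zero_mul, zero_div, add_zero, sub_zero] at h4
    refine h4.congr fun z ↦ ?_
    simp only [Function.comp_apply, ζ]
    rw [← hb1 z, Finset.sum_sub_distrib, Finset.sum_sub_distrib (f := fun i ↦ (b z i : ℂ) * _)]
    rw [← Finset.sum_mul, ← Finset.sum_div]
    push_cast
    ring
  have hmain := tendsto_integral_exp_bootLaw (π := π) (A := A)
    (c := fun z i ↦ (b z i : ℂ) * Complex.I) (ζ := ζ)
    (K := |K * ‖t‖| + q / 2) hN hπ hA (Eventually.of_forall fun z i _ ↦ by simp)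
    (by
      filter_upwards [hrt] with z hz
      constructor
      · simp only [ζ, Complex.sub_re, Complex.mul_re, Complex.ofReal_re, Complex.I_re, mul_zero,
          Complex.ofReal_im, Complex.I_im, mul_one, sub_self, zero_sub]
        linarith
      · refine (norm_sub_le _ _).trans (add_le_add ?_ ?_)
        · rw [norm_mul, Complex.norm_I, mul_one, Complex.norm_real, Real.norm_eq_abs]
          exact hz.trans (le_abs_self _)
        · rw [Complex.norm_real, Real.norm_eq_abs, abs_of_nonneg (by positivity)]) hlim
  refine tendsto_iff_norm_sub_tendsto_zero.2 ((hmain.norm.congr fun z ↦ ?_).trans (by simp))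
  rw [integral_exp_bootFluct]
  have e : Complex.exp ((-(q / 2) : ℝ) : ℂ) = Complex.exp (-(inner ℝ (r z) t * Complex.I)) *
      Complex.exp (ζ z) := by
    rw [← Complex.exp_add]
    congr 1
    simp only [ζ]
    push_cast
    ring
  rw [e, ← mul_sub, norm_mul, Complex.norm_exp]
  simp [b]

/-- The conditional central limit theorem for the bootstrap. Only finitely many statistics of the
sample enter the hypotheses, which therefore hold along a countably generated filter, and Lévy's
continuity theorem for sequences applies. -/
lemma tendsto_integral_bootFluct {Vs : Matrix (Fin p) (Fin p) ℝ} {C T K : ℝ}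
    {γ : Measure (EuclideanSpace ℝ (Fin p))} [IsProbabilityMeasure γ]
    (hVs : ∀ t : EuclideanSpace ℝ (Fin p), 0 ≤ ∑ a, ∑ b, t a * t b * Vs a b)
    (hγ : ∀ t : EuclideanSpace ℝ (Fin p), charFun γ t =
      Complex.exp (-((∑ a, ∑ b, t a * t b * Vs a b) / 2) : ℝ))
    (hN : Tendsto N 𝓕 atTop) (hn₀ : Tendsto n₀ 𝓕 atTop)
    (hπ : ∀ᶠ z in 𝓕, ∀ i, 0 < π z i ∧ π z i ≤ 1)
    (hC : ∀ᶠ z in 𝓕, ∀ i, n₀ z * (N z : ℝ)⁻¹ * (π z i)⁻¹ ≤ C)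
    (hA : ∀ᶠ z in 𝓕, (A z).Nonempty)
    (hW : Tendsto (fun z ↦ (N z : ℝ)⁻¹ * ∑ i ∈ A z, designWeight (π z) i) 𝓕 (𝓝 1))
    (hT : Tendsto (fun z ↦ (N z : ℝ)⁻¹ * ∑ i ∈ A z, designWeight (π z) i * ‖v z i‖ ^ 3) 𝓕 (𝓝 T))
    (hr : ∀ᶠ z in 𝓕, ‖√(n₀ z) • (N z : ℝ)⁻¹ • ∑ i ∈ A z, designWeight (π z) i • v z i‖ ≤ K)
    (hH : ∀ a b, Tendsto (fun z ↦ n₀ z * ((N z : ℝ)⁻¹ ^ 2 *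
      ∑ i ∈ A z, designWeight (π z) i ^ 2 * (v z i a * v z i b))) 𝓕 (𝓝 (Vs a b)))
    (h : EuclideanSpace ℝ (Fin p) →ᵇ ℝ) :
    Tendsto (fun z ↦ ∫ m, h (bootFluct (n₀ z) (π z) (A z) (v z) m) ∂(bootLaw (π z) (A z))) 𝓕
      (𝓝 (∫ x, h x ∂γ)) := by
  let good : Set Z := {z | ((∀ i, 0 < π z i ∧ π z i ≤ 1) ∧
    (∀ i, n₀ z * (N z : ℝ)⁻¹ * (π z i)⁻¹ ≤ C)) ∧ (A z).Nonempty ∧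
    ‖√(n₀ z) • (N z : ℝ)⁻¹ • ∑ i ∈ A z, designWeight (π z) i • v z i‖ ≤ K}
  obtain ⟨U, hU⟩ : ∃ U : Z → ℝ, U = fun z ↦ (N z : ℝ)⁻¹ * ∑ i ∈ A z, designWeight (π z) i :=
    ⟨_, rfl⟩
  obtain ⟨V, hV⟩ : ∃ V : Z → ℝ, V = fun z ↦ (N z : ℝ)⁻¹ *
    ∑ i ∈ A z, designWeight (π z) i * ‖v z i‖ ^ 3 := ⟨_, rfl⟩
  obtain ⟨H, hHdef⟩ : ∃ H : Z → Fin p × Fin p → ℝ, H = fun z ab ↦ n₀ z * ((N z : ℝ)⁻¹ ^ 2 *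
      ∑ i ∈ A z, designWeight (π z) i ^ 2 * (v z i ab.1 * v z i ab.2)) := ⟨_, rfl⟩
  have hH' : Tendsto H 𝓕 (𝓝 fun ab ↦ Vs ab.1 ab.2) := by
    rw [tendsto_pi_nhds, hHdef]
    exact fun ab ↦ hH ab.1 ab.2
  rw [← hU] at hW
  rw [← hV] at hT
  let 𝓖 : Filter Z := comap N atTop ⊓ comap n₀ atTop ⊓ comap U (𝓝 1) ⊓ comap V (𝓝 T) ⊓
    comap H (𝓝 fun ab ↦ Vs ab.1 ab.2) ⊓ 𝓟 good
  have hle : 𝓕 ≤ 𝓖 := by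
    refine le_inf (le_inf (le_inf (le_inf (le_inf hN.le_comap hn₀.le_comap) hW.le_comap)
      hT.le_comap) hH'.le_comap) ?_
    rw [le_principal_iff]
    filter_upwards [hπ, hC, hA, hr] with z h1 h2 h3 h4
    exact ⟨⟨h1, h2⟩, h3, h4⟩
  refine Tendsto.mono_left ?_ hle
  refine tendsto_of_seq_tendsto fun x hx ↦ ?_
  have hx1 := tendsto_inf.1 hx
  have hx2 := tendsto_inf.1 hx1.1
  have hx3 := tendsto_inf.1 hx2.1
  have hx4 := tendsto_inf.1 hx3.1
  have hx5 := tendsto_inf.1 hx4.1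
  have hgood : ∀ᶠ n in atTop, x n ∈ good := tendsto_principal.1 hx1.2
  have hHx : ∀ a b, Tendsto (fun n ↦ n₀ (x n) * ((N (x n) : ℝ)⁻¹ ^ 2 *
      ∑ i ∈ A (x n), designWeight (π (x n)) i ^ 2 * (v (x n) i a * v (x n) i b))) atTop
      (𝓝 (Vs a b)) := fun a b ↦ by
    have := tendsto_pi_nhds.1 (tendsto_comap_iff.1 hx2.2) (a, b)
    rw [hHdef] at this
    exact this
  have hUx := tendsto_comap_iff.1 hx4.2
  have hVx := tendsto_comap_iff.1 hx3.2
  rw [hU] at hUx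
  rw [hV] at hVx
  have hchar : ∀ t : EuclideanSpace ℝ (Fin p), Tendsto (fun n ↦ ∫ m, Complex.exp (inner ℝ
      (bootFluct (n₀ (x n)) (π (x n)) (A (x n)) (v (x n)) m) t * Complex.I)
      ∂(bootLaw (π (x n)) (A (x n)))) atTop (𝓝 (charFun γ t)) := fun t ↦ by
    rw [hγ]
    refine tendsto_charFun_bootFluct (Z := ℕ) (N := fun n ↦ N (x n)) (n₀ := fun n ↦ n₀ (x n))
      (π := fun n ↦ π (x n)) (A := fun n ↦ A (x n)) (v := fun n ↦ v (x n)) (K := K) (C := C)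
      (T := T) t (tendsto_comap_iff.1 hx5.1) (tendsto_comap_iff.1 hx5.2)
      (hgood.mono fun n hn ↦ hn.1.1) (hgood.mono fun n hn ↦ hn.1.2) (hgood.mono fun n hn ↦ hn.2.1)
      hUx hVx
      (hgood.mono fun n hn ↦ hn.2.2) (hVs t) ?_
    have := tendsto_finsetSum (s := Finset.univ) fun a _ ↦ tendsto_finsetSum (s := Finset.univ)
      fun b _ ↦ (hHx a b).const_mul (t a * t b)
    refine this.congr fun n ↦ ?_
    simp only [Finset.mul_sum]
    simp_rw [Finset.sum_comm (t := A (x n))]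
    refine Finset.sum_congr rfl fun i _ ↦ ?_
    rw [PiLp.inner_apply, sq (∑ _, _), Finset.sum_mul_sum]
    simp only [Finset.mul_sum]
    refine Finset.sum_congr rfl fun a _ ↦ Finset.sum_congr rfl fun b _ ↦ ?_
    simp only [RCLike.inner_apply, conj_trivial]
    ring
  have hprob : ∀ z ∈ good, IsProbabilityMeasure (bootLaw (π z) (A z)) := fun z hz ↦
    isProbabilityMeasure_bootLaw hz.1.1 hz.2.1
  have hmeas : ∀ z, Measurable (bootFluct (n₀ z) (π z) (A z) (v z)) := fun z ↦ .of_discrete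
  have hex : ∀ n, ∃ μ : ProbabilityMeasure (EuclideanSpace ℝ (Fin p)), x n ∈ good →
      (μ : Measure (EuclideanSpace ℝ (Fin p))) =
      (bootLaw (π (x n)) (A (x n))).map (bootFluct (n₀ (x n)) (π (x n)) (A (x n)) (v (x n))) := by
    intro n
    by_cases hn : x n ∈ good
    · have := hprob _ hn
      exact ⟨⟨_, Measure.isProbabilityMeasure_map (hmeas (x n)).aemeasurable⟩, fun _ ↦ rfl⟩
    · exact ⟨⟨γ, inferInstance⟩, fun h ↦ absurd h hn⟩
  choose μs hμs using hex
  have hlevy : Tendsto μs atTop (𝓝 ⟨γ, inferInstance⟩) := by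
    refine ProbabilityMeasure.tendsto_of_tendsto_charFun fun t ↦ (hchar t).congr' ?_
    filter_upwards [hgood] with n hn
    rw [hμs n hn, charFun_apply, integral_map (hmeas _).aemeasurable (by fun_prop)]
  have := ProbabilityMeasure.tendsto_iff_forall_integral_tendsto.1 hlevy h
  refine this.congr' ?_
  filter_upwards [hgood] with n hn
  rw [hμs n hn, integral_map (hmeas _).aemeasurable
    h.continuous.measurable.aestronglyMeasurable]
  rfl

end BootstrapCentralLimit

/-! ### The parametric model -/

section ParametricModel

variable {p : ℕ} {𝒴 : Type*} [MeasurableSpace 𝒴]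

/-- The regularity conditions on the parametric model, with `D` an integrable function dominating
the entries of the information near the true parameter `θ₀`. -/
structure IsRegularModel (μ : Measure 𝒴) (f : EuclideanSpace ℝ (Fin p) → 𝒴 → ℝ)
    (Θ 𝓑 : Set (EuclideanSpace ℝ (Fin p))) (θ₀ : EuclideanSpace ℝ (Fin p)) (D : 𝒴 → ℝ) :
    Prop where
  meas : Measurable (Function.uncurry f)
  pos : ∀ θ ∈ Θ, ∀ y, 0 < f θ y
  dens : ∀ θ ∈ Θ, ∫⁻ y, ENNReal.ofReal (f θ y) ∂μ = 1
  compact : IsCompact 𝓑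
  convex : Convex ℝ 𝓑
  subset : 𝓑 ⊆ Θ
  mem_interior : θ₀ ∈ interior 𝓑
  ident : ∀ θ ∈ 𝓑, θ ≠ θ₀ → ¬ (f θ =ᵐ[μ] f θ₀)
  smooth : ∀ y, ∀ θ ∈ Θ, ContDiffAt ℝ 2 (fun t ↦ f t y) θ
  moment : ∃ C : ℝ≥0, ∫⁻ y, ‖score f θ₀ y‖ₑ ^ 6 ∂(modelLaw μ f θ₀) ≤ C
  integrable_dom : Integrable D (modelLaw μ f θ₀)
  dom : ∀ θ ∈ 𝓑, ∀ y a b, |info f θ y a b| ≤ D y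
  isUnit_det : IsUnit (expInfo μ f θ₀ θ₀).det

namespace IsRegularModel

variable {μ : Measure 𝒴} {f : EuclideanSpace ℝ (Fin p) → 𝒴 → ℝ}
  {Θ 𝓑 : Set (EuclideanSpace ℝ (Fin p))} {θ₀ θ θ' : EuclideanSpace ℝ (Fin p)} {D : 𝒴 → ℝ}

lemma mem_ball (M : IsRegularModel μ f Θ 𝓑 θ₀ D) : θ₀ ∈ 𝓑 := interior_subset M.mem_interior

lemma mem_param (M : IsRegularModel μ f Θ 𝓑 θ₀ D) : θ₀ ∈ Θ := M.subset M.mem_ball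

lemma exists_closedBall_subset (M : IsRegularModel μ f Θ 𝓑 θ₀ D) :
    ∃ δ : ℝ, 0 < δ ∧ ∀ h : EuclideanSpace ℝ (Fin p), ‖h‖ ≤ δ → θ₀ + h ∈ 𝓑 := by
  obtain ⟨δ, hδ, h⟩ := Metric.nhds_basis_closedBall.mem_iff.1 (mem_interior_iff_mem_nhds.1
    M.mem_interior)
  exact ⟨δ, hδ, fun x hx ↦ h (by simpa [dist_eq_norm] using hx)⟩

lemma measurable_density (M : IsRegularModel μ f Θ 𝓑 θ₀ D) (θ : EuclideanSpace ℝ (Fin p)) :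
    Measurable (f θ) := M.meas.comp measurable_prodMk_left

lemma measurable_log (M : IsRegularModel μ f Θ 𝓑 θ₀ D) (θ : EuclideanSpace ℝ (Fin p)) :
    Measurable fun y ↦ Real.log (f θ y) := Real.measurable_log.comp (M.measurable_density θ)

lemma isProbabilityMeasure (M : IsRegularModel μ f Θ 𝓑 θ₀ D) :
    IsProbabilityMeasure (modelLaw μ f θ₀) := by
  refine ⟨?_⟩
  rw [modelLaw, withDensity_apply _ MeasurableSet.univ, Measure.restrict_univ]
  exact M.dens _ M.mem_param

lemma contDiffAt_log (M : IsRegularModel μ f Θ 𝓑 θ₀ D) (hθ : θ ∈ Θ) (y : 𝒴) :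
    ContDiffAt ℝ 2 (fun t ↦ Real.log (f t y)) θ :=
  (M.smooth y θ hθ).log (M.pos θ hθ y).ne'

lemma hasGradientAt_log (M : IsRegularModel μ f Θ 𝓑 θ₀ D) (hθ : θ ∈ Θ) (y : 𝒴) :
    HasGradientAt (fun t ↦ Real.log (f t y)) (score f θ y) θ :=
  ((M.contDiffAt_log hθ y).differentiableAt two_ne_zero).hasGradientAt

lemma score_eq (f : EuclideanSpace ℝ (Fin p) → 𝒴 → ℝ) (y : 𝒴) :
    (fun t ↦ score f t y) = fun t ↦ (InnerProductSpace.toDual ℝ (EuclideanSpace ℝ (Fin p))).symm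
      (fderiv ℝ (fun t ↦ Real.log (f t y)) t) := rfl

lemma contDiffAt_score (M : IsRegularModel μ f Θ 𝓑 θ₀ D) (hθ : θ ∈ Θ) (y : 𝒴) :
    ContDiffAt ℝ 1 (fun t ↦ score f t y) θ := by
  rw [score_eq]
  exact ((InnerProductSpace.toDual ℝ (EuclideanSpace ℝ (Fin p))).symm.contDiff.contDiffAt).comp θ
    ((M.contDiffAt_log hθ y).fderiv_right (by norm_num))

lemma hasFDerivAt_score (M : IsRegularModel μ f Θ 𝓑 θ₀ D) (hθ : θ ∈ Θ) (y : 𝒴) :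
    HasFDerivAt (fun t ↦ score f t y) (fderiv ℝ (fun t ↦ score f t y) θ) θ :=
  ((M.contDiffAt_score hθ y).differentiableAt one_ne_zero).hasFDerivAt

lemma continuousAt_fderiv_score (M : IsRegularModel μ f Θ 𝓑 θ₀ D) (hθ : θ ∈ Θ) (y : 𝒴) :
    ContinuousAt (fun t ↦ fderiv ℝ (fun t ↦ score f t y) t) θ :=
  ((M.contDiffAt_score hθ y).fderiv_right (m := 0) (by norm_num)).continuousAt

lemma info_apply (M : IsRegularModel μ f Θ 𝓑 θ₀ D) (hθ : θ ∈ Θ) (y : 𝒴) (a b : Fin p) :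
    info f θ y a b = -(fderiv ℝ (fun t ↦ score f t y) θ (EuclideanSpace.single b 1) a) := by
  simp only [info, Matrix.of_apply]
  congr 1
  exact DFunLike.congr_fun ((EuclideanSpace.proj (𝕜 := ℝ) a :
    EuclideanSpace ℝ (Fin p) →L[ℝ] ℝ).hasFDerivAt.comp θ (M.hasFDerivAt_score hθ y)).fderiv _

lemma eq_sum_smul_single (x : EuclideanSpace ℝ (Fin p)) :
    x = ∑ b, x b • EuclideanSpace.single b (1 : ℝ) := by
  ext c
  simp [Pi.single_apply, Finset.sum_apply]

lemma fderiv_score_apply (M : IsRegularModel μ f Θ 𝓑 θ₀ D) (hθ : θ ∈ Θ) (y : 𝒴)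
    (x : EuclideanSpace ℝ (Fin p)) (a : Fin p) :
    fderiv ℝ (fun t ↦ score f t y) θ x a = -∑ b, x b * info f θ y a b := by
  conv_lhs => rw [eq_sum_smul_single x]
  simp only [map_sum, map_smul, M.info_apply hθ]
  simp

lemma info_symm (M : IsRegularModel μ f Θ 𝓑 θ₀ D) (hθ : θ ∈ Θ) (y : 𝒴) (a b : Fin p) :
    info f θ y a b = info f θ y b a := by
  have hs : IsSymmSndFDerivAt ℝ (fun t ↦ Real.log (f t y)) θ :=
    (M.contDiffAt_log hθ y).isSymmSndFDerivAt (by simp)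
  have hd : DifferentiableAt ℝ (fderiv ℝ (fun t ↦ Real.log (f t y))) θ :=
    ((M.contDiffAt_log hθ y).fderiv_right (m := 1) (by norm_num)).differentiableAt one_ne_zero
  have key : ∀ a b, info f θ y a b = -(fderiv ℝ (fderiv ℝ (fun t ↦ Real.log (f t y))) θ
      (EuclideanSpace.single b 1) (EuclideanSpace.single a 1)) := fun a b ↦ by
    have h1 : (fun t ↦ score f t y a) = fun t ↦
        fderiv ℝ (fun t ↦ Real.log (f t y)) t (EuclideanSpace.single a 1) := by
      funext t
      have h2 : ∀ x : EuclideanSpace ℝ (Fin p), x a = inner ℝ x (EuclideanSpace.single a 1) :=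
        fun x ↦ by simp [EuclideanSpace.inner_single_right]
      rw [h2]
      exact InnerProductSpace.toDual_symm_apply
    simp only [info, Matrix.of_apply, h1]
    congr 1
    exact DFunLike.congr_fun ((ContinuousLinearMap.apply ℝ ℝ
      (EuclideanSpace.single a (1 : ℝ))).hasFDerivAt.comp θ hd.hasFDerivAt).fderiv _
  rw [key, key, hs]

lemma dom_nonneg (M : IsRegularModel μ f Θ 𝓑 θ₀ D) (y : 𝒴) : 0 ≤ (p : ℝ) ^ 2 * D y := by
  rcases Nat.eq_zero_or_pos p with rfl | h
  · simp
  · exact mul_nonneg (by positivity) ((abs_nonneg _).trans (M.dom θ₀ M.mem_ball y ⟨0, h⟩ ⟨0, h⟩))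

lemma norm_fderiv_score_le (M : IsRegularModel μ f Θ 𝓑 θ₀ D) (hθ : θ ∈ 𝓑) (y : 𝒴) :
    ‖fderiv ℝ (fun t ↦ score f t y) θ‖ ≤ (p : ℝ) ^ 2 * D y := by
  refine ContinuousLinearMap.opNorm_le_bound _ (M.dom_nonneg y) fun x ↦ ?_
  have h1 : ∀ z : EuclideanSpace ℝ (Fin p), ‖z‖ ≤ ∑ a, |z a| := fun z ↦ by
    conv_lhs => rw [eq_sum_smul_single z]
    refine (norm_sum_le _ _).trans (le_of_eq (Finset.sum_congr rfl fun a _ ↦ ?_))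
    rw [norm_smul]
    simp
  refine (h1 _).trans ?_
  calc ∑ a, |fderiv ℝ (fun t ↦ score f t y) θ x a| ≤ ∑ _a : Fin p, ∑ _b : Fin p, ‖x‖ * D y := by
        refine Finset.sum_le_sum fun a _ ↦ ?_
        rw [M.fderiv_score_apply (M.subset hθ), abs_neg]
        refine (Finset.abs_sum_le_sum_abs _ _).trans (Finset.sum_le_sum fun b _ ↦ ?_)
        rw [abs_mul]
        exact mul_le_mul (PiLp.norm_apply_le x b) (M.dom θ hθ y a b) (abs_nonneg _) (norm_nonneg _)
    _ = _ := by simp; ring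

lemma norm_score_sub_le (M : IsRegularModel μ f Θ 𝓑 θ₀ D) (hθ : θ ∈ 𝓑) (hθ' : θ' ∈ 𝓑) (y : 𝒴) :
    ‖score f θ' y - score f θ y‖ ≤ (p : ℝ) ^ 2 * D y * ‖θ' - θ‖ :=
  M.convex.norm_image_sub_le_of_norm_hasFDerivWithin_le (𝕜 := ℝ) (f := fun t ↦ score f t y)
    (fun _ hx ↦ (M.hasFDerivAt_score (M.subset hx) y).hasFDerivWithinAt)
    (fun _ hx ↦ M.norm_fderiv_score_le hx y) hθ hθ'

/-- A Lipschitz constant of the log-likelihood of one observation on the compact set `𝓑`. -/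
noncomputable def lipConst (f : EuclideanSpace ℝ (Fin p) → 𝒴 → ℝ)
    (𝓑 : Set (EuclideanSpace ℝ (Fin p))) (θ₀ : EuclideanSpace ℝ (Fin p)) (D : 𝒴 → ℝ) (y : 𝒴) : ℝ :=
  ‖score f θ₀ y‖ + (p : ℝ) ^ 2 * D y * Metric.diam 𝓑

lemma abs_log_sub_le (M : IsRegularModel μ f Θ 𝓑 θ₀ D) (hθ : θ ∈ 𝓑) (hθ' : θ' ∈ 𝓑) (y : 𝒴) :
    |Real.log (f θ' y) - Real.log (f θ y)| ≤ lipConst f 𝓑 θ₀ D y * ‖θ' - θ‖ := by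
  refine M.convex.norm_image_sub_le_of_norm_hasFDerivWithin_le (𝕜 := ℝ)
    (f := fun t ↦ Real.log (f t y))
    (fun x hx ↦ (M.hasGradientAt_log (M.subset hx) y).hasFDerivAt.hasFDerivWithinAt)
    (fun x hx ↦ ?_) hθ hθ'
  rw [LinearIsometryEquiv.norm_map]
  have h1 := M.norm_score_sub_le M.mem_ball hx y
  have h2 : ‖x - θ₀‖ ≤ Metric.diam 𝓑 := by
    rw [← dist_eq_norm]
    exact Metric.dist_le_diam_of_mem M.compact.isBounded hx M.mem_ball
  have h3 := mul_le_mul_of_nonneg_left h2 (M.dom_nonneg y)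
  have h4 := norm_add_le (score f x y - score f θ₀ y) (score f θ₀ y)
  rw [sub_add_cancel] at h4
  rw [lipConst]
  linarith

lemma eventually_add_smul_mem (hθ : θ ∈ interior 𝓑)
    (x : EuclideanSpace ℝ (Fin p)) : ∀ᶠ n : ℕ in atTop, θ + ((n : ℝ) + 1)⁻¹ • x ∈ interior 𝓑 := by
  have h : Tendsto (fun n : ℕ ↦ θ + ((n : ℝ) + 1)⁻¹ • x) atTop (𝓝 (θ + (0 : ℝ) • x)) := by
    have : Tendsto (fun n : ℕ ↦ ((n : ℝ) + 1)⁻¹) atTop (𝓝 0) := by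
      simpa using tendsto_one_div_add_atTop_nhds_zero_nat (𝕜 := ℝ)
    exact tendsto_const_nhds.add (this.smul_const x)
  rw [zero_smul, add_zero] at h
  exact h.eventually (isOpen_interior.mem_nhds hθ)

lemma tendsto_inv_nhdsNE : Tendsto (fun n : ℕ ↦ ((n : ℝ) + 1)⁻¹) atTop (𝓝[≠] 0) := by
  rw [tendsto_nhdsWithin_iff]
  constructor
  · simpa using tendsto_one_div_add_atTop_nhds_zero_nat (𝕜 := ℝ)
  · refine Eventually.of_forall fun n ↦ ?_
    simp only [mem_compl_iff, mem_singleton_iff, inv_eq_zero]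
    positivity

/-- Directional derivatives as limits of difference quotients along a fixed sequence. -/
lemma _root_.HasFDerivAt.tendsto_quotient {E F : Type*} [NormedAddCommGroup E] [NormedSpace ℝ E]
    [NormedAddCommGroup F] [NormedSpace ℝ F] {g : E → F} {g' : E →L[ℝ] F} {x : E}
    (h : HasFDerivAt g g' x) (v : E) :
    Tendsto (fun n : ℕ ↦ ((n : ℝ) + 1) • (g (x + ((n : ℝ) + 1)⁻¹ • v) - g x)) atTop
      (𝓝 (g' v)) := by
  have h1 := ((h.hasLineDerivAt v).tendsto_slope_zero).comp tendsto_inv_nhdsNE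
  simpa [Function.comp_def] using h1

lemma measurable_score (M : IsRegularModel μ f Θ 𝓑 θ₀ D) (hθ : θ ∈ Θ) :
    Measurable (score f θ) := by
  have h : ∀ a, Measurable fun y ↦ score f θ y a := fun a ↦ by
    refine measurable_of_tendsto_metrizable (f := fun (n : ℕ) y ↦ ((n : ℝ) + 1) *
      (Real.log (f (θ + ((n : ℝ) + 1)⁻¹ • EuclideanSpace.single a (1 : ℝ)) y) - Real.log (f θ y)))
      (fun n ↦ ((M.measurable_log _).sub (M.measurable_log _)).const_mul _)
      (tendsto_pi_nhds.2 fun y ↦ ?_)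
    have := (M.hasGradientAt_log hθ y).hasFDerivAt.tendsto_quotient (EuclideanSpace.single a 1)
    simpa [EuclideanSpace.inner_single_right] using this
  have h2 : Measurable fun y ↦ (WithLp.ofLp (score f θ y) : Fin p → ℝ) := measurable_pi_iff.2 h
  exact (WithLp.measurable_toLp 2 (Fin p → ℝ)).comp h2

lemma measurable_info (M : IsRegularModel μ f Θ 𝓑 θ₀ D) (a b : Fin p) :
    Measurable fun y ↦ info f θ₀ y a b := by
  simp_rw [M.info_apply M.mem_param]
  refine Measurable.neg ?_
  obtain ⟨n₁, hn₁⟩ := eventually_atTop.1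
    (eventually_add_smul_mem M.mem_interior (EuclideanSpace.single b 1))
  refine measurable_of_tendsto_metrizable (f := fun (n : ℕ) y ↦ (((n + n₁ : ℕ) : ℝ) + 1) *
      (score f (θ₀ + (((n + n₁ : ℕ) : ℝ) + 1)⁻¹ • EuclideanSpace.single b (1 : ℝ)) y a -
        score f θ₀ y a)) (fun n ↦ ?_) (tendsto_pi_nhds.2 fun y ↦ ?_)
  · have h1 := M.measurable_score (M.subset (interior_subset (hn₁ (n + n₁) (by omega))))
    have h2 := M.measurable_score M.mem_param
    fun_prop
  · have h1 := (M.hasFDerivAt_score M.mem_param y).tendsto_quotient (EuclideanSpace.single b 1)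
    have h2 := ((PiLp.continuous_apply 2 (fun _ : Fin p ↦ ℝ) a).tendsto _).comp h1
    have h3 := h2.comp (tendsto_add_atTop_nat n₁)
    refine h3.congr fun n ↦ ?_
    simp

lemma memLp_score (M : IsRegularModel μ f Θ 𝓑 θ₀ D) :
    MemLp (score f θ₀) 6 (modelLaw μ f θ₀) := by
  obtain ⟨C, hC⟩ := M.moment
  refine ⟨(M.measurable_score M.mem_param).aestronglyMeasurable, ?_⟩
  rw [eLpNorm_lt_top_iff_lintegral_rpow_enorm_lt_top (by norm_num) (by norm_num)]
  refine lt_of_le_of_lt ?_ (ENNReal.coe_lt_top (r := C))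
  refine le_trans (le_of_eq (lintegral_congr fun y ↦ ?_)) hC
  rw [← ENNReal.rpow_natCast]
  norm_num

lemma integrable_score (M : IsRegularModel μ f Θ 𝓑 θ₀ D) :
    Integrable (score f θ₀) (modelLaw μ f θ₀) := by
  have := M.isProbabilityMeasure
  exact M.memLp_score.integrable (by norm_num)

lemma integrable_info (M : IsRegularModel μ f Θ 𝓑 θ₀ D) (a b : Fin p) :
    Integrable (fun y ↦ info f θ₀ y a b) (modelLaw μ f θ₀) :=
  M.integrable_dom.mono' (M.measurable_info a b).aestronglyMeasurable
    (Eventually.of_forall fun y ↦ M.dom θ₀ M.mem_ball y a b)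

lemma integrable_lipConst (M : IsRegularModel μ f Θ 𝓑 θ₀ D) :
    Integrable (lipConst f 𝓑 θ₀ D) (modelLaw μ f θ₀) :=
  M.integrable_score.norm.add ((M.integrable_dom.const_mul _).mul_const _)

lemma integrable_log_sub (M : IsRegularModel μ f Θ 𝓑 θ₀ D) (hθ : θ ∈ 𝓑) :
    Integrable (fun y ↦ Real.log (f θ y) - Real.log (f θ₀ y)) (modelLaw μ f θ₀) :=
  (M.integrable_lipConst.mul_const ‖θ - θ₀‖).mono'
    ((M.measurable_log _).sub (M.measurable_log _)).aestronglyMeasurable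
    (Eventually.of_forall fun y ↦ M.abs_log_sub_le M.mem_ball hθ y)

/-- The information inequality: the Kullback–Leibler divergence is positive. -/
lemma integral_log_sub_neg (M : IsRegularModel μ f Θ 𝓑 θ₀ D) (hθ : θ ∈ 𝓑) (hne : θ ≠ θ₀) :
    ∫ y, (Real.log (f θ y) - Real.log (f θ₀ y)) ∂(modelLaw μ f θ₀) < 0 := by
  have := M.isProbabilityMeasure
  have hp := M.pos θ (M.subset hθ)
  have hp0 := M.pos θ₀ M.mem_param
  have hm0 : Measurable fun y ↦ ENNReal.ofReal (f θ₀ y) := (M.measurable_density θ₀).ennreal_ofReal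
  have hratio : ∫⁻ y, ENNReal.ofReal (f θ y / f θ₀ y) ∂(modelLaw μ f θ₀) = 1 := by
    rw [modelLaw, lintegral_withDensity_eq_lintegral_mul _ hm0
      (g := fun y ↦ ENNReal.ofReal (f θ y / f θ₀ y))
      ((M.measurable_density θ).div (M.measurable_density θ₀)).ennreal_ofReal,
      ← M.dens θ (M.subset hθ)]
    refine lintegral_congr fun y ↦ ?_
    rw [Pi.mul_apply, ← ENNReal.ofReal_mul (hp0 y).le, mul_div_cancel₀ _ (hp0 y).ne']
  have hri : Integrable (fun y ↦ f θ y / f θ₀ y) (modelLaw μ f θ₀) := by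
    refine ⟨((M.measurable_density θ).div (M.measurable_density θ₀)).aestronglyMeasurable, ?_⟩
    rw [hasFiniteIntegral_iff_ofReal (Eventually.of_forall fun y ↦ (div_pos (hp y) (hp0 y)).le),
      hratio]
    exact ENNReal.one_lt_top
  have hr1 : ∫ y, f θ y / f θ₀ y ∂(modelLaw μ f θ₀) = 1 := by
    rw [integral_eq_lintegral_of_nonneg_ae
      (Eventually.of_forall fun y ↦ (div_pos (hp y) (hp0 y)).le) hri.1, hratio, ENNReal.toReal_one]
  have hl := M.integrable_log_sub hθ
  let u : 𝒴 → ℝ := fun y ↦ (f θ y / f θ₀ y - 1) - (Real.log (f θ y) - Real.log (f θ₀ y))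
  have hu0 : ∀ y, 0 ≤ u y := fun y ↦ by
    have := Real.log_le_sub_one_of_pos (div_pos (hp y) (hp0 y))
    rw [Real.log_div (hp y).ne' (hp0 y).ne'] at this
    simp only [u]
    linarith
  have hui : Integrable u (modelLaw μ f θ₀) := (hri.sub (integrable_const 1)).sub hl
  have hint : ∫ y, u y ∂(modelLaw μ f θ₀) =
      -∫ y, (Real.log (f θ y) - Real.log (f θ₀ y)) ∂(modelLaw μ f θ₀) := by
    have h1 : Integrable (fun y ↦ f θ y / f θ₀ y - 1) (modelLaw μ f θ₀) :=
      hri.sub (integrable_const 1)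
    simp only [u]
    rw [integral_sub h1 hl, integral_sub hri (integrable_const 1), hr1]
    simp
  by_contra! hc
  have h0 : ∫ y, u y ∂(modelLaw μ f θ₀) = 0 :=
    le_antisymm (by rw [hint]; linarith) (integral_nonneg hu0)
  rw [integral_eq_zero_iff_of_nonneg hu0 hui] at h0
  refine M.ident θ hθ hne ?_
  rw [modelLaw] at h0
  have h1 := (ae_withDensity_iff hm0).1 h0
  filter_upwards [h1] with y hy
  have hz := hy (by simpa using hp0 y)
  by_contra hne'
  have hx : f θ y / f θ₀ y ≠ 1 := fun h ↦ hne' ((div_eq_one_iff_eq (hp0 y).ne').1 h)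
  have := Real.log_lt_sub_one_of_pos (div_pos (hp y) (hp0 y)) hx
  rw [Real.log_div (hp y).ne' (hp0 y).ne'] at this
  simp only [u, Pi.zero_apply] at hz
  linarith

lemma integral_log_sub_nonpos (M : IsRegularModel μ f Θ 𝓑 θ₀ D) (hθ : θ ∈ 𝓑) :
    ∫ y, (Real.log (f θ y) - Real.log (f θ₀ y)) ∂(modelLaw μ f θ₀) ≤ 0 := by
  rcases eq_or_ne θ θ₀ with rfl | h
  · simp
  · exact (M.integral_log_sub_neg hθ h).le

end IsRegularModel

end ParametricModel

/-! ### Second-order expansion of the log-likelihood -/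

section Expansion

variable {p : ℕ} {𝒴 : Type*} [MeasurableSpace 𝒴]

/-- The remainder in the second-order Taylor expansion of `log f(y; ·)` at `θ₀`. -/
noncomputable def logRem (f : EuclideanSpace ℝ (Fin p) → 𝒴 → ℝ) (θ₀ : EuclideanSpace ℝ (Fin p))
    (y : 𝒴) (h : EuclideanSpace ℝ (Fin p)) : ℝ :=
  Real.log (f (θ₀ + h) y) - Real.log (f θ₀ y) - inner ℝ (score f θ₀ y) h +
    (∑ a, ∑ b, h a * h b * info f θ₀ y a b) / 2

namespace IsRegularModel

variable {μ : Measure 𝒴} {f : EuclideanSpace ℝ (Fin p) → 𝒴 → ℝ}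
  {Θ 𝓑 : Set (EuclideanSpace ℝ (Fin p))} {θ₀ θ θ' : EuclideanSpace ℝ (Fin p)} {D : 𝒴 → ℝ}

lemma inner_fderiv_score (M : IsRegularModel μ f Θ 𝓑 θ₀ D) (y : 𝒴)
    (h : EuclideanSpace ℝ (Fin p)) :
    inner ℝ (fderiv ℝ (fun t ↦ score f t y) θ₀ h) h =
      -∑ a, ∑ b, h a * h b * info f θ₀ y a b := by
  rw [PiLp.inner_apply, ← Finset.sum_neg_distrib]
  refine Finset.sum_congr rfl fun a _ ↦ ?_
  rw [M.fderiv_score_apply M.mem_param]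
  simp only [RCLike.inner_apply, conj_trivial, mul_neg, Finset.mul_sum, mul_assoc]

lemma abs_logRem_le (M : IsRegularModel μ f Θ 𝓑 θ₀ D) {y : 𝒴} {h : EuclideanSpace ℝ (Fin p)}
    {m : ℝ} (hm : ∀ h' : EuclideanSpace ℝ (Fin p), ‖h'‖ ≤ ‖h‖ → θ₀ + h' ∈ 𝓑 ∧
      ‖fderiv ℝ (fun t ↦ score f t y) (θ₀ + h') - fderiv ℝ (fun t ↦ score f t y) θ₀‖ ≤ m) :
    |logRem f θ₀ y h| ≤ m * ‖h‖ ^ 2 := by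
  have hm0 : 0 ≤ m := (norm_nonneg _).trans (hm 0 (by simp)).2
  set L := fderiv ℝ (fun t ↦ score f t y) θ₀ with hL
  have hS : ∀ h' : EuclideanSpace ℝ (Fin p), ‖h'‖ ≤ ‖h‖ →
      ‖score f (θ₀ + h') y - score f θ₀ y - L h'‖ ≤ m * ‖h'‖ := fun h' hh' ↦ by
    have := (convex_closedBall θ₀ ‖h‖).norm_image_sub_le_of_norm_hasFDerivWithin_le' (𝕜 := ℝ)
      (f := fun t ↦ score f t y) (f' := fun t ↦ fderiv ℝ (fun t ↦ score f t y) t) (φ := L) (C := m)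
      (x := θ₀) (y := θ₀ + h') (fun t ht ↦ ?_) (fun t ht ↦ ?_) (by simp)
      (by simpa [dist_eq_norm] using hh')
    · simpa using this
    · have h1 := (hm (t - θ₀) (by simpa [dist_eq_norm] using ht)).1
      rw [add_sub_cancel] at h1
      exact (M.hasFDerivAt_score (M.subset h1) y).hasFDerivWithinAt
    · have h1 := (hm (t - θ₀) (by simpa [dist_eq_norm] using ht)).2
      rw [add_sub_cancel] at h1
      exact h1
  let g : ℝ → ℝ := fun s ↦ Real.log (f (θ₀ + s • h) y) - s * inner ℝ (score f θ₀ y) h -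
    s ^ 2 / 2 * inner ℝ (L h) h
  have hsh : ∀ s ∈ Icc (0 : ℝ) 1, ‖s • h‖ ≤ ‖h‖ := fun s hs ↦ by
    rw [norm_smul, Real.norm_eq_abs, abs_of_nonneg hs.1]
    exact mul_le_of_le_one_left (norm_nonneg _) hs.2
  have hg : ∀ s ∈ Icc (0 : ℝ) 1, HasDerivWithinAt g
      (inner ℝ (score f (θ₀ + s • h) y - score f θ₀ y - L (s • h)) h) (Icc (0 : ℝ) 1) s := by
    intro s hs
    have h1 := (M.hasGradientAt_log (M.subset (hm _ (hsh s hs)).1) y).hasFDerivAt.comp_hasDerivAt s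
      (((hasDerivAt_id s).smul_const h).const_add θ₀)
    have h2 := (h1.sub ((hasDerivAt_id s).mul_const (inner ℝ (score f θ₀ y) h))).sub
      ((((hasDerivAt_id s).pow 2).div_const 2).mul_const (inner ℝ (L h) h))
    refine (h2.congr_deriv ?_).hasDerivWithinAt
    simp only [inner_sub_left, map_smul, inner_smul_left, conj_trivial, id, one_smul,
      InnerProductSpace.toDual_apply_apply]
    norm_num
  have hb := norm_image_sub_le_of_norm_deriv_le_segment_01' hg (C := m * ‖h‖ ^ 2) fun s hs ↦ by
    have hs' : s ∈ Icc (0 : ℝ) 1 := ⟨hs.1, hs.2.le⟩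
    refine (norm_inner_le_norm _ _).trans ?_
    calc _ ≤ (m * ‖h‖) * ‖h‖ := by
          gcongr
          exact (hS _ (hsh s hs')).trans (mul_le_mul_of_nonneg_left (hsh s hs') hm0)
      _ = _ := by ring
  refine le_trans (le_of_eq ?_) hb
  rw [Real.norm_eq_abs]
  congr 1
  simp only [g, logRem, hL, M.inner_fderiv_score, one_smul, zero_smul, add_zero]
  ring

lemma continuousAt_logRem (M : IsRegularModel μ f Θ 𝓑 θ₀ D) (y : 𝒴)
    {h : EuclideanSpace ℝ (Fin p)} (hh : θ₀ + h ∈ 𝓑) : ContinuousAt (logRem f θ₀ y) h := by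
  have h1 : ContinuousAt (fun x ↦ Real.log (f (θ₀ + x) y)) h :=
    ContinuousAt.comp (f := fun x ↦ θ₀ + x) (g := fun t ↦ Real.log (f t y))
      (M.contDiffAt_log (M.subset hh) y).continuousAt (by fun_prop)
  have h2 : Continuous fun h : EuclideanSpace ℝ (Fin p) ↦
      (∑ a, ∑ b, h a * h b * info f θ₀ y a b) / 2 := by fun_prop
  have h3 : Continuous fun h : EuclideanSpace ℝ (Fin p) ↦ inner ℝ (score f θ₀ y) h := by fun_prop
  exact ((h1.sub continuousAt_const).sub h3.continuousAt).add h2.continuousAt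

lemma measurable_logRem (M : IsRegularModel μ f Θ 𝓑 θ₀ D) (h : EuclideanSpace ℝ (Fin p)) :
    Measurable fun y ↦ logRem f θ₀ y h := by
  have h1 := M.measurable_score M.mem_param
  have h2 := M.measurable_info
  have h3 := M.measurable_log θ₀
  have h4 := M.measurable_log (θ₀ + h)
  refine ((h4.sub h3).sub (h1.inner measurable_const)).add (Measurable.div_const ?_ _)
  exact Finset.measurable_sum _ fun a _ ↦ Finset.measurable_sum _ fun b _ ↦ (h2 a b).const_mul _

/-- Near the true parameter the Taylor remainder is, uniformly in the direction, at most a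
variable of small mean times the squared distance. The supremum defining this variable runs over a
countable dense set, which makes it measurable. -/
lemma exists_logRem_bound (M : IsRegularModel μ f Θ 𝓑 θ₀ D) {ε : ℝ} (hε : 0 < ε) :
    ∃ δ : ℝ, 0 < δ ∧ ∃ ω : 𝒴 → ℝ, Integrable ω (modelLaw μ f θ₀) ∧
      ∫ y, ω y ∂(modelLaw μ f θ₀) < ε ∧ ∀ h : EuclideanSpace ℝ (Fin p), ‖h‖ < δ →
        θ₀ + h ∈ 𝓑 ∧ ∀ y, |logRem f θ₀ y h| ≤ ω y * ‖h‖ ^ 2 := by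
  obtain ⟨δ, hδ, hball⟩ := M.exists_closedBall_subset
  let d := TopologicalSpace.denseSeq (EuclideanSpace ℝ (Fin p))
  have hd : DenseRange d := TopologicalSpace.denseRange_denseSeq _
  let r : ℕ → ℝ := fun k ↦ δ * ((k : ℝ) + 1)⁻¹
  have hr0 : ∀ k, 0 < r k := fun k ↦ by positivity
  have hrδ : ∀ k, r k ≤ δ := fun k ↦ by
    refine mul_le_of_le_one_right hδ.le (inv_le_one_of_one_le₀ ?_)
    have := Nat.cast_nonneg (α := ℝ) k
    linarith
  have hrlim : Tendsto r atTop (𝓝 0) := by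
    have : Tendsto (fun n : ℕ ↦ ((n : ℝ) + 1)⁻¹) atTop (𝓝 0) := by
      simpa using tendsto_one_div_add_atTop_nhds_zero_nat (𝕜 := ℝ)
    simpa using this.const_mul δ
  classical
  let τ : ℕ → ℕ → 𝒴 → ℝ := fun k n y ↦
    if 0 < ‖d n‖ ∧ ‖d n‖ < r k then |logRem f θ₀ y (d n)| / ‖d n‖ ^ 2 else 0
  let ω : ℕ → 𝒴 → ℝ := fun k y ↦ ⨆ n, τ k n y
  have hτ0 : ∀ k n y, 0 ≤ τ k n y := fun k n y ↦ by
    simp only [τ]; split_ifs <;> positivity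
  have hτle : ∀ k n y m, 0 ≤ m → (∀ h' : EuclideanSpace ℝ (Fin p), ‖h'‖ < r k →
      ‖fderiv ℝ (fun t ↦ score f t y) (θ₀ + h') - fderiv ℝ (fun t ↦ score f t y) θ₀‖ ≤ m) →
      τ k n y ≤ m := fun k n y m hm0 hm ↦ by
    simp only [τ]
    split_ifs with hc
    · rw [div_le_iff₀ (by have := hc.1; positivity)]
      refine M.abs_logRem_le fun h' hh' ↦ ⟨hball _ (hh'.trans (hc.2.le.trans (hrδ k))), ?_⟩
      exact hm h' (lt_of_le_of_lt hh' hc.2)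
    · exact hm0
  have hτb : ∀ k n y, τ k n y ≤ 2 * ((p : ℝ) ^ 2 * D y) := fun k n y ↦ by
    refine hτle k n y _ (mul_nonneg zero_le_two (M.dom_nonneg y)) fun h' hh' ↦ ?_
    refine (norm_sub_le _ _).trans ?_
    have h1 := M.norm_fderiv_score_le (hball h' (hh'.le.trans (hrδ k))) y
    have h2 := M.norm_fderiv_score_le M.mem_ball y
    linarith
  have hbdd : ∀ k y, BddAbove (range fun n ↦ τ k n y) := fun k y ↦
    ⟨_, by rintro _ ⟨n, rfl⟩; exact hτb k n y⟩
  have hω0 : ∀ k y, 0 ≤ ω k y := fun k y ↦ Real.iSup_nonneg fun n ↦ hτ0 k n y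
  have hωb : ∀ k y, ‖ω k y‖ ≤ 2 * ((p : ℝ) ^ 2 * D y) := fun k y ↦ by
    rw [Real.norm_eq_abs, abs_of_nonneg (hω0 k y)]
    exact ciSup_le fun n ↦ hτb k n y
  have hωm : ∀ k, Measurable (ω k) := fun k ↦ Measurable.iSup fun n ↦ by
    simp only [τ]
    split_ifs
    · exact (measurable_norm.comp (M.measurable_logRem (d n))).div_const _
    · exact measurable_const
  have hDi : Integrable (fun y ↦ 2 * ((p : ℝ) ^ 2 * D y)) (modelLaw μ f θ₀) :=
    (M.integrable_dom.const_mul _).const_mul _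
  have hωi : ∀ k, Integrable (ω k) (modelLaw μ f θ₀) := fun k ↦
    hDi.mono' (hωm k).aestronglyMeasurable (Eventually.of_forall (hωb k))
  have hlim : Tendsto (fun k ↦ ∫ y, ω k y ∂(modelLaw μ f θ₀)) atTop (𝓝 0) := by
    have := tendsto_integral_of_dominated_convergence (μ := modelLaw μ f θ₀) (F := ω)
      (f := fun _ ↦ 0) _ (fun k ↦ (hωm k).aestronglyMeasurable) hDi
      (fun k ↦ Eventually.of_forall (hωb k)) (Eventually.of_forall fun y ↦ by
        rw [Metric.tendsto_nhds]
        intro e he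
        obtain ⟨ρ, hρ, hcont⟩ := Metric.continuousAt_iff.1
          (M.continuousAt_fderiv_score M.mem_param y) (e / 2) (half_pos he)
        filter_upwards [(tendsto_order.1 hrlim).2 ρ hρ] with k hk
        rw [Real.dist_eq, sub_zero, abs_of_nonneg (hω0 k y)]
        refine lt_of_le_of_lt (ciSup_le fun n ↦ hτle k n y (e / 2) (half_pos he).le ?_)
          (half_lt_self he)
        intro h' hh'
        rw [← dist_eq_norm]
        exact (hcont (by simpa [dist_eq_norm] using hh'.trans hk)).le)
    simpa using this
  obtain ⟨k, hk⟩ := ((tendsto_order.1 hlim).2 ε hε).exists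
  refine ⟨r k, hr0 k, ω k, hωi k, hk, fun h hh ↦ ⟨hball h (hh.le.trans (hrδ k)), fun y ↦ ?_⟩⟩
  rcases eq_or_ne h 0 with rfl | hne
  · simp [logRem]
  let U : Set (EuclideanSpace ℝ (Fin p)) := {x | 0 < ‖x‖ ∧ ‖x‖ < r k}
  have hU : IsOpen U := (isOpen_lt continuous_const continuous_norm).inter
    (isOpen_lt continuous_norm continuous_const)
  have hcl : h ∈ closure (U ∩ range d) := hd.open_subset_closure_inter hU ⟨norm_pos_iff.2 hne, hh⟩
  refine ContinuousWithinAt.closure_le hcl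
    (M.continuousAt_logRem y (hball h (hh.le.trans (hrδ k)))).abs.continuousWithinAt
    (f := fun h ↦ |logRem f θ₀ y h|) (g := fun h ↦ ω k y * ‖h‖ ^ 2)
    (Continuous.continuousWithinAt (by fun_prop)) ?_
  rintro _ ⟨hx, n, rfl⟩
  have h1 : τ k n y ≤ ω k y := le_ciSup (hbdd k y) n
  have h2 : τ k n y = |logRem f θ₀ y (d n)| / ‖d n‖ ^ 2 := if_pos hx
  rw [h2, div_le_iff₀ (by have := hx.1; positivity)] at h1
  exact h1

lemma integral_log_sub_eq (M : IsRegularModel μ f Θ 𝓑 θ₀ D) {h : EuclideanSpace ℝ (Fin p)}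
    (hh : θ₀ + h ∈ 𝓑) :
    ∫ y, logRem f θ₀ y h ∂(modelLaw μ f θ₀) =
      ∫ y, (Real.log (f (θ₀ + h) y) - Real.log (f θ₀ y)) ∂(modelLaw μ f θ₀) -
        inner ℝ (∫ y, score f θ₀ y ∂(modelLaw μ f θ₀)) h +
        (∑ a, ∑ b, h a * h b * expInfo μ f θ₀ θ₀ a b) / 2 := by
  have h1 := M.integrable_log_sub hh
  have h2 : Integrable (fun y ↦ inner ℝ (score f θ₀ y) h) (modelLaw μ f θ₀) :=
    M.integrable_score.inner_const h
  have h3 : ∀ a b, Integrable (fun y ↦ h a * h b * info f θ₀ y a b) (modelLaw μ f θ₀) :=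
    fun a b ↦ (M.integrable_info a b).const_mul _
  have h4 : Integrable (fun y ↦ (∑ a, ∑ b, h a * h b * info f θ₀ y a b) / 2) (modelLaw μ f θ₀) :=
    (integrable_finsetSum _ fun a _ ↦ integrable_finsetSum _ fun b _ ↦ h3 a b).div_const 2
  have h12 : Integrable (fun y ↦ Real.log (f (θ₀ + h) y) - Real.log (f θ₀ y) -
      inner ℝ (score f θ₀ y) h) (modelLaw μ f θ₀) := h1.sub h2
  simp only [logRem]
  rw [integral_add h12 h4, integral_sub h1 h2, integral_div, integral_finsetSum _ fun a _ ↦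
    integrable_finsetSum _ fun b _ ↦ h3 a b]
  congr 1
  · congr 1
    simp_rw [real_inner_comm h]
    exact integral_inner M.integrable_score h
  · congr 1
    refine Finset.sum_congr rfl fun a _ ↦ ?_
    rw [integral_finsetSum _ fun b _ ↦ h3 a b]
    refine Finset.sum_congr rfl fun b _ ↦ ?_
    rw [integral_const_mul]
    rfl

/-- Second-order expansion of the Kullback–Leibler divergence, as a one-sided inequality. -/
lemma eventually_inner_sub_le (M : IsRegularModel μ f Θ 𝓑 θ₀ D) {ε : ℝ} (hε : 0 < ε) :
    ∃ δ : ℝ, 0 < δ ∧ ∀ h : EuclideanSpace ℝ (Fin p), ‖h‖ < δ →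
      inner ℝ (∫ y, score f θ₀ y ∂(modelLaw μ f θ₀)) h ≤
        (∑ a, ∑ b, h a * h b * expInfo μ f θ₀ θ₀ a b) / 2 + ε * ‖h‖ ^ 2 := by
  obtain ⟨δ, hδ, ω, hω, hωε, hb⟩ := M.exists_logRem_bound hε
  refine ⟨δ, hδ, fun h hh ↦ ?_⟩
  obtain ⟨h1, h2⟩ := hb h hh
  have h3 := M.integral_log_sub_eq h1
  have h4 := M.integral_log_sub_nonpos h1
  have h5 : -(ε * ‖h‖ ^ 2) ≤ ∫ y, logRem f θ₀ y h ∂(modelLaw μ f θ₀) := by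
    have := norm_integral_le_of_norm_le (μ := modelLaw μ f θ₀) (f := fun y ↦ logRem f θ₀ y h)
      (hω.mul_const (‖h‖ ^ 2)) (Eventually.of_forall h2)
    rw [integral_mul_const, Real.norm_eq_abs] at this
    have h6 := mul_le_mul_of_nonneg_right hωε.le (sq_nonneg ‖h‖)
    linarith [neg_abs_le (∫ y, logRem f θ₀ y h ∂(modelLaw μ f θ₀))]
  linarith

lemma infoForm_smul (B : Matrix (Fin p) (Fin p) ℝ) (s : ℝ) (h : EuclideanSpace ℝ (Fin p)) :
    ∑ a, ∑ b, (s • h) a * (s • h) b * B a b = s ^ 2 * ∑ a, ∑ b, h a * h b * B a b := by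
  simp only [Finset.mul_sum, PiLp.smul_apply, smul_eq_mul]
  exact Finset.sum_congr rfl fun a _ ↦ Finset.sum_congr rfl fun b _ ↦ by ring

/-- The score has mean zero, since the Kullback–Leibler divergence is minimal at `θ₀`. -/
lemma integral_score (M : IsRegularModel μ f Θ 𝓑 θ₀ D) :
    ∫ y, score f θ₀ y ∂(modelLaw μ f θ₀) = 0 := by
  set e := ∫ y, score f θ₀ y ∂(modelLaw μ f θ₀) with he
  obtain ⟨δ, hδ, hb⟩ := M.eventually_inner_sub_le one_pos
  rw [← he] at hb
  set B := (∑ a, ∑ b, e a * e b * expInfo μ f θ₀ θ₀ a b) / 2 + 1 * ‖e‖ ^ 2 with hB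
  have hlim : Tendsto (fun n : ℕ ↦ ((n : ℝ) + 1)⁻¹ * B) atTop (𝓝 0) := by
    have : Tendsto (fun n : ℕ ↦ ((n : ℝ) + 1)⁻¹) atTop (𝓝 0) := by
      simpa using tendsto_one_div_add_atTop_nhds_zero_nat (𝕜 := ℝ)
    simpa using this.mul_const B
  have hlim2 : Tendsto (fun n : ℕ ↦ ‖((n : ℝ) + 1)⁻¹ • e‖) atTop (𝓝 0) := by
    have : Tendsto (fun n : ℕ ↦ ((n : ℝ) + 1)⁻¹) atTop (𝓝 0) := by
      simpa using tendsto_one_div_add_atTop_nhds_zero_nat (𝕜 := ℝ)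
    simpa using (this.smul_const e).norm
  have hle : ‖e‖ ^ 2 ≤ 0 := by
    refine ge_of_tendsto hlim ?_
    filter_upwards [(tendsto_order.1 hlim2).2 δ hδ] with n hn
    have h1 := hb _ hn
    have hn0 : (0 : ℝ) < ((n : ℝ) + 1)⁻¹ := by positivity
    rw [infoForm_smul, inner_smul_right, real_inner_self_eq_norm_sq, norm_smul, mul_pow,
      Real.norm_eq_abs, sq_abs] at h1
    refine le_of_mul_le_mul_left (h1.trans (le_of_eq ?_)) hn0
    rw [hB]
    ring
  exact norm_eq_zero.1 (pow_eq_zero_iff two_ne_zero |>.1 (le_antisymm hle (sq_nonneg _)))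

lemma expInfo_posDef (M : IsRegularModel μ f Θ 𝓑 θ₀ D) : (expInfo μ f θ₀ θ₀).PosDef := by
  have hherm : (expInfo μ f θ₀ θ₀).IsHermitian := by
    ext a b
    simp only [Matrix.conjTranspose_apply, star_trivial, expInfo, Matrix.of_apply]
    exact integral_congr_ae (Eventually.of_forall fun y ↦ M.info_symm M.mem_param y b a)
  have hform : ∀ x : Fin p → ℝ, x ⬝ᵥ (expInfo μ f θ₀ θ₀).mulVec x =
      ∑ a, ∑ b, x a * x b * expInfo μ f θ₀ θ₀ a b := fun x ↦ by
    simp only [dotProduct, Matrix.mulVec, Finset.mul_sum]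
    exact Finset.sum_congr rfl fun a _ ↦ Finset.sum_congr rfl fun b _ ↦ by ring
  have hpsd : (expInfo μ f θ₀ θ₀).PosSemidef := by
    refine Matrix.PosSemidef.of_dotProduct_mulVec_nonneg hherm fun x ↦ ?_
    rw [star_trivial, hform]
    refine le_of_forall_pos_le_add fun η hη ↦ ?_
    let h : EuclideanSpace ℝ (Fin p) := WithLp.toLp 2 x
    have hε : 0 < η / (2 * (‖h‖ ^ 2 + 1)) := by positivity
    obtain ⟨δ, hδ, hb⟩ := M.eventually_inner_sub_le hε
    obtain ⟨s, hs0, hs⟩ : ∃ s : ℝ, 0 < s ∧ ‖s • h‖ < δ := by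
      refine ⟨δ / (2 * (‖h‖ + 1)), by positivity, ?_⟩
      rw [norm_smul, Real.norm_eq_abs, abs_of_pos (by positivity), div_mul_eq_mul_div,
        div_lt_iff₀ (by positivity)]
      nlinarith [norm_nonneg h]
    have h1 := hb _ hs
    rw [M.integral_score, inner_zero_left, infoForm_smul, norm_smul, mul_pow, Real.norm_eq_abs,
      sq_abs] at h1
    have h2 : 0 ≤ s ^ 2 * ((∑ a, ∑ b, h a * h b * expInfo μ f θ₀ θ₀ a b) / 2 +
        η / (2 * (‖h‖ ^ 2 + 1)) * ‖h‖ ^ 2) := by linarith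
    have h3 := nonneg_of_mul_nonneg_right h2 (by positivity)
    have h4 : η / (2 * (‖h‖ ^ 2 + 1)) * ‖h‖ ^ 2 ≤ η / 2 := by
      rw [div_mul_eq_mul_div, div_le_div_iff₀ (by positivity) (by positivity)]
      nlinarith [sq_nonneg ‖h‖]
    have h5 : ∑ a, ∑ b, x a * x b * expInfo μ f θ₀ θ₀ a b =
      ∑ a, ∑ b, h a * h b * expInfo μ f θ₀ θ₀ a b := rfl
    rw [h5]
    linarith
  exact hpsd.posDef_iff_det_ne_zero.2 M.isUnit_det.ne_zero

end IsRegularModel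

end Expansion

/-! ### Weighted maximum likelihood -/

section WeightedLikelihood

variable {p : ℕ} {𝒴 Z : Type*} [MeasurableSpace 𝒴]

/-- The law of large numbers with limit law `ρ` for the weights `v` on the samples `A`, along the
filter `𝓕`. It covers both the design weights and the bootstrap weights. -/
structure HasWeightedLLN (ρ : Measure 𝒴) (𝓕 : Filter Z) (N : Z → ℕ)
    (v : ∀ z, Fin (N z) → ℝ) (A : ∀ z, Finset (Fin (N z))) (y : ∀ z, Fin (N z) → 𝒴) : Prop where
  nonneg : ∀ᶠ z in 𝓕, ∀ i, 0 ≤ v z i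
  tendsto : ∀ g : 𝒴 → ℝ, Integrable g ρ →
    Tendsto (fun z ↦ (N z : ℝ)⁻¹ * ∑ i ∈ A z, v z i * g (y z i)) 𝓕 (𝓝 (∫ y, g y ∂ρ))

lemma exists_le_inner_of_posDef {G : Matrix (Fin p) (Fin p) ℝ} (hG : G.PosDef) :
    ∃ c : ℝ, 0 < c ∧ ∀ x : EuclideanSpace ℝ (Fin p),
      c * ‖x‖ ^ 2 ≤ inner ℝ x (Matrix.toEuclideanCLM (𝕜 := ℝ) G x) := by
  have hpos : ∀ x : EuclideanSpace ℝ (Fin p), x ≠ 0 →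
      0 < inner ℝ x (Matrix.toEuclideanCLM (𝕜 := ℝ) G x) := fun x hx ↦ by
    have := hG.dotProduct_mulVec_pos (x := x.ofLp) (by simpa using hx)
    rw [star_trivial] at this
    simpa [EuclideanSpace.inner_eq_star_dotProduct, dotProduct_comm] using this
  rcases (Metric.sphere (0 : EuclideanSpace ℝ (Fin p)) 1).eq_empty_or_nonempty with he | hne
  · refine ⟨1, one_pos, fun x ↦ ?_⟩
    have hx : x = 0 := by
      by_contra hx
      have : (‖x‖⁻¹ • x) ∈ Metric.sphere (0 : EuclideanSpace ℝ (Fin p)) 1 := by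
        simp [norm_smul, hx]
      rw [he] at this
      exact this
    simp [hx]
  obtain ⟨x₀, hx₀, hmin⟩ := (isCompact_sphere (0 : EuclideanSpace ℝ (Fin p)) 1).exists_isMinOn hne
    (f := fun x ↦ inner ℝ x (Matrix.toEuclideanCLM (𝕜 := ℝ) G x)) (by fun_prop)
  have hx₀' : x₀ ≠ 0 := by rintro rfl; simp at hx₀
  refine ⟨_, hpos x₀ hx₀', fun x ↦ ?_⟩
  rcases eq_or_ne x 0 with rfl | hx
  · simp
  have h1 : (‖x‖⁻¹ • x) ∈ Metric.sphere (0 : EuclideanSpace ℝ (Fin p)) 1 := by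
    simp [norm_smul, hx]
  have h2 := hmin h1
  simp only [mem_ofPred_eq, map_smul, inner_smul_left, inner_smul_right, conj_trivial] at h2
  have h3 : 0 < ‖x‖ := norm_pos_iff.2 hx
  calc _ ≤ ‖x‖⁻¹ * (‖x‖⁻¹ * inner ℝ x (Matrix.toEuclideanCLM (𝕜 := ℝ) G x)) * ‖x‖ ^ 2 := by
        gcongr
    _ = _ := by field_simp

lemma inner_toEuclideanCLM_eq_sum (G : Matrix (Fin p) (Fin p) ℝ) (h : EuclideanSpace ℝ (Fin p)) :
    inner ℝ h (Matrix.toEuclideanCLM (𝕜 := ℝ) G h) = ∑ a, ∑ b, h a * h b * G a b := by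
  rw [PiLp.inner_apply]
  refine Finset.sum_congr rfl fun a _ ↦ ?_
  simp only [RCLike.inner_apply, conj_trivial, Matrix.ofLp_toEuclideanCLM, Matrix.mulVec,
    dotProduct, Finset.sum_mul]
  exact Finset.sum_congr rfl fun b _ ↦ by ring

namespace HasWeightedLLN

variable {μ : Measure 𝒴} {f : EuclideanSpace ℝ (Fin p) → 𝒴 → ℝ}
  {Θ 𝓑 : Set (EuclideanSpace ℝ (Fin p))} {θ₀ θ θ' : EuclideanSpace ℝ (Fin p)} {D : 𝒴 → ℝ}
  {𝓕 : Filter Z} {N : Z → ℕ} {v : ∀ z, Fin (N z) → ℝ} {A : ∀ z, Finset (Fin (N z))}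
  {y : ∀ z, Fin (N z) → 𝒴}

lemma tendsto_wScore (L : HasWeightedLLN (modelLaw μ f θ₀) 𝓕 N v A y)
    (M : IsRegularModel μ f Θ 𝓑 θ₀ D) :
    Tendsto (fun z ↦ wScore f (v z) (A z) (y z) θ₀) 𝓕 (𝓝 0) := by
  have h : ∀ a, Tendsto (fun z ↦ (N z : ℝ)⁻¹ * ∑ i ∈ A z, v z i * score f θ₀ (y z i) a) 𝓕
      (𝓝 0) := fun a ↦ by
    have h1 := L.tendsto (fun y ↦ score f θ₀ y a)
      ((EuclideanSpace.proj (𝕜 := ℝ) a : EuclideanSpace ℝ (Fin p) →L[ℝ] ℝ).integrable_comp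
        M.integrable_score)
    have h2 := (EuclideanSpace.proj (𝕜 := ℝ) a : EuclideanSpace ℝ (Fin p) →L[ℝ] ℝ).integral_comp_comm
      M.integrable_score
    rw [M.integral_score, map_zero] at h2
    rwa [show ∫ y, score f θ₀ y a ∂(modelLaw μ f θ₀) = 0 from h2] at h1
  have h2 : Tendsto (fun z a ↦ (N z : ℝ)⁻¹ * ∑ i ∈ A z, v z i * score f θ₀ (y z i) a) 𝓕
      (𝓝 (0 : Fin p → ℝ)) := tendsto_pi_nhds.2 h
  have h3 := ((PiLp.continuous_toLp 2 (fun _ : Fin p ↦ ℝ)).tendsto 0).comp h2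
  refine h3.congr fun z ↦ ?_
  ext a
  simp [wScore, Finset.sum_apply]

/-- The weighted log-likelihood is uniformly approximated by a quadratic near `θ₀`. -/
lemma eventually_quadratic (L : HasWeightedLLN (modelLaw μ f θ₀) 𝓕 N v A y)
    (M : IsRegularModel μ f Θ 𝓑 θ₀ D) {η : ℝ} (hη : 0 < η) :
    ∃ δ : ℝ, 0 < δ ∧ ∀ᶠ z in 𝓕, ∀ h : EuclideanSpace ℝ (Fin p), ‖h‖ < δ → θ₀ + h ∈ 𝓑 ∧
      |logLik f (v z) (A z) (y z) (θ₀ + h) - logLik f (v z) (A z) (y z) θ₀ -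
        (inner ℝ (wScore f (v z) (A z) (y z) θ₀) h -
          inner ℝ h (Matrix.toEuclideanCLM (𝕜 := ℝ) (expInfo μ f θ₀ θ₀) h) / 2)| ≤
        η * ‖h‖ ^ 2 := by
  obtain ⟨δ, hδ, ω, hω, hωη, hb⟩ := M.exists_logRem_bound (half_pos hη)
  refine ⟨δ, hδ, ?_⟩
  let Ĝ : Z → Fin p → Fin p → ℝ := fun z a b ↦
    (N z : ℝ)⁻¹ * ∑ i ∈ A z, v z i * info f θ₀ (y z i) a b
  have hG : Tendsto (fun z ↦ ∑ a, ∑ b, |Ĝ z a b - expInfo μ f θ₀ θ₀ a b|) 𝓕 (𝓝 0) := by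
    have : Tendsto (fun z ↦ ∑ a, ∑ b, |Ĝ z a b - expInfo μ f θ₀ θ₀ a b|) 𝓕
        (𝓝 (∑ _a : Fin p, ∑ _b : Fin p, 0)) := by
      refine tendsto_finsetSum _ fun a _ ↦ tendsto_finsetSum _ fun b _ ↦ ?_
      have := ((L.tendsto _ (M.integrable_info a b)).sub_const (expInfo μ f θ₀ θ₀ a b)).abs
      rwa [show ∫ y, info f θ₀ y a b ∂(modelLaw μ f θ₀) = expInfo μ f θ₀ θ₀ a b from rfl,
        sub_self, abs_zero] at this
    simpa using this
  filter_upwards [L.nonneg, (tendsto_order.1 (L.tendsto ω hω)).2 _ hωη,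
    (tendsto_order.1 hG).2 η hη] with z hv hωz hGz h hh
  obtain ⟨h1, h2⟩ := hb h hh
  refine ⟨h1, ?_⟩
  have hN0 : (0 : ℝ) ≤ (N z : ℝ)⁻¹ := by positivity
  have e : logLik f (v z) (A z) (y z) (θ₀ + h) - logLik f (v z) (A z) (y z) θ₀ -
        (inner ℝ (wScore f (v z) (A z) (y z) θ₀) h -
          inner ℝ h (Matrix.toEuclideanCLM (𝕜 := ℝ) (expInfo μ f θ₀ θ₀) h) / 2) =
      (N z : ℝ)⁻¹ * ∑ i ∈ A z, v z i * logRem f θ₀ (y z i) h -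
        (∑ a, ∑ b, h a * h b * (Ĝ z a b - expInfo μ f θ₀ θ₀ a b)) / 2 := by
    have e1 : ∑ a, ∑ b, h a * h b * Ĝ z a b = (N z : ℝ)⁻¹ * ∑ i ∈ A z, v z i *
        ∑ a, ∑ b, h a * h b * info f θ₀ (y z i) a b := by
      simp only [Ĝ, Finset.mul_sum]
      simp_rw [Finset.sum_comm (t := A z)]
      exact Finset.sum_congr rfl fun i _ ↦ Finset.sum_congr rfl fun a _ ↦
        Finset.sum_congr rfl fun b _ ↦ by ring
    simp only [mul_sub, Finset.sum_sub_distrib]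
    rw [inner_toEuclideanCLM_eq_sum, e1]
    simp only [logLik, wScore, logRem, inner_smul_left, sum_inner, conj_trivial, mul_add, mul_sub,
      Finset.sum_add_distrib, Finset.sum_sub_distrib]
    have e2 : ∀ i, v z i * ((∑ a, ∑ b, h a * h b * info f θ₀ (y z i) a b) / 2) =
        (v z i * ∑ a, ∑ b, h a * h b * info f θ₀ (y z i) a b) / 2 := fun i ↦ by ring
    simp_rw [e2, ← Finset.sum_div]
    ring
  rw [e]
  have b1 : |(N z : ℝ)⁻¹ * ∑ i ∈ A z, v z i * logRem f θ₀ (y z i) h| ≤ η / 2 * ‖h‖ ^ 2 := by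
    rw [abs_mul, abs_of_nonneg hN0]
    calc _ ≤ (N z : ℝ)⁻¹ * ∑ i ∈ A z, v z i * (ω (y z i) * ‖h‖ ^ 2) := by
          refine mul_le_mul_of_nonneg_left ((Finset.abs_sum_le_sum_abs _ _).trans
            (Finset.sum_le_sum fun i _ ↦ ?_)) hN0
          rw [abs_mul, abs_of_nonneg (hv i)]
          exact mul_le_mul_of_nonneg_left (h2 _) (hv i)
      _ = ((N z : ℝ)⁻¹ * ∑ i ∈ A z, v z i * ω (y z i)) * ‖h‖ ^ 2 := by
          simp only [← mul_assoc, ← Finset.sum_mul]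
      _ ≤ _ := by gcongr
  have b2 : |∑ a, ∑ b, h a * h b * (Ĝ z a b - expInfo μ f θ₀ θ₀ a b)| ≤ η * ‖h‖ ^ 2 := by
    calc _ ≤ ∑ a, ∑ b, ‖h‖ ^ 2 * |Ĝ z a b - expInfo μ f θ₀ θ₀ a b| := by
          refine (Finset.abs_sum_le_sum_abs _ _).trans (Finset.sum_le_sum fun a _ ↦
            (Finset.abs_sum_le_sum_abs _ _).trans (Finset.sum_le_sum fun b _ ↦ ?_))
          rw [abs_mul, abs_mul, sq]
          gcongr
          · exact PiLp.norm_apply_le h a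
          · exact PiLp.norm_apply_le h b
      _ = ‖h‖ ^ 2 * ∑ a, ∑ b, |Ĝ z a b - expInfo μ f θ₀ θ₀ a b| := by simp only [Finset.mul_sum]
      _ ≤ ‖h‖ ^ 2 * η := by gcongr
      _ = _ := mul_comm _ _
  rw [abs_le] at b1 b2 ⊢
  constructor <;> linarith

/-- Away from `θ₀` the weighted log-likelihood is smaller than at `θ₀`. -/
lemma eventually_logLik_lt (L : HasWeightedLLN (modelLaw μ f θ₀) 𝓕 N v A y)
    (M : IsRegularModel μ f Θ 𝓑 θ₀ D) {δ : ℝ} (hδ : 0 < δ) :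
    ∀ᶠ z in 𝓕, ∀ θ ∈ 𝓑, δ ≤ ‖θ - θ₀‖ →
      logLik f (v z) (A z) (y z) θ < logLik f (v z) (A z) (y z) θ₀ := by
  have hK : IsCompact (𝓑 ∩ {θ | δ ≤ ‖θ - θ₀‖}) :=
    M.compact.inter_right (isClosed_le continuous_const (by fun_prop))
  suffices h : ∀ᶠ z in 𝓕, ∀ θ ∈ 𝓑 ∩ {θ | δ ≤ ‖θ - θ₀‖},
      logLik f (v z) (A z) (y z) θ < logLik f (v z) (A z) (y z) θ₀ by
    filter_upwards [h] with z hz θ h1 h2 using hz θ ⟨h1, h2⟩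
  refine hK.induction_on (p := fun s ↦ ∀ᶠ z in 𝓕, ∀ θ ∈ s,
      logLik f (v z) (A z) (y z) θ < logLik f (v z) (A z) (y z) θ₀) (by simp)
    (fun s t hst ht ↦ ht.mono fun z hz θ hθ ↦ hz θ (hst hθ))
    (fun s t hs ht ↦ by
      filter_upwards [hs, ht] with z h1 h2 θ hθ
      exact hθ.elim (h1 θ) (h2 θ)) ?_
  rintro θ₁ ⟨h1, h2⟩
  have hne : θ₁ ≠ θ₀ := by
    rintro rfl
    simp only [mem_ofPred_eq, sub_self, norm_zero] at h2
    linarith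
  have hkl := M.integral_log_sub_neg h1 hne
  set k := ∫ y, (Real.log (f θ₁ y) - Real.log (f θ₀ y)) ∂(modelLaw μ f θ₀) with hk
  obtain ⟨ε, hε, hεk⟩ : ∃ ε : ℝ, 0 < ε ∧
      k + ε * ∫ y, IsRegularModel.lipConst f 𝓑 θ₀ D y ∂(modelLaw μ f θ₀) < 0 := by
    set c := ∫ y, IsRegularModel.lipConst f 𝓑 θ₀ D y ∂(modelLaw μ f θ₀)
    refine ⟨-k / (2 * (|c| + 1)), div_pos (by linarith) (by positivity), ?_⟩
    have h3 : -k / (2 * (|c| + 1)) * c ≤ -k / 2 := by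
      rw [div_mul_eq_mul_div, div_le_div_iff₀ (by positivity) two_pos]
      nlinarith [le_abs_self c, abs_nonneg c]
    linarith
  refine ⟨(𝓑 ∩ {θ | δ ≤ ‖θ - θ₀‖}) ∩ Metric.ball θ₁ ε,
    inter_mem self_mem_nhdsWithin (mem_nhdsWithin_of_mem_nhds (Metric.ball_mem_nhds _ hε)), ?_⟩
  have hlim := (L.tendsto _ (M.integrable_log_sub h1)).add
    ((L.tendsto _ M.integrable_lipConst).const_mul ε)
  filter_upwards [L.nonneg, (tendsto_order.1 hlim).2 0 hεk] with z hv hz θ hθ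
  rw [← sub_neg]
  refine lt_of_le_of_lt ?_ hz
  have hN0 : (0 : ℝ) ≤ (N z : ℝ)⁻¹ := by positivity
  rw [logLik, logLik, ← mul_sub, ← Finset.sum_sub_distrib, mul_left_comm ε, ← mul_add,
    Finset.mul_sum _ _ ε, ← Finset.sum_add_distrib]
  refine mul_le_mul_of_nonneg_left (Finset.sum_le_sum fun i _ ↦ ?_) hN0
  have h4 := (le_abs_self _).trans (M.abs_log_sub_le h1 hθ.1.1 (y z i))
  have h5 : 0 ≤ IsRegularModel.lipConst f 𝓑 θ₀ D (y z i) := by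
    have := mul_nonneg (M.dom_nonneg (y z i)) (Metric.diam_nonneg (s := 𝓑))
    rw [IsRegularModel.lipConst]
    positivity
  have h6 : ‖θ - θ₁‖ ≤ ε := by
    rw [← dist_eq_norm]
    exact (Metric.mem_ball.1 hθ.2).le
  have h7 := mul_le_mul_of_nonneg_left h6 h5
  calc _ = v z i * (Real.log (f θ (y z i)) - Real.log (f θ₀ (y z i))) := by ring
    _ ≤ v z i * ((Real.log (f θ₁ (y z i)) - Real.log (f θ₀ (y z i))) +
        ε * IsRegularModel.lipConst f 𝓑 θ₀ D (y z i)) := mul_le_mul_of_nonneg_left (by linarith) (hv i)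
    _ = _ := by ring

/-- First-order asymptotics of maximizers of the weighted log-likelihood and of its maximum. -/
lemma eventually_isMaxOn (L : HasWeightedLLN (modelLaw μ f θ₀) 𝓕 N v A y)
    (M : IsRegularModel μ f Θ 𝓑 θ₀ D) {η : ℝ} (hη : 0 < η) :
    ∀ᶠ z in 𝓕, ∀ θ ∈ 𝓑, IsMaxOn (logLik f (v z) (A z) (y z)) Θ θ →
      ‖θ - θ₀ - Matrix.toEuclideanCLM (𝕜 := ℝ) (expInfo μ f θ₀ θ₀)⁻¹
        (wScore f (v z) (A z) (y z) θ₀)‖ ≤ η * ‖wScore f (v z) (A z) (y z) θ₀‖ ∧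
      |logLik f (v z) (A z) (y z) θ - logLik f (v z) (A z) (y z) θ₀ -
        inner ℝ (wScore f (v z) (A z) (y z) θ₀) (Matrix.toEuclideanCLM (𝕜 := ℝ)
          (expInfo μ f θ₀ θ₀)⁻¹ (wScore f (v z) (A z) (y z) θ₀)) / 2| ≤
        η * ‖wScore f (v z) (A z) (y z) θ₀‖ ^ 2 := by
  have hG := M.expInfo_posDef
  set G := Matrix.toEuclideanCLM (𝕜 := ℝ) (expInfo μ f θ₀ θ₀) with hGdef
  set J := Matrix.toEuclideanCLM (𝕜 := ℝ) (expInfo μ f θ₀ θ₀)⁻¹ with hJdef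
  have hGJ : ∀ x, G (J x) = x := fun x ↦ by
    rw [← mul_apply_eq_comp, hGdef, hJdef, ← map_mul,
      Matrix.mul_nonsing_inv _ M.isUnit_det, map_one]
    rfl
  have hGs : ∀ x x', inner ℝ x (G x') = inner ℝ x' (G x) := fun x x' ↦ by
    have hsym : ∀ a b, expInfo μ f θ₀ θ₀ a b = expInfo μ f θ₀ θ₀ b a := fun a b ↦ by
      have := hG.isHermitian.apply a b
      simpa using this.symm
    simp only [PiLp.inner_apply, hGdef, Matrix.ofLp_toEuclideanCLM, Matrix.mulVec, dotProduct,
      RCLike.inner_apply, conj_trivial, Finset.sum_mul]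
    rw [Finset.sum_comm]
    exact Finset.sum_congr rfl fun a _ ↦ Finset.sum_congr rfl fun b _ ↦ by rw [hsym b a]; ring
  obtain ⟨c, hc, hcG⟩ := exists_le_inner_of_posDef hG
  rw [← hGdef] at hcG
  -- `τ` is the precision of the quadratic approximation that yields the accuracy `η`
  obtain ⟨κ, hκ, hκη1, hκη2⟩ : ∃ κ : ℝ, 0 < κ ∧ κ * ‖J‖ ≤ η ∧ κ ≤ 1 := by
    refine ⟨min 1 (η / (‖J‖ + 1)), by positivity, ?_, min_le_left _ _⟩
    calc _ ≤ η / (‖J‖ + 1) * ‖J‖ := by gcongr; exact min_le_right _ _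
      _ ≤ η := by rw [div_mul_eq_mul_div, div_le_iff₀ (by positivity)]; nlinarith [norm_nonneg J]
  obtain ⟨τ, hτ, hτ1, hτ2, hτ3⟩ : ∃ τ : ℝ, 0 < τ ∧ 2 * τ ≤ c / 4 ∧ 3 * τ ≤ c / 4 * κ ^ 2 ∧
      τ * 4 * ‖J‖ ^ 2 ≤ η := by
    refine ⟨min (c / 12 * κ ^ 2) (η / (4 * (‖J‖ ^ 2 + 1))), by positivity, ?_, ?_, ?_⟩
    · have h1 : min (c / 12 * κ ^ 2) (η / (4 * (‖J‖ ^ 2 + 1))) ≤ c / 12 * κ ^ 2 := min_le_left _ _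
      have h2 : κ ^ 2 ≤ 1 := pow_le_one₀ hκ.le hκη2
      nlinarith
    · have h1 : min (c / 12 * κ ^ 2) (η / (4 * (‖J‖ ^ 2 + 1))) ≤ c / 12 * κ ^ 2 := min_le_left _ _
      linarith
    · calc _ ≤ η / (4 * (‖J‖ ^ 2 + 1)) * 4 * ‖J‖ ^ 2 := by gcongr; exact min_le_right _ _
        _ ≤ η := by
          rw [div_mul_eq_mul_div, div_mul_eq_mul_div, div_le_iff₀ (by positivity)]
          nlinarith [sq_nonneg ‖J‖]
  obtain ⟨δ, hδ, hquad⟩ := L.eventually_quadratic M hτ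
  rw [← hGdef] at hquad
  have hJs : Tendsto (fun z ↦ ‖J (wScore f (v z) (A z) (y z) θ₀)‖) 𝓕 (𝓝 0) := by
    have := ((J.continuous.tendsto 0).comp (L.tendsto_wScore M)).norm
    simpa using this
  filter_upwards [hquad, L.eventually_logLik_lt M hδ, (tendsto_order.1 hJs).2 δ hδ]
    with z hq hlt hz θ hθ hmax
  set s := wScore f (v z) (A z) (y z) θ₀
  set l := logLik f (v z) (A z) (y z)
  have hJs0 : ‖J s‖ ≤ ‖J‖ * ‖s‖ := J.le_opNorm s
  have hclose : ‖θ - θ₀‖ < δ := by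
    by_contra! hcon
    exact absurd (hlt θ hθ hcon) (not_lt.2 (hmax M.mem_param))
  obtain ⟨hmem, hq0⟩ := hq (J s) hz
  obtain ⟨-, hq1⟩ := hq (θ - θ₀) hclose
  rw [add_sub_cancel] at hq1
  have hge : l (θ₀ + J s) ≤ l θ := hmax (M.subset hmem)
  set u := θ - θ₀ - J s with hu
  have hθu : θ - θ₀ = J s + u := by rw [hu]; abel
  -- completing the square
  have hsq : inner ℝ s (θ - θ₀) - inner ℝ (θ - θ₀) (G (θ - θ₀)) / 2 =
      inner ℝ s (J s) / 2 - inner ℝ u (G u) / 2 := by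
    have h1 : inner ℝ (J s) (G u) = inner ℝ s u := by rw [hGs, hGJ, real_inner_comm]
    have h2 : inner ℝ (J s) (G (J s)) = inner ℝ s (J s) := by rw [hGJ, real_inner_comm]
    have h3 : inner ℝ u (G (J s)) = inner ℝ s u := by rw [hGJ, real_inner_comm]
    rw [hθu]
    simp only [map_add, inner_add_left, inner_add_right, h1, h2, h3]
    ring
  have hsq0 : inner ℝ s (J s) - inner ℝ (J s) (G (J s)) / 2 = inner ℝ s (J s) / 2 := by
    rw [hGJ, real_inner_comm (J s) s]
    ring
  rw [hsq] at hq1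
  rw [hsq0] at hq0
  rw [abs_le] at hq0 hq1
  have hcu := hcG u
  have hn : ‖θ - θ₀‖ ^ 2 ≤ 2 * ‖J s‖ ^ 2 + 2 * ‖u‖ ^ 2 := by
    rw [hθu]
    have := norm_add_le (J s) u
    nlinarith [sq_nonneg (‖J s‖ - ‖u‖), norm_nonneg (J s + u)]
  have hτn := mul_le_mul_of_nonneg_left hn hτ.le
  have hmain : c / 4 * ‖u‖ ^ 2 ≤ 3 * τ * ‖J s‖ ^ 2 := by
    have h1 : 2 * τ * ‖u‖ ^ 2 ≤ c / 4 * ‖u‖ ^ 2 := mul_le_mul_of_nonneg_right hτ1 (sq_nonneg _)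
    linarith
  have hu2 : ‖u‖ ^ 2 ≤ (κ * ‖J s‖) ^ 2 := by
    have h1 : 3 * τ * ‖J s‖ ^ 2 ≤ c / 4 * κ ^ 2 * ‖J s‖ ^ 2 :=
      mul_le_mul_of_nonneg_right hτ2 (sq_nonneg _)
    have h2 : c / 4 * ‖u‖ ^ 2 ≤ c / 4 * (κ * ‖J s‖) ^ 2 := by rw [mul_pow]; linarith
    exact le_of_mul_le_mul_left h2 (by positivity)
  have hu1 : ‖u‖ ≤ κ * ‖J s‖ := le_of_sq_le_sq hu2 (by positivity)
  have hJs2 : ‖J s‖ ^ 2 ≤ ‖J‖ ^ 2 * ‖s‖ ^ 2 := by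
    rw [← mul_pow]
    exact pow_le_pow_left₀ (norm_nonneg _) hJs0 2
  have hfin : τ * 4 * ‖J s‖ ^ 2 ≤ η * ‖s‖ ^ 2 := by
    have h1 := mul_le_mul_of_nonneg_left hJs2 (by positivity : 0 ≤ τ * 4)
    have h2 := mul_le_mul_of_nonneg_right hτ3 (sq_nonneg ‖s‖)
    linarith
  have hu3 : ‖u‖ ^ 2 ≤ ‖J s‖ ^ 2 := by
    refine pow_le_pow_left₀ (norm_nonneg _) (hu1.trans ?_) 2
    exact mul_le_of_le_one_left (norm_nonneg _) hκη2
  have hτu := mul_le_mul_of_nonneg_left hu3 hτ.le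
  have hcu0 : 0 ≤ inner ℝ u (G u) := le_trans (by positivity) hcu
  refine ⟨?_, ?_⟩
  · calc ‖u‖ ≤ κ * (‖J‖ * ‖s‖) := hu1.trans (mul_le_mul_of_nonneg_left hJs0 hκ.le)
      _ = κ * ‖J‖ * ‖s‖ := by ring
      _ ≤ η * ‖s‖ := mul_le_mul_of_nonneg_right hκη1 (norm_nonneg _)
  · have hτ0 : 0 ≤ τ * ‖J s‖ ^ 2 := by positivity
    rw [abs_le]
    constructor <;> linarith

end HasWeightedLLN

end WeightedLikelihood

/-! ### Matrix square roots and quadratic forms in Gaussian vectors -/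

section GaussianQuadraticForms

variable {p : ℕ}

/-- Continuity of the square root of positive semidefinite matrices, in terms of the roots: by
compactness it is enough that the square root of the limit is unique. -/
lemma tendsto_matrix_sqrt {ι : Type*} {𝓕 : Filter ι} {B : ι → Matrix (Fin p) (Fin p) ℝ}
    {V : Matrix (Fin p) (Fin p) ℝ} (hB : ∀ᶠ i in 𝓕, (B i).PosSemidef)
    (h : Tendsto (fun i ↦ B i * B i) 𝓕 (𝓝 V)) : Tendsto B 𝓕 (𝓝 (CFC.sqrt V)) := by
  have hdiag : ∀ᶠ i in 𝓕, ∀ a, (B i * B i) a a < V a a + 1 := by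
    rw [eventually_all]
    intro a
    have h1 : Tendsto (fun i ↦ (B i * B i) a a) 𝓕 (𝓝 (V a a)) :=
      tendsto_pi_nhds.1 (tendsto_pi_nhds.1 h a) a
    exact (tendsto_order.1 h1).2 _ (lt_add_one _)
  let K : Set (Matrix (Fin p) (Fin p) ℝ) := Set.pi univ fun a ↦ Set.pi univ fun _ ↦
    Icc (-(√(V a a + 1))) (√(V a a + 1))
  have hK : IsCompact K := isCompact_univ_pi fun a ↦ isCompact_univ_pi fun _ ↦ isCompact_Icc
  refine hK.tendsto_nhds_of_unique_mapClusterPt ?_ ?_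
  · filter_upwards [hB, hdiag] with i hi hd a _ b _
    have hsym : ∀ b, B i b a = B i a b := fun b ↦ by simpa using hi.isHermitian.apply a b
    have h1 : B i a b ^ 2 ≤ (B i * B i) a a := by
      rw [Matrix.mul_apply]
      have h2 : ∀ c, B i a c * B i c a = B i a c ^ 2 := fun c ↦ by rw [hsym]; ring
      simp_rw [h2]
      exact Finset.single_le_sum (f := fun c ↦ B i a c ^ 2) (fun c _ ↦ sq_nonneg _)
        (Finset.mem_univ b)
    exact abs_le.1 (Real.abs_le_sqrt (h1.trans (hd a).le))
  · intro X _ hX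
    have hclosed : IsClosed {X : Matrix (Fin p) (Fin p) ℝ | X.PosSemidef} := by
      have : {X : Matrix (Fin p) (Fin p) ℝ | X.PosSemidef} =
          {X | X.transpose = X} ∩ ⋂ x : Fin p → ℝ, {X | 0 ≤ x ⬝ᵥ X.mulVec x} := by
        ext X
        simp [Matrix.posSemidef_iff_dotProduct_mulVec, Matrix.IsHermitian]
      rw [this]
      refine (isClosed_eq (by fun_prop) continuous_id).inter (isClosed_iInter fun x ↦
        isClosed_le continuous_const ?_)
      exact Continuous.dotProduct continuous_const (Continuous.matrix_mulVec continuous_id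
        continuous_const)
    have h1 : X.PosSemidef := by
      by_contra hcon
      have h2 : ∀ᶠ Y in 𝓝 X, ¬ Y.PosSemidef := hclosed.isOpen_compl.mem_nhds hcon
      have h3 : ∃ᶠ i in 𝓕, ¬ (B i).PosSemidef := hX.frequently h2
      exact h3 (hB.mono fun i hi hc ↦ hc hi)
    have h2 : X * X = V := by
      have hc : MapClusterPt (X * X) 𝓕 (fun i ↦ B i * B i) :=
        hX.tendsto_comp (f := fun Y : Matrix (Fin p) (Fin p) ℝ ↦ Y * Y)
          ((by fun_prop : Continuous fun Y : Matrix (Fin p) (Fin p) ℝ ↦ Y * Y).tendsto X)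
      have : ClusterPt (X * X) (𝓝 V) := ClusterPt.mono hc h
      exact eq_of_nhds_neBot this
    exact (CFC.sqrt_unique h2 h1.nonneg).symm

/-- Passing from standardized to normalized vectors in a central limit theorem. -/
lemma tendsto_integral_of_standardized {Ω : Type*} [MeasurableSpace Ω] {P : Measure Ω}
    [IsProbabilityMeasure P] {n₀ : ℕ → ℝ} {s : ℕ → Ω → EuclideanSpace ℝ (Fin p)}
    {V : ℕ → Matrix (Fin p) (Fin p) ℝ} {Vs : Matrix (Fin p) (Fin p) ℝ}
    (hs : ∀ ν, Measurable (s ν)) (hV : ∀ᶠ ν in atTop, (V ν).PosSemidef) (hVs : Vs.PosDef)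
    (hn₀ : Tendsto n₀ atTop atTop) (hlim : Tendsto (fun ν ↦ n₀ ν • V ν) atTop (𝓝 Vs))
    (hclt : TendstoInDistribution (fun ν ω ↦ Matrix.toEuclideanCLM (𝕜 := ℝ)
      (CFC.sqrt (V ν))⁻¹ (s ν ω)) atTop (fun z ↦ z) (fun _ ↦ P)
      (stdGaussian (EuclideanSpace ℝ (Fin p)))) (h : EuclideanSpace ℝ (Fin p) →ᵇ ℝ) :
    Tendsto (fun ν ↦ ∫ ω, h (√(n₀ ν) • s ν ω) ∂P) atTop
      (𝓝 (∫ x, h x ∂(multivariateGaussian 0 Vs))) := by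
  have hroot : Tendsto (fun ν ↦ √(n₀ ν) • CFC.sqrt (V ν)) atTop (𝓝 (CFC.sqrt Vs)) := by
    refine tendsto_matrix_sqrt ?_ (hlim.congr' ?_)
    · exact Eventually.of_forall fun ν ↦
        (Matrix.nonneg_iff_posSemidef.1 (CFC.sqrt_nonneg (V ν))).smul (Real.sqrt_nonneg _)
    · filter_upwards [hV, hn₀.eventually_ge_atTop 0] with ν h1 h2
      rw [smul_mul_smul_comm, Real.mul_self_sqrt h2, CFC.sqrt_mul_sqrt_self _ h1.nonneg]
  have hdet : ∀ᶠ ν in atTop, IsUnit (CFC.sqrt (V ν)).det := by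
    have h1 : Tendsto (fun ν ↦ (n₀ ν • V ν).det) atTop (𝓝 Vs.det) :=
      ((by fun_prop : Continuous fun B : Matrix (Fin p) (Fin p) ℝ ↦ B.det).tendsto _).comp hlim
    filter_upwards [h1.eventually_ne hVs.det_pos.ne', hV, hn₀.eventually_gt_atTop 0] with ν h2 h3 h4
    rw [isUnit_iff_ne_zero]
    intro h5
    refine h2 ?_
    rw [← CFC.sqrt_mul_sqrt_self (V ν) h3.nonneg, Matrix.det_smul, Matrix.det_mul, h5]
    simp
  let T : (Σ _ : ℕ, Ω) → EuclideanSpace ℝ (Fin p) := fun x ↦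
    Matrix.toEuclideanCLM (𝕜 := ℝ) (CFC.sqrt (V x.1))⁻¹ (s x.1 x.2)
  have hT : ∀ g : EuclideanSpace ℝ (Fin p) →ᵇ ℝ, Tendsto (fun ν ↦ ∫ ω, g (T ⟨ν, ω⟩) ∂P) atTop
      (𝓝 (∫ z, g z ∂(stdGaussian (EuclideanSpace ℝ (Fin p))))) := fun g ↦ by
    have h1 := ProbabilityMeasure.tendsto_iff_forall_integral_tendsto.1 hclt.tendsto g
    simp only [ProbabilityMeasure.coe_mk, Measure.map_id'] at h1
    refine h1.congr fun ν ↦ ?_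
    exact integral_map (hclt.forall_aemeasurable ν) g.continuous.measurable.aestronglyMeasurable
  have hcont : Continuous fun B : Matrix (Fin p) (Fin p) ℝ ↦ Matrix.toEuclideanCLM (𝕜 := ℝ) B :=
    LinearMap.continuous_of_finiteDimensional
      (Matrix.toEuclideanCLM (n := Fin p) (𝕜 := ℝ)).toAlgEquiv.toLinearMap
  have hop : Tendsto (fun ν ↦ ‖Matrix.toEuclideanCLM (𝕜 := ℝ) (√(n₀ ν) • CFC.sqrt (V ν)) -
      Matrix.toEuclideanCLM (𝕜 := ℝ) (CFC.sqrt Vs)‖) atTop (𝓝 0) :=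
    tendsto_iff_norm_sub_tendsto_zero.1 ((hcont.tendsto _).comp hroot)
  have key := tendsto_integral_of_slutsky (𝓕 := atTop) (κ := fun _ : ℕ ↦ P) (R := T)
    (W := fun x ↦ √(n₀ x.1) • s x.1 x.2)
    (q := fun z ↦ 0 + Matrix.toEuclideanCLM (𝕜 := ℝ) (CFC.sqrt Vs) z) (by fun_prop)
    (Eventually.of_forall fun _ ↦ inferInstance)
    (Eventually.of_forall fun ν ↦ hclt.forall_aemeasurable ν)
    (Eventually.of_forall fun ν ↦ ((hs ν).const_smul √(n₀ ν)).aemeasurable) hT (fun η hη ↦ ?_) h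
  · rw [multivariateGaussian, integral_map (by fun_prop)
      h.continuous.measurable.aestronglyMeasurable]
    exact key
  suffices hQ : ∀ᶠ ν in atTop, ∀ ω, dist (√(n₀ ν) • s ν ω)
      (0 + Matrix.toEuclideanCLM (𝕜 := ℝ) (CFC.sqrt Vs) (T ⟨ν, ω⟩)) ≤
        η * (1 + ‖T ⟨ν, ω⟩‖ ^ 2) by
    filter_upwards [tendsto_fst_probFilter.eventually hQ] with x hx
    exact hx x.2
  filter_upwards [hdet, (tendsto_order.1 hop).2 η hη] with ν h1 h2 ω
  have e : √(n₀ ν) • s ν ω = Matrix.toEuclideanCLM (𝕜 := ℝ) (√(n₀ ν) • CFC.sqrt (V ν))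
      (T ⟨ν, ω⟩) := by
    simp only [T]
    rw [← mul_apply_eq_comp, ← map_mul, smul_mul_assoc, Matrix.mul_nonsing_inv _ h1,
      map_smul, map_one]
    rfl
  rw [e, zero_add, dist_eq_norm, ← sub_apply]
  refine (ContinuousLinearMap.le_opNorm _ _).trans ?_
  have h3 : ‖T ⟨ν, ω⟩‖ ≤ 1 + ‖T ⟨ν, ω⟩‖ ^ 2 := by nlinarith [sq_nonneg (‖T ⟨ν, ω⟩‖ - 1)]
  exact mul_le_mul h2.le h3 (norm_nonneg _) hη.le

lemma dotProduct_mulVec_eq_sum (B : Matrix (Fin p) (Fin p) ℝ) (x : Fin p → ℝ) :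
    x ⬝ᵥ B.mulVec x = ∑ a, ∑ b, x a * x b * B a b := by
  simp only [dotProduct, Matrix.mulVec, Finset.mul_sum]
  exact Finset.sum_congr rfl fun a _ ↦ Finset.sum_congr rfl fun b _ ↦ by ring

lemma charFun_multivariateGaussian_zero {Vs : Matrix (Fin p) (Fin p) ℝ} (hVs : Vs.PosSemidef)
    (t : EuclideanSpace ℝ (Fin p)) : charFun (multivariateGaussian 0 Vs) t =
      Complex.exp (-((∑ a, ∑ b, t a * t b * Vs a b) / 2) : ℝ) := by
  rw [charFun_multivariateGaussian hVs, dotProduct_mulVec_eq_sum]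
  simp

/-- A quadratic form in a Gaussian vector is distributed as a weighted sum of independent `χ²₁`
variables, the weights being the eigenvalues of the product of the covariance matrix and of the
matrix of the form; here the latter is the inverse of a positive definite matrix `G`. -/
lemma exists_eigenvalues_integral_eq {G Vs : Matrix (Fin p) (Fin p) ℝ} (hG : G.PosDef)
    (hVs : Vs.PosDef) : ∃ c : Fin p → ℝ,
      (G⁻¹ * Vs * G⁻¹.transpose * G).charpoly = ∏ i, (Polynomial.X - Polynomial.C (c i)) ∧
      ∀ g : ℝ →ᵇ ℝ, ∫ x, g (inner ℝ x (Matrix.toEuclideanCLM (𝕜 := ℝ) G⁻¹ x))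
          ∂(multivariateGaussian 0 Vs) =
        ∫ z, g (∑ i, c i * z i ^ 2) ∂(Measure.pi fun _ : Fin p ↦ gaussianReal 0 1) := by
  set R := CFC.sqrt Vs with hR
  have hRR : R * R = Vs := CFC.sqrt_mul_sqrt_self _ hVs.posSemidef.nonneg
  have hRt : R.transpose = R := by
    have := (Matrix.nonneg_iff_posSemidef.1 (CFC.sqrt_nonneg Vs)).isHermitian
    simpa [Matrix.IsHermitian] using this
  have hGt : G.transpose = G := by simpa [Matrix.IsHermitian] using hG.isHermitian
  have hJt : G⁻¹.transpose = G⁻¹ := by rw [Matrix.transpose_nonsing_inv, hGt]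
  have hB : (R * (G⁻¹ * R)).IsHermitian := by
    rw [Matrix.IsHermitian, Matrix.conjTranspose_eq_transpose_of_trivial, Matrix.transpose_mul,
      Matrix.transpose_mul, hRt, hJt, mul_assoc]
  refine ⟨hB.eigenvalues, ?_, fun g ↦ ?_⟩
  · rw [hJt, mul_assoc, Matrix.nonsing_inv_mul _ hG.det_pos.ne'.isUnit, mul_one, ← hRR,
      ← mul_assoc, Matrix.charpoly_mul_comm, hB.charpoly_eq]
    rfl
  · have hquad : ∀ x : EuclideanSpace ℝ (Fin p),
        inner ℝ (Matrix.toEuclideanCLM (𝕜 := ℝ) R x) (Matrix.toEuclideanCLM (𝕜 := ℝ) G⁻¹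
          (Matrix.toEuclideanCLM (𝕜 := ℝ) R x)) =
        inner ℝ x (Matrix.toEuclideanCLM (𝕜 := ℝ) (R * (G⁻¹ * R)) x) := fun x ↦ by
      simp only [Matrix.inner_toEuclideanCLM, Matrix.ofLp_toEuclideanCLM, ← Matrix.mulVec_mulVec]
      conv_rhs => rw [Matrix.dotProduct_mulVec, ← Matrix.mulVec_transpose, hRt]
    have heig : ∀ z : Fin p → ℝ, inner ℝ (∑ i, z i • hB.eigenvectorBasis i)
        (Matrix.toEuclideanCLM (𝕜 := ℝ) (R * (G⁻¹ * R)) (∑ i, z i • hB.eigenvectorBasis i)) =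
        ∑ i, hB.eigenvalues i * z i ^ 2 := fun z ↦ by
      have h1 : ∀ i, Matrix.toEuclideanCLM (𝕜 := ℝ) (R * (G⁻¹ * R)) (hB.eigenvectorBasis i) =
          hB.eigenvalues i • hB.eigenvectorBasis i := fun i ↦ by
        apply (WithLp.ofLp_injective 2)
        rw [Matrix.ofLp_toEuclideanCLM, hB.mulVec_eigenvectorBasis]
        rfl
      simp only [map_sum, map_smul, h1, smul_smul]
      rw [hB.eigenvectorBasis.orthonormal.inner_sum]
      exact Finset.sum_congr rfl fun i _ ↦ by simp only [conj_trivial]; ring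
    rw [multivariateGaussian, integral_map (by fun_prop)
      (Continuous.aestronglyMeasurable (by fun_prop))]
    simp only [zero_add, ← hR, hquad]
    rw [stdGaussian_eq_map_pi_orthonormalBasis hB.eigenvectorBasis, integral_map
      (Measurable.aemeasurable (by fun_prop)) (Continuous.aestronglyMeasurable (by fun_prop))]
    simp only [heig]

end GaussianQuadraticForms

/-! ### Asymptotics of the weighted score -/

section SampleScore

variable {p : ℕ} {𝒴 Ω : Type*} [MeasurableSpace 𝒴] [MeasurableSpace Ω]
  {μ : Measure 𝒴} {f : EuclideanSpace ℝ (Fin p) → 𝒴 → ℝ}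
  {Θ 𝓑 : Set (EuclideanSpace ℝ (Fin p))} {θ₀ : EuclideanSpace ℝ (Fin p)} {D : 𝒴 → ℝ}
  {P : Measure Ω} [IsProbabilityMeasure P]
  {N : ℕ → ℕ} {n₀ : ℕ → ℝ} {Y : (ν : ℕ) → Ω → Fin (N ν) → 𝒴} {π : (ν : ℕ) → Ω → Fin (N ν) → ℝ}
  {A : (ν : ℕ) → Ω → Finset (Fin (N ν))}

lemma inner_wScore {N : ℕ} (v : Fin N → ℝ) (A : Finset (Fin N)) (y : Fin N → 𝒴)
    (θ t : EuclideanSpace ℝ (Fin p)) :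
    inner ℝ (wScore f v A y θ) t = (N : ℝ)⁻¹ * ∑ i ∈ A, v i * inner ℝ (score f θ (y i)) t := by
  simp only [wScore, inner_smul_left, sum_inner, conj_trivial]

namespace IsRegularModel

lemma measurable_inner_score (M : IsRegularModel μ f Θ 𝓑 θ₀ D) (t : EuclideanSpace ℝ (Fin p)) :
    Measurable fun y ↦ inner ℝ (score f θ₀ y) t :=
  (M.measurable_score M.mem_param).inner measurable_const

lemma memLp_inner_score (M : IsRegularModel μ f Θ 𝓑 θ₀ D) {q : ℝ≥0∞} (hq : q ≤ 6)
    (t : EuclideanSpace ℝ (Fin p)) :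
    MemLp (fun y ↦ inner ℝ (score f θ₀ y) t) q (modelLaw μ f θ₀) := by
  have := M.isProbabilityMeasure
  refine (M.memLp_score.mono_exponent hq).of_le_mul (c := ‖t‖)
    (M.measurable_inner_score t).aestronglyMeasurable (Eventually.of_forall fun y ↦ ?_)
  rw [mul_comm]
  exact norm_inner_le_norm _ _

lemma integral_inner_score (M : IsRegularModel μ f Θ 𝓑 θ₀ D) (t : EuclideanSpace ℝ (Fin p)) :
    ∫ y, inner ℝ (score f θ₀ y) t ∂(modelLaw μ f θ₀) = 0 := by
  simp_rw [real_inner_comm t]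
  rw [integral_inner M.integrable_score, M.integral_score, inner_zero_right]

end IsRegularModel

namespace IsSamplingScheme

lemma measurable_wScore (S : IsSamplingScheme (modelLaw μ f θ₀) P N n₀ Y π A)
    (M : IsRegularModel μ f Θ 𝓑 θ₀ D) (ν : ℕ) :
    Measurable fun ω ↦ wScore f (designWeight (π ν ω)) (A ν ω) (Y ν ω) θ₀ := by
  refine measurable_sample (fun s ↦ (S.sample ν s).1)
    (F := fun ω s ↦ wScore f (designWeight (π ν ω)) s (Y ν ω) θ₀) fun s ↦ ?_
  refine Measurable.const_smul (g := fun ω ↦ ∑ i ∈ s, designWeight (π ν ω) i •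
    score f θ₀ (Y ν ω i)) (Finset.measurable_sum _ fun i _ ↦ ?_) (N ν : ℝ)⁻¹
  exact ((measurable_pi_apply i).comp (S.measurable_π ν)).inv.smul
    ((M.measurable_score M.mem_param).comp ((measurable_pi_apply i).comp (S.measurable_Y ν)))

lemma eventually_memLp_inner (S : IsSamplingScheme (modelLaw μ f θ₀) P N n₀ Y π A)
    (M : IsRegularModel μ f Θ 𝓑 θ₀ D) (t : EuclideanSpace ℝ (Fin p)) : ∀ᶠ ν in atTop,
      MemLp (fun ω ↦ inner ℝ (wScore f (designWeight (π ν ω)) (A ν ω) (Y ν ω) θ₀) t) 2 P := by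
  have := M.isProbabilityMeasure
  filter_upwards [S.memLp_weighted (M.measurable_inner_score t)
    (M.memLp_inner_score (by norm_num) t)] with ν h
  have h1 : MemLp (fun ω ↦ (N ν : ℝ)⁻¹ * ∑ i, ‖(π ν ω i)⁻¹ * inner ℝ (score f θ₀ (Y ν ω i)) t‖)
      2 P := (memLp_finsetSum _ fun i _ ↦ (h i).norm).const_mul _
  refine h1.mono ((S.measurable_wScore M ν).inner measurable_const).aestronglyMeasurable
    (Eventually.of_forall fun ω ↦ ?_)
  rw [inner_wScore, norm_mul, norm_mul]
  refine mul_le_mul_of_nonneg_left ?_ (norm_nonneg _)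
  refine (norm_sum_le _ _).trans ((Finset.sum_le_sum_of_subset_of_nonneg (Finset.subset_univ _)
    fun i _ _ ↦ norm_nonneg _).trans (le_abs_self _))

lemma eventually_integral_inner (S : IsSamplingScheme (modelLaw μ f θ₀) P N n₀ Y π A)
    (M : IsRegularModel μ f Θ 𝓑 θ₀ D) (t : EuclideanSpace ℝ (Fin p)) : ∀ᶠ ν in atTop,
      ∫ ω, inner ℝ (wScore f (designWeight (π ν ω)) (A ν ω) (Y ν ω) θ₀) t ∂P = 0 := by
  have := M.isProbabilityMeasure
  filter_upwards [S.integral_weighted (M.measurable_inner_score t)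
    (M.memLp_inner_score (by norm_num) t)] with ν h
  rw [M.integral_inner_score] at h
  simp_rw [inner_wScore]
  exact h

/-- The weighted score has mean zero, so its covariance matrix gives second moments. -/
lemma eventually_covMat (S : IsSamplingScheme (modelLaw μ f θ₀) P N n₀ Y π A)
    (M : IsRegularModel μ f Θ 𝓑 θ₀ D) : ∀ᶠ ν in atTop, ∀ t : EuclideanSpace ℝ (Fin p),
      ∑ a, ∑ b, t a * t b *
        covMat P (fun ω ↦ wScore f (designWeight (π ν ω)) (A ν ω) (Y ν ω) θ₀) a b =
      ∫ ω, inner ℝ (wScore f (designWeight (π ν ω)) (A ν ω) (Y ν ω) θ₀) t ^ 2 ∂P := by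
  have h1 := eventually_all.2 fun a : Fin p ↦
    S.eventually_memLp_inner M (EuclideanSpace.single a 1)
  have h2 := eventually_all.2 fun a : Fin p ↦
    S.eventually_integral_inner M (EuclideanSpace.single a 1)
  filter_upwards [h1, h2] with ν h1 h2 t
  set s : Ω → EuclideanSpace ℝ (Fin p) := fun ω ↦
    wScore f (designWeight (π ν ω)) (A ν ω) (Y ν ω) θ₀
  have e : ∀ a (x : EuclideanSpace ℝ (Fin p)), inner ℝ x (EuclideanSpace.single a (1 : ℝ)) = x a :=
    fun a x ↦ by simp [EuclideanSpace.inner_single_right]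
  simp only [e] at h1 h2
  have hcov : ∀ a b, covMat P s a b = ∫ ω, s ω a * s ω b ∂P := fun a b ↦ by
    simp only [covMat, Matrix.of_apply, covariance]
    have ha : ∫ ω, s ω a ∂P = 0 := h2 a
    have hb : ∫ ω, s ω b ∂P = 0 := h2 b
    rw [ha, hb]
    simp
  have hint : ∀ a b, Integrable (fun ω ↦ t a * t b * (s ω a * s ω b)) P := fun a b ↦
    ((h1 a).integrable_mul (h1 b)).const_mul _
  have e2 : ∀ ω, inner ℝ (s ω) t ^ 2 = ∑ a, ∑ b, t a * t b * (s ω a * s ω b) := fun ω ↦ by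
    rw [PiLp.inner_apply, sq, Finset.sum_mul_sum]
    refine Finset.sum_congr rfl fun a _ ↦ Finset.sum_congr rfl fun b _ ↦ ?_
    simp only [RCLike.inner_apply, conj_trivial]
    ring
  change _ = ∫ ω, inner ℝ (s ω) t ^ 2 ∂P
  simp_rw [e2]
  rw [integral_finsetSum _ fun a _ ↦ integrable_finsetSum _ fun b _ ↦ hint a b]
  refine Finset.sum_congr rfl fun a _ ↦ ?_
  rw [integral_finsetSum _ fun b _ ↦ hint a b]
  refine Finset.sum_congr rfl fun b _ ↦ ?_
  rw [integral_const_mul, hcov]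

lemma eventually_covMat_posSemidef (S : IsSamplingScheme (modelLaw μ f θ₀) P N n₀ Y π A)
    (M : IsRegularModel μ f Θ 𝓑 θ₀ D) : ∀ᶠ ν in atTop,
      (covMat P fun ω ↦ wScore f (designWeight (π ν ω)) (A ν ω) (Y ν ω) θ₀).PosSemidef := by
  filter_upwards [S.eventually_covMat M] with ν h
  refine Matrix.PosSemidef.of_dotProduct_mulVec_nonneg ?_ fun x ↦ ?_
  · ext a b
    simp only [Matrix.conjTranspose_apply, star_trivial, covMat, Matrix.of_apply]
    exact covariance_comm _ _
  · rw [star_trivial, dotProduct_mulVec_eq_sum]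
    refine le_of_le_of_eq ?_ (h (WithLp.toLp 2 x)).symm
    exact integral_nonneg fun ω ↦ sq_nonneg _

/-- The law of large numbers for the design weights. -/
lemma hasWeightedLLN (S : IsSamplingScheme (modelLaw μ f θ₀) P N n₀ Y π A)
    (M : IsRegularModel μ f Θ 𝓑 θ₀ D) :
    HasWeightedLLN (modelLaw μ f θ₀) (inProb P) (fun x ↦ N x.1)
      (fun x ↦ designWeight (π x.1 x.2)) (fun x ↦ A x.1 x.2) (fun x ↦ Y x.1 x.2) := by
  have := M.isProbabilityMeasure
  refine ⟨?_, fun g hg ↦ S.tendsto_weighted hg⟩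
  filter_upwards [S.eventually_prob] with x hx i
  exact (inv_pos.2 (hx i).1).le

/-- The law of large numbers for the bootstrap weights. -/
lemma hasWeightedLLN_bootstrap (S : IsSamplingScheme (modelLaw μ f θ₀) P N n₀ Y π A)
    (M : IsRegularModel μ f Θ 𝓑 θ₀ D) :
    HasWeightedLLN (modelLaw μ f θ₀)
      (probFilter (inProb P) fun z ↦ bootLaw (π z.1 z.2) (A z.1 z.2)) (fun x ↦ N x.1.1)
      (fun x ↦ bootWeight (π x.1.1 x.1.2) x.2) (fun x ↦ A x.1.1 x.1.2)
      (fun x ↦ Y x.1.1 x.1.2) := by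
  have := M.isProbabilityMeasure
  refine ⟨?_, fun g hg ↦ S.tendsto_bootstrap hg⟩
  filter_upwards [tendsto_fst_probFilter.eventually S.eventually_prob] with x hx i
  exact mul_nonneg (inv_pos.2 (hx i).1).le (Nat.cast_nonneg _)

variable {Vs : Matrix (Fin p) (Fin p) ℝ}

/-- The sample analogues of the asymptotic covariances are consistent. -/
lemma tendsto_sample_covariance (S : IsSamplingScheme (modelLaw μ f θ₀) P N n₀ Y π A)
    (M : IsRegularModel μ f Θ 𝓑 θ₀ D) (hVs : Vs.PosDef)
    (hlim : Tendsto (fun ν ↦ n₀ ν • covMat P fun ω ↦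
      wScore f (designWeight (π ν ω)) (A ν ω) (Y ν ω) θ₀) atTop (𝓝 Vs))
    (hclt : ∀ h : EuclideanSpace ℝ (Fin p) →ᵇ ℝ, Tendsto (fun ν ↦ ∫ ω, h (√(n₀ ν) •
      wScore f (designWeight (π ν ω)) (A ν ω) (Y ν ω) θ₀) ∂P) atTop
        (𝓝 (∫ x, h x ∂(multivariateGaussian 0 Vs)))) (a b : Fin p) :
    Tendsto (fun x : Σ _ : ℕ, Ω ↦ n₀ x.1 * ((N x.1 : ℝ)⁻¹ ^ 2 * ∑ i ∈ A x.1 x.2,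
      designWeight (π x.1 x.2) i ^ 2 *
        (score f θ₀ (Y x.1 x.2 i) a * score f θ₀ (Y x.1 x.2 i) b))) (inProb P) (𝓝 (Vs a b)) := by
  have := M.isProbabilityMeasure
  let Q : EuclideanSpace ℝ (Fin p) → ℝ := fun t ↦ ∑ a, ∑ b, t a * t b * Vs a b
  have hQ : ∀ t : EuclideanSpace ℝ (Fin p), Tendsto (fun x : Σ _ : ℕ, Ω ↦ n₀ x.1 *
      ((N x.1 : ℝ)⁻¹ ^ 2 * ∑ i ∈ A x.1 x.2, designWeight (π x.1 x.2) i ^ 2 *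
        inner ℝ (score f θ₀ (Y x.1 x.2 i)) t ^ 2)) (inProb P) (𝓝 (Q t)) := by
    intro t
    refine S.tendsto_sample_condVar (M.measurable_inner_score t)
      (M.memLp_inner_score (by norm_num) t) ?_
    refine S.tendsto_condVar (M.measurable_inner_score t)
      (M.memLp_inner_score (by norm_num) t) (M.integral_inner_score t) ?_ ?_
    · have h1 : Tendsto (fun ν ↦ ∑ a, ∑ b, t a * t b * (n₀ ν • covMat P fun ω ↦
          wScore f (designWeight (π ν ω)) (A ν ω) (Y ν ω) θ₀) a b) atTop (𝓝 (Q t)) :=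
        tendsto_finsetSum _ fun a _ ↦ tendsto_finsetSum _ fun b _ ↦
          (tendsto_pi_nhds.1 (tendsto_pi_nhds.1 hlim a) b).const_mul _
      refine h1.congr' ?_
      filter_upwards [S.eventually_covMat M] with ν h2
      have h3 := h2 t
      simp_rw [inner_wScore] at h3
      refine Eq.trans ?_ (congrArg (n₀ ν * ·) h3)
      simp only [Finset.mul_sum, Matrix.smul_apply, smul_eq_mul]
      exact Finset.sum_congr rfl fun a _ ↦ Finset.sum_congr rfl fun b _ ↦ by ring
    · have hmeas : ∀ ν, Measurable fun ω ↦ √(n₀ ν) •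
          wScore f (designWeight (π ν ω)) (A ν ω) (Y ν ω) θ₀ := fun ν ↦
        (S.measurable_wScore M ν).const_smul √(n₀ ν)
      let ms : ℕ → ProbabilityMeasure (EuclideanSpace ℝ (Fin p)) := fun ν ↦
        ⟨P.map fun ω ↦ √(n₀ ν) • wScore f (designWeight (π ν ω)) (A ν ω) (Y ν ω) θ₀,
          Measure.isProbabilityMeasure_map (hmeas ν).aemeasurable⟩
      have h1 : Tendsto ms atTop (𝓝 ⟨multivariateGaussian 0 Vs, inferInstance⟩) := by
        refine ProbabilityMeasure.tendsto_iff_forall_integral_tendsto.2 fun h ↦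
          (hclt h).congr fun ν ↦ ?_
        exact (integral_map (hmeas ν).aemeasurable
          h.continuous.measurable.aestronglyMeasurable).symm
      have h2 := ProbabilityMeasure.tendsto_iff_tendsto_charFun.1 h1 t
      have h3 : charFun (multivariateGaussian 0 Vs) t = ((Real.exp (-(Q t / 2)) : ℝ) : ℂ) := by
        rw [charFun_multivariateGaussian_zero hVs.posSemidef, Complex.ofReal_exp]
      simp only [ProbabilityMeasure.coe_mk] at h2
      rw [h3] at h2
      refine h2.congr fun ν ↦ ?_
      change charFun (P.map _) t = _
      rw [charFun_apply, integral_map (hmeas ν).aemeasurable (by fun_prop)]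
      refine integral_congr_ae (Eventually.of_forall fun ω ↦ ?_)
      simp only [inner_smul_left, inner_wScore, conj_trivial]
      rfl
  -- polarization
  have hsym : Vs b a = Vs a b := by simpa using hVs.isHermitian.apply a b
  have hQab : ((Q (EuclideanSpace.single a 1 + EuclideanSpace.single b 1) -
      Q (EuclideanSpace.single a 1)) - Q (EuclideanSpace.single b 1)) / 2 = Vs a b := by
    simp only [Q, PiLp.add_apply, add_mul, mul_add, Finset.sum_add_distrib]
    simp [hsym]
    ring
  rw [← hQab]
  refine ((((hQ _).sub (hQ _)).sub (hQ _)).div_const 2).congr fun x ↦ ?_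
  simp only [Finset.mul_sum, ← Finset.sum_sub_distrib, Finset.sum_div]
  refine Finset.sum_congr rfl fun i _ ↦ ?_
  simp [inner_add_right, EuclideanSpace.inner_single_right]
  ring

end IsSamplingScheme

end SampleScore

/-! ### The likelihood ratio statistics -/

section LikelihoodRatio

variable {p : ℕ} {𝒴 Ω : Type*} [MeasurableSpace 𝒴] [MeasurableSpace Ω]
  {μ : Measure 𝒴} {f : EuclideanSpace ℝ (Fin p) → 𝒴 → ℝ}
  {Θ 𝓑 : Set (EuclideanSpace ℝ (Fin p))} {θ₀ : EuclideanSpace ℝ (Fin p)} {D : 𝒴 → ℝ}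
  {P : Measure Ω} [IsProbabilityMeasure P]
  {N : ℕ → ℕ} {n₀ : ℕ → ℝ} {Y : (ν : ℕ) → Ω → Fin (N ν) → 𝒴} {π : (ν : ℕ) → Ω → Fin (N ν) → ℝ}
  {A : (ν : ℕ) → Ω → Finset (Fin (N ν))} {Vs : Matrix (Fin p) (Fin p) ℝ}
  {θhat : ℕ → Ω → EuclideanSpace ℝ (Fin p)}
  {θstar : (ν : ℕ) → Ω → (Fin (N ν) → ℕ) → EuclideanSpace ℝ (Fin p)}

/-- The bootstrap log-likelihood at its maximizer and at a point `h` close to the maximizer `J s`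
of another quadratic. The difference is governed by the quadratic form of the difference of the
two scores, the terms linear in `s` cancelling. -/
lemma abs_sub_sub_le_of_quadratic {E : Type*} [NormedAddCommGroup E] [InnerProductSpace ℝ E]
    {G J : E →L[ℝ] E} (hGJ : ∀ x, G (J x) = x)
    (hG : ∀ x y, inner ℝ x (G y) = inner ℝ y (G x)) {s s' h : E} {l₀ l l' η : ℝ}
    (hη : 0 ≤ η) (hη1 : η ≤ 1)
    (h1 : |l - l₀ - (inner ℝ s' h - inner ℝ h (G h) / 2)| ≤ η * ‖h‖ ^ 2)
    (h2 : ‖h - J s‖ ≤ η * ‖s‖) (h3 : |l' - l₀ - inner ℝ s' (J s') / 2| ≤ η * ‖s'‖ ^ 2) :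
    |l' - l - inner ℝ (s' - s) (J (s' - s)) / 2| ≤
      η * (3 + ‖G‖ + (‖J‖ + 1) ^ 2) * (‖s‖ ^ 2 + ‖s' - s‖ ^ 2) := by
  have hJ : ∀ x y, inner ℝ x (J y) = inner ℝ y (J x) := fun x y ↦ by
    conv_lhs => rw [← hGJ x]
    rw [real_inner_comm, hG, hGJ, real_inner_comm, real_inner_comm]
  obtain ⟨u, hu⟩ : ∃ u, h = J s + u := ⟨h - J s, by abel⟩
  obtain ⟨d, hd⟩ : ∃ d, s' = s + d := ⟨s' - s, by abel⟩
  have hun : ‖u‖ ≤ η * ‖s‖ := by rwa [hu, add_sub_cancel_left] at h2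
  have hdn : s' - s = d := by rw [hd, add_sub_cancel_left]
  have hus : ‖u‖ ≤ ‖s‖ := hun.trans (mul_le_of_le_one_left (norm_nonneg _) hη1)
  have e : inner ℝ s' (J s') / 2 - (inner ℝ s' h - inner ℝ h (G h) / 2) =
      inner ℝ d (J d) / 2 - inner ℝ d u + inner ℝ u (G u) / 2 := by
    have e1 : inner ℝ (J s) (G u) = inner ℝ s u := by rw [hG, hGJ, real_inner_comm]
    have e2 : inner ℝ (J s) (G (J s)) = inner ℝ s (J s) := by rw [hGJ, real_inner_comm]
    have e3 : inner ℝ u (G (J s)) = inner ℝ s u := by rw [hGJ, real_inner_comm]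
    rw [hu, hd]
    simp only [map_add, inner_add_left, inner_add_right, e1, e2, e3, hJ d s]
    ring
  have b1 : |inner ℝ d u| ≤ η * (‖s‖ ^ 2 + ‖d‖ ^ 2) := by
    refine (abs_real_inner_le_norm _ _).trans ?_
    have := mul_le_mul_of_nonneg_left hun (norm_nonneg d)
    nlinarith [mul_nonneg hη (sq_nonneg (‖s‖ - ‖d‖)), mul_nonneg hη (sq_nonneg ‖s‖),
      mul_nonneg hη (sq_nonneg ‖d‖)]
  have b2 : |inner ℝ u (G u)| ≤ η * ‖G‖ * ‖s‖ ^ 2 := by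
    refine (abs_real_inner_le_norm _ _).trans ?_
    calc ‖u‖ * ‖G u‖ ≤ (η * ‖s‖) * (‖G‖ * ‖s‖) := by
          gcongr
          exact (G.le_opNorm u).trans (by gcongr)
      _ = _ := by ring
  have b3 : ‖h‖ ^ 2 ≤ (‖J‖ + 1) ^ 2 * ‖s‖ ^ 2 := by
    rw [← mul_pow]
    refine pow_le_pow_left₀ (norm_nonneg _) ?_ 2
    rw [hu]
    refine (norm_add_le _ _).trans ?_
    have := J.le_opNorm s
    linarith
  have b4 : ‖s'‖ ^ 2 ≤ 2 * (‖s‖ ^ 2 + ‖d‖ ^ 2) := by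
    rw [hd]
    have := norm_add_le s d
    nlinarith [sq_nonneg (‖s‖ - ‖d‖), norm_nonneg (s + d)]
  have b3' := mul_le_mul_of_nonneg_left b3 hη
  have b4' := mul_le_mul_of_nonneg_left b4 hη
  have hGd : 0 ≤ η * ‖G‖ * ‖d‖ ^ 2 := by positivity
  have hGs : 0 ≤ η * ‖G‖ * ‖s‖ ^ 2 := by positivity
  have hJd : 0 ≤ η * (‖J‖ + 1) ^ 2 * ‖d‖ ^ 2 := by positivity
  rw [hdn]
  rw [abs_le] at h1 h3 b1 b2 ⊢
  constructor <;> linarith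

/-- Passing from an expansion of the log-likelihood in terms of an unscaled score `d` to one of the
likelihood ratio statistic in terms of `√n₀ d`, when the realized sample size `n` is close to `n₀`.
The error may involve another vector `s` of bounded scaled norm. -/
lemma abs_two_mul_sub_inner_le {E : Type*} [NormedAddCommGroup E] [InnerProductSpace ℝ E]
    {J : E →L[ℝ] E} {s d : E} {n n₀ Δ η ε K : ℝ} (hn : 0 ≤ n) (hn₀ : 0 < n₀) (hη : 0 < η)
    (hε : 0 ≤ ε) (h2 : n / n₀ < 2) (h1 : dist (n / n₀) 1 < η / (2 * (‖J‖ + 1)))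
    (hΔ : |Δ - inner ℝ d (J d) / 2| ≤ ε * (‖s‖ ^ 2 + ‖d‖ ^ 2)) (hs : ‖√n₀ • s‖ ≤ K)
    (hεη : 4 * ε * (K ^ 2 + 1) ≤ η / 2) :
    |2 * n * Δ - inner ℝ (√n₀ • d) (J (√n₀ • d))| ≤ η * (1 + ‖√n₀ • d‖ ^ 2) := by
  obtain ⟨r, hr⟩ : ∃ r, r = n / n₀ := ⟨_, rfl⟩
  obtain ⟨c, hc⟩ : ∃ c, c = ‖J‖ + 1 := ⟨_, rfl⟩
  have hc0 : 0 < c := by rw [hc]; positivity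
  have hcard : n = r * n₀ := by rw [hr, div_mul_cancel₀ _ hn₀.ne']
  have hr0 : 0 ≤ r := by rw [hr]; positivity
  rw [← hr] at h1 h2
  rw [Real.dist_eq, ← hc] at h1
  have hnorm : ∀ e : E, ‖√n₀ • e‖ ^ 2 = n₀ * ‖e‖ ^ 2 := fun e ↦ by
    rw [norm_smul, mul_pow, Real.norm_eq_abs, sq_abs, Real.sq_sqrt hn₀.le]
  have hq : inner ℝ (√n₀ • d) (J (√n₀ • d)) = n₀ * inner ℝ d (J d) := by
    rw [map_smul, inner_smul_left, inner_smul_right, conj_trivial, ← mul_assoc,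
      Real.mul_self_sqrt hn₀.le]
  have hdJ : |inner ℝ d (J d)| ≤ c * ‖d‖ ^ 2 := by
    refine (abs_real_inner_le_norm _ _).trans ?_
    have h3 := mul_le_mul_of_nonneg_left (J.le_opNorm d) (norm_nonneg d)
    have h4 := sq_nonneg ‖d‖
    rw [hc]
    linarith
  have hsK : n₀ * ‖s‖ ^ 2 ≤ K ^ 2 := by
    rw [← hnorm]
    exact pow_le_pow_left₀ (norm_nonneg _) hs 2
  have hnd : 0 ≤ n₀ * ‖d‖ ^ 2 := by positivity
  have e : 2 * n * Δ - n₀ * inner ℝ d (J d) =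
      2 * r * (n₀ * (Δ - inner ℝ d (J d) / 2)) + (r - 1) * (n₀ * inner ℝ d (J d)) := by
    rw [hcard]
    ring
  have b1 : |2 * r * (n₀ * (Δ - inner ℝ d (J d) / 2))| ≤ η / 2 * (1 + n₀ * ‖d‖ ^ 2) := by
    rw [abs_mul, abs_of_nonneg (by positivity : 0 ≤ 2 * r), abs_mul, abs_of_pos hn₀]
    calc _ ≤ 2 * 2 * (n₀ * (ε * (‖s‖ ^ 2 + ‖d‖ ^ 2))) := by gcongr
      _ = 4 * ε * (n₀ * ‖s‖ ^ 2 + n₀ * ‖d‖ ^ 2) := by ring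
      _ ≤ 4 * ε * ((K ^ 2 + 1) * (1 + n₀ * ‖d‖ ^ 2)) := by
        gcongr
        nlinarith [mul_nonneg (sq_nonneg K) hnd]
      _ = 4 * ε * (K ^ 2 + 1) * (1 + n₀ * ‖d‖ ^ 2) := by ring
      _ ≤ _ := mul_le_mul_of_nonneg_right hεη (by positivity)
  have b2 : |(r - 1) * (n₀ * inner ℝ d (J d))| ≤ η / 2 * (n₀ * ‖d‖ ^ 2) := by
    rw [abs_mul, abs_mul, abs_of_pos hn₀]
    calc _ ≤ η / (2 * c) * (n₀ * (c * ‖d‖ ^ 2)) :=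
          mul_le_mul h1.le (mul_le_mul_of_nonneg_left hdJ hn₀.le) (by positivity) (by positivity)
      _ = _ := by field_simp
  rw [hq, hnorm, e]
  refine (abs_add_le _ _).trans ((add_le_add b1 b2).trans ?_)
  linarith

lemma measurable_lrStat (S : IsSamplingScheme (modelLaw μ f θ₀) P N n₀ Y π A)
    (M : IsRegularModel μ f Θ 𝓑 θ₀ D) (hθm : ∀ ν, Measurable (θhat ν)) (ν : ℕ) :
    Measurable fun ω ↦ lrStat f (designWeight (π ν ω)) (A ν ω) (Y ν ω) θ₀ (θhat ν ω) := by
  refine measurable_sample (fun s ↦ (S.sample ν s).1)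
    (F := fun ω s ↦ lrStat f (designWeight (π ν ω)) s (Y ν ω) θ₀ (θhat ν ω)) fun s ↦ ?_
  have hl : ∀ θ : Ω → EuclideanSpace ℝ (Fin p), Measurable θ →
      Measurable fun ω ↦ logLik f (designWeight (π ν ω)) s (Y ν ω) (θ ω) := fun θ hθ ↦ by
    refine Measurable.const_mul (Finset.measurable_sum _ fun i _ ↦ ?_) _
    exact ((measurable_pi_apply i).comp (S.measurable_π ν)).inv.mul (Real.measurable_log.comp
      (M.meas.comp (hθ.prodMk ((measurable_pi_apply i).comp (S.measurable_Y ν)))))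
  exact ((hl _ measurable_const).sub (hl _ (hθm ν))).const_mul _

namespace IsRegularModel

lemma expInfo_mul_inv_apply (M : IsRegularModel μ f Θ 𝓑 θ₀ D) (x : EuclideanSpace ℝ (Fin p)) :
    Matrix.toEuclideanCLM (𝕜 := ℝ) (expInfo μ f θ₀ θ₀)
      (Matrix.toEuclideanCLM (𝕜 := ℝ) (expInfo μ f θ₀ θ₀)⁻¹ x) = x := by
  rw [← mul_apply_eq_comp, ← map_mul, Matrix.mul_nonsing_inv _ M.isUnit_det, map_one]
  rfl

lemma inner_expInfo_comm (M : IsRegularModel μ f Θ 𝓑 θ₀ D) (x x' : EuclideanSpace ℝ (Fin p)) :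
    inner ℝ x (Matrix.toEuclideanCLM (𝕜 := ℝ) (expInfo μ f θ₀ θ₀) x') =
      inner ℝ x' (Matrix.toEuclideanCLM (𝕜 := ℝ) (expInfo μ f θ₀ θ₀) x) := by
  have hsym : (expInfo μ f θ₀ θ₀).transpose = expInfo μ f θ₀ θ₀ := by
    simpa [Matrix.IsHermitian] using M.expInfo_posDef.isHermitian
  rw [Matrix.inner_toEuclideanCLM, Matrix.inner_toEuclideanCLM, Matrix.dotProduct_mulVec,
    ← Matrix.mulVec_transpose, hsym, dotProduct_comm]

end IsRegularModel

/-- The survey-weighted Wilks theorem, with the limit as a quadratic form in a Gaussian vector. -/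
lemma tendsto_integral_lrStat (S : IsSamplingScheme (modelLaw μ f θ₀) P N n₀ Y π A)
    (M : IsRegularModel μ f Θ 𝓑 θ₀ D)
    (hclt : ∀ h : EuclideanSpace ℝ (Fin p) →ᵇ ℝ, Tendsto (fun ν ↦ ∫ ω, h (√(n₀ ν) •
      wScore f (designWeight (π ν ω)) (A ν ω) (Y ν ω) θ₀) ∂P) atTop
        (𝓝 (∫ x, h x ∂(multivariateGaussian 0 Vs))))
    (hθm : ∀ ν, Measurable (θhat ν))
    (hθ : ∀ᶠ x in inProb P, θhat x.1 x.2 ∈ 𝓑 ∧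
      IsMaxOn (logLik f (designWeight (π x.1 x.2)) (A x.1 x.2) (Y x.1 x.2)) Θ (θhat x.1 x.2))
    (g : ℝ →ᵇ ℝ) :
    Tendsto (fun ν ↦ ∫ ω, g (lrStat f (designWeight (π ν ω)) (A ν ω) (Y ν ω) θ₀ (θhat ν ω)) ∂P)
      atTop (𝓝 (∫ x, g (inner ℝ x (Matrix.toEuclideanCLM (𝕜 := ℝ) (expInfo μ f θ₀ θ₀)⁻¹ x))
        ∂(multivariateGaussian 0 Vs))) := by
  have := M.isProbabilityMeasure
  set J := Matrix.toEuclideanCLM (𝕜 := ℝ) (expInfo μ f θ₀ θ₀)⁻¹ with hJ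
  refine tendsto_integral_of_slutsky (𝓕 := atTop) (κ := fun _ : ℕ ↦ P)
    (R := fun x : Σ _ : ℕ, Ω ↦ √(n₀ x.1) •
      wScore f (designWeight (π x.1 x.2)) (A x.1 x.2) (Y x.1 x.2) θ₀)
    (W := fun x : Σ _ : ℕ, Ω ↦ lrStat f (designWeight (π x.1 x.2)) (A x.1 x.2) (Y x.1 x.2) θ₀
      (θhat x.1 x.2)) (q := fun x ↦ inner ℝ x (J x)) (by fun_prop)
    (Eventually.of_forall fun _ ↦ inferInstance)
    (Eventually.of_forall fun ν ↦ ((S.measurable_wScore M ν).const_smul √(n₀ ν)).aemeasurable)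
    (Eventually.of_forall fun ν ↦ (measurable_lrStat S M hθm ν).aemeasurable) hclt
    (fun η hη ↦ ?_) g
  have hρ := S.tendsto_card_div
  filter_upwards [hθ, (S.hasWeightedLLN M).eventually_isMaxOn M (η := η / 8) (by positivity),
    S.tendsto_n₀_inProb.eventually_gt_atTop 0, (tendsto_order.1 hρ).2 2 one_lt_two,
    Metric.tendsto_nhds.1 hρ (η / (2 * (‖J‖ + 1))) (by positivity)] with x h1 h2 h3 h4 h5
  obtain ⟨-, h6⟩ := h2 _ h1.1 h1.2
  rw [← hJ] at h6
  set s := wScore f (designWeight (π x.1 x.2)) (A x.1 x.2) (Y x.1 x.2) θ₀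
  have key := abs_two_mul_sub_inner_le (J := J) (s := 0) (d := s) (K := 0) (ε := η / 8)
    (Nat.cast_nonneg _) h3 hη (by positivity) h4 h5 (by simpa using h6) (by simp) (by linarith)
  rw [Real.dist_eq, lrStat]
  refine le_trans (le_of_eq ?_) key
  congr 1
  ring

/-- The bootstrap Wilks theorem, with the limit as a quadratic form in a Gaussian vector. The
bootstrap score, recentred at the weighted score, satisfies the same central limit theorem as the
weighted score itself. -/
lemma tendsto_integral_bootstrap_lrStat (S : IsSamplingScheme (modelLaw μ f θ₀) P N n₀ Y π A)
    (M : IsRegularModel μ f Θ 𝓑 θ₀ D) (hVs : Vs.PosDef)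
    (hlim : Tendsto (fun ν ↦ n₀ ν • covMat P fun ω ↦
      wScore f (designWeight (π ν ω)) (A ν ω) (Y ν ω) θ₀) atTop (𝓝 Vs))
    (hclt : ∀ h : EuclideanSpace ℝ (Fin p) →ᵇ ℝ, Tendsto (fun ν ↦ ∫ ω, h (√(n₀ ν) •
      wScore f (designWeight (π ν ω)) (A ν ω) (Y ν ω) θ₀) ∂P) atTop
        (𝓝 (∫ x, h x ∂(multivariateGaussian 0 Vs))))
    (hθ : ∀ᶠ x in inProb P, θhat x.1 x.2 ∈ 𝓑 ∧
      IsMaxOn (logLik f (designWeight (π x.1 x.2)) (A x.1 x.2) (Y x.1 x.2)) Θ (θhat x.1 x.2))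
    (hθs : ∀ᶠ x in probFilter (inProb P) fun z ↦ bootLaw (π z.1 z.2) (A z.1 z.2),
      θstar x.1.1 x.1.2 x.2 ∈ 𝓑 ∧ IsMaxOn (logLik f (bootWeight (π x.1.1 x.1.2) x.2)
        (A x.1.1 x.1.2) (Y x.1.1 x.1.2)) Θ (θstar x.1.1 x.1.2 x.2))
    (g : ℝ →ᵇ ℝ) :
    Tendsto (fun x : Σ _ : ℕ, Ω ↦ ∫ m, g (lrStat f (bootWeight (π x.1 x.2) m) (A x.1 x.2)
        (Y x.1 x.2) (θhat x.1 x.2) (θstar x.1 x.2 m)) ∂(bootLaw (π x.1 x.2) (A x.1 x.2)))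
      (inProb P) (𝓝 (∫ x, g (inner ℝ x (Matrix.toEuclideanCLM (𝕜 := ℝ) (expInfo μ f θ₀ θ₀)⁻¹ x))
        ∂(multivariateGaussian 0 Vs))) := by
  have := M.isProbabilityMeasure
  set G := Matrix.toEuclideanCLM (𝕜 := ℝ) (expInfo μ f θ₀ θ₀) with hG
  set J := Matrix.toEuclideanCLM (𝕜 := ℝ) (expInfo μ f θ₀ θ₀)⁻¹ with hJ
  -- the weighted score is tight, so it may be taken to be bounded
  refine tendsto_probFilter_of_tight (r := fun x : Σ _ : ℕ, Ω ↦ ‖√(n₀ x.1) •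
      wScore f (designWeight (π x.1 x.2)) (A x.1 x.2) (Y x.1 x.2) θ₀‖)
    (fun ε hε ↦ exists_measure_norm_le_of_weak (κ := fun _ : ℕ ↦ P)
      (R := fun x : Σ _ : ℕ, Ω ↦ √(n₀ x.1) •
        wScore f (designWeight (π x.1 x.2)) (A x.1 x.2) (Y x.1 x.2) θ₀)
      (Eventually.of_forall fun _ ↦ inferInstance)
      (Eventually.of_forall fun ν ↦ ((S.measurable_wScore M ν).const_smul √(n₀ ν)).aemeasurable)
      hclt hε) fun K ↦ ?_
  set 𝓕 : Filter (Σ _ : ℕ, Ω) := inProb P ⊓ 𝓟 {x | ‖√(n₀ x.1) •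
    wScore f (designWeight (π x.1 x.2)) (A x.1 x.2) (Y x.1 x.2) θ₀‖ ≤ K} with h𝓕
  have hle : 𝓕 ≤ inProb P := inf_le_left
  have hK : ∀ᶠ x in 𝓕, ‖√(n₀ x.1) •
      wScore f (designWeight (π x.1 x.2)) (A x.1 x.2) (Y x.1 x.2) θ₀‖ ≤ K :=
    mem_inf_of_right (mem_principal_self _)
  obtain ⟨C, hC, hCb⟩ := S.exists_weight_bound_inProb
  have hL := S.hasWeightedLLN M
  have hLb := S.hasWeightedLLN_bootstrap M
  have hscore3 : Integrable (fun y ↦ ‖score f θ₀ y‖ ^ 3) (modelLaw μ f θ₀) :=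
    (M.memLp_score.mono_exponent (p := 3) (by norm_num)).integrable_norm_pow (by norm_num)
  refine tendsto_integral_of_slutsky (𝓕 := 𝓕)
    (κ := fun z : Σ _ : ℕ, Ω ↦ bootLaw (π z.1 z.2) (A z.1 z.2))
    (R := fun x : Σ z : (Σ _ : ℕ, Ω), (Fin (N z.1) → ℕ) ↦ bootFluct (n₀ x.1.1) (π x.1.1 x.1.2)
      (A x.1.1 x.1.2) (fun i ↦ score f θ₀ (Y x.1.1 x.1.2 i)) x.2)
    (W := fun x : Σ z : (Σ _ : ℕ, Ω), (Fin (N z.1) → ℕ) ↦ lrStat f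
      (bootWeight (π x.1.1 x.1.2) x.2) (A x.1.1 x.1.2) (Y x.1.1 x.1.2) (θhat x.1.1 x.1.2)
      (θstar x.1.1 x.1.2 x.2)) (γ := multivariateGaussian 0 Vs)
    (q := fun x ↦ inner ℝ x (J x)) (by fun_prop)
    (S.eventually_isProbabilityMeasure.filter_mono hle)
    (Eventually.of_forall fun x ↦ Measurable.of_discrete.aemeasurable)
    (Eventually.of_forall fun x ↦ Measurable.of_discrete.aemeasurable)
    (fun h ↦ ?_) (fun η hη ↦ ?_) g
  · refine tendsto_integral_bootFluct (Vs := Vs) (C := C) (K := K)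
      (T := ∫ y, ‖score f θ₀ y‖ ^ 3 ∂(modelLaw μ f θ₀)) (𝓕 := 𝓕)
      (N := fun x : Σ _ : ℕ, Ω ↦ N x.1) (n₀ := fun x ↦ n₀ x.1) (π := fun x ↦ π x.1 x.2)
      (A := fun x ↦ A x.1 x.2) (v := fun x i ↦ score f θ₀ (Y x.1 x.2 i))
      (fun t ↦ ?_) (charFun_multivariateGaussian_zero hVs.posSemidef)
      (S.tendsto_N_inProb.mono_left hle) (S.tendsto_n₀_inProb.mono_left hle)
      (S.eventually_prob.filter_mono hle) ((hCb.mono fun x hx i ↦ (hx i).2).filter_mono hle)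
      (S.eventually_nonempty.filter_mono hle) (S.tendsto_sum_weight.mono_left hle)
      ((hL.tendsto _ hscore3).mono_left hle) hK
      (fun a b ↦ (S.tendsto_sample_covariance M hVs hlim hclt a b).mono_left hle) h
    rw [← dotProduct_mulVec_eq_sum Vs t.ofLp]
    simpa using hVs.posSemidef.dotProduct_mulVec_nonneg t.ofLp
  have hfst := tendsto_fst_probFilter (𝓕 := 𝓕)
    (κ := fun z : Σ _ : ℕ, Ω ↦ bootLaw (π z.1 z.2) (A z.1 z.2))
  have hleb := probFilter_mono (κ := fun z : Σ _ : ℕ, Ω ↦ bootLaw (π z.1 z.2) (A z.1 z.2)) hle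
  set B := 3 + ‖G‖ + (‖J‖ + 1) ^ 2 with hB
  have hB0 : 0 < B := by positivity
  obtain ⟨τ, hτ, hτ1, hτη⟩ : ∃ τ : ℝ, 0 < τ ∧ τ ≤ 1 ∧ 4 * (τ * B) * (K ^ 2 + 1) ≤ η / 2 := by
    refine ⟨min 1 (η / (8 * B * (K ^ 2 + 1))), by positivity, min_le_left _ _, ?_⟩
    calc _ ≤ 4 * (η / (8 * B * (K ^ 2 + 1)) * B) * (K ^ 2 + 1) := by gcongr; exact min_le_right _ _
      _ = _ := by field_simp; norm_num
  obtain ⟨δ, hδ, hquad⟩ := hLb.eventually_quadratic M hτ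
  have hsmall : ∀ᶠ x in inProb P, (‖J‖ + 1) *
      ‖wScore f (designWeight (π x.1 x.2)) (A x.1 x.2) (Y x.1 x.2) θ₀‖ < δ := by
    have := ((hL.tendsto_wScore M).norm).const_mul (‖J‖ + 1)
    rw [norm_zero, mul_zero] at this
    exact (tendsto_order.1 this).2 δ hδ
  have hρ := S.tendsto_card_div
  filter_upwards [hfst.eventually hK, hfst.eventually (hθ.filter_mono hle),
    hfst.eventually ((hL.eventually_isMaxOn M hτ).filter_mono hle),
    hfst.eventually (hsmall.filter_mono hle),
    hfst.eventually ((S.tendsto_n₀_inProb.eventually_gt_atTop 0).filter_mono hle),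
    hfst.eventually (((tendsto_order.1 hρ).2 2 one_lt_two).filter_mono hle),
    hfst.eventually ((Metric.tendsto_nhds.1 hρ (η / (2 * (‖J‖ + 1))) (by positivity)).filter_mono
      hle),
    hquad.filter_mono hleb, (hLb.eventually_isMaxOn M hτ).filter_mono hleb, hθs.filter_mono hleb]
    with x hKx hθx hmax hsm h3 h4 h5 hq hmaxs hθsx
  obtain ⟨h6, -⟩ := hmax _ hθx.1 hθx.2
  obtain ⟨-, h7⟩ := hmaxs _ hθsx.1 hθsx.2
  rw [← hJ] at h6 h7
  rw [← hG] at hq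
  set s := wScore f (designWeight (π x.1.1 x.1.2)) (A x.1.1 x.1.2) (Y x.1.1 x.1.2) θ₀
  set s' := wScore f (bootWeight (π x.1.1 x.1.2) x.2) (A x.1.1 x.1.2) (Y x.1.1 x.1.2) θ₀
  have hR : bootFluct (n₀ x.1.1) (π x.1.1 x.1.2) (A x.1.1 x.1.2)
      (fun i ↦ score f θ₀ (Y x.1.1 x.1.2 i)) x.2 = √(n₀ x.1.1) • (s' - s) := rfl
  have hclose : ‖θhat x.1.1 x.1.2 - θ₀‖ < δ := by
    refine lt_of_le_of_lt ?_ hsm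
    have e1 := norm_add_le (θhat x.1.1 x.1.2 - θ₀ - J s) (J s)
    rw [sub_add_cancel] at e1
    have e2 := J.le_opNorm s
    have e3 := mul_le_of_le_one_left (norm_nonneg s) hτ1
    linarith
  have h8 := (hq _ hclose).2
  rw [add_sub_cancel] at h8
  have hmain := abs_sub_sub_le_of_quadratic M.expInfo_mul_inv_apply M.inner_expInfo_comm hτ.le hτ1
    h8 h6 h7
  rw [← hG, ← hJ, ← hB] at hmain
  rw [hR]
  have key := abs_two_mul_sub_inner_le (J := J) (d := s' - s) (K := K) (ε := τ * B)
    (Nat.cast_nonneg _) h3 hη (by positivity) h4 h5 hmain hKx hτη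
  rw [Real.dist_eq, lrStat]
  refine le_trans (le_of_eq ?_) key
  congr 1
  ring

end LikelihoodRatio

/-! ### The bootstrap and the survey-weighted Wilks theorems -/

theorem theorem1 {p : ℕ} {𝒴 Ω : Type*} [MeasurableSpace 𝒴] [MeasurableSpace Ω]
    -- the superpopulation model
    (μ : Measure 𝒴) (f : EuclideanSpace ℝ (Fin p) → 𝒴 → ℝ)
    (Θ 𝓑 : Set (EuclideanSpace ℝ (Fin p))) (θ₀ : EuclideanSpace ℝ (Fin p))
    (hf_meas : Measurable (Function.uncurry f))
    (hf_pos : ∀ θ ∈ Θ, ∀ y, 0 < f θ y)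
    (hf_dens : ∀ θ ∈ Θ, ∫⁻ y, ENNReal.ofReal (f θ y) ∂μ = 1)
    (h𝓑 : IsCompact 𝓑) (h𝓑_conv : Convex ℝ 𝓑) (h𝓑Θ : 𝓑 ⊆ Θ) (hθ₀ : θ₀ ∈ interior 𝓑)
    (hident : ∀ θ ∈ 𝓑, θ ≠ θ₀ → ¬ (f θ =ᵐ[μ] f θ₀))
    -- the finite populations, the inclusion probabilities and the Poisson samples
    (P : Measure Ω) [IsProbabilityMeasure P]
    (N : ℕ → ℕ) (n₀ : ℕ → ℝ)
    (Y : (ν : ℕ) → Ω → Fin (N ν) → 𝒴) (π : (ν : ℕ) → Ω → Fin (N ν) → ℝ)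
    (A : (ν : ℕ) → Ω → Finset (Fin (N ν)))
    (hY_meas : ∀ ν, Measurable (Y ν)) (hπ_meas : ∀ ν, Measurable (π ν))
    (hY_iid : ∀ ν, P.map (Y ν) = Measure.pi fun _ ↦ modelLaw μ f θ₀)
    (hπ_prob : ∀ ν, ∀ᵐ ω ∂P, ∀ i, 0 < π ν ω i ∧ π ν ω i ≤ 1)
    (hA : ∀ ν, IsPoissonSample P (Y ν) (π ν) (A ν))
    -- smoothness
    (hsmooth : ∀ y, ∀ θ ∈ Θ, ContDiffAt ℝ 2 (fun t ↦ f t y) θ)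
    -- bounded sixth moments of the score
    (hmoment : ∃ C : ℝ≥0, ∀ θ ∈ 𝓑,
      ∫⁻ y, ‖score f θ y‖ₑ ^ 6 ∂(modelLaw μ f θ₀) ≤ C)
    -- scaled variance of the weighted score
    (SigmaS : EuclideanSpace ℝ (Fin p) → Matrix (Fin p) (Fin p) ℝ)
    (hSigma_pos : ∀ θ ∈ 𝓑, (SigmaS θ).PosDef)
    (hSigma : ∀ θ ∈ 𝓑, Tendsto (fun ν ↦ n₀ ν • covMat P fun ω ↦
      wScore f (designWeight (π ν ω)) (A ν ω) (Y ν ω) θ)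
      atTop (𝓝 (SigmaS θ)))
    -- convergence of the weighted information, integrable domination, nonsingular limit at `θ₀`
    (hinfo : ∀ θ ∈ 𝓑, ∀ a b, TendstoInMeasure P (fun ν ω ↦
      wInfo f (designWeight (π ν ω)) (A ν ω) (Y ν ω) θ a b)
      atTop (fun _ ↦ expInfo μ f θ₀ θ a b))
    (hdom : ∃ D : 𝒴 → ℝ, Integrable D (modelLaw μ f θ₀) ∧
      ∀ θ ∈ 𝓑, ∀ y a b, |info f θ y a b| ≤ D y)
    (hinfo_unit : IsUnit (expInfo μ f θ₀ θ₀).det)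
    -- central limit theorem for the standardized weighted score
    (hclt : TendstoInDistribution (fun ν ω ↦ Matrix.toEuclideanCLM (𝕜 := ℝ)
        (CFC.sqrt (covMat P fun ω' ↦ wScore f
          (designWeight (π ν ω')) (A ν ω') (Y ν ω') θ₀))⁻¹
        (wScore f
          (designWeight (π ν ω)) (A ν ω) (Y ν ω) θ₀))
      atTop (fun z ↦ z) (fun _ ↦ P) (stdGaussian (EuclideanSpace ℝ (Fin p))))
    -- asymptotic regime and inclusion probabilities of the Poisson sampling
    (hn₀ : Tendsto n₀ atTop atTop)
    (hn₀N : Tendsto (fun ν ↦ n₀ ν / N ν) atTop (𝓝 0))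
    (hn₀π : TendstoInMeasure P (fun ν ω ↦ (∑ i, π ν ω i) / n₀ ν) atTop (fun _ ↦ 1))
    (hπ_bdd : ∃ C₁ C₂ : ℝ, 0 < C₁ ∧ 0 < C₂ ∧ ∀ ν, ∀ᵐ ω ∂P, ∀ i,
      C₁ ≤ N ν * (n₀ ν)⁻¹ * π ν ω i ∧ N ν * (n₀ ν)⁻¹ * π ν ω i ≤ C₂)
    -- the pseudo maximum likelihood estimator
    (θhat : ℕ → Ω → EuclideanSpace ℝ (Fin p)) (hθhat_meas : ∀ ν, Measurable (θhat ν))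
    (hθhat : Tendsto (fun ν ↦ P {ω | ¬ (θhat ν ω ∈ 𝓑 ∧
      IsMaxOn (logLik f (designWeight (π ν ω)) (A ν ω) (Y ν ω))
        Θ (θhat ν ω))}) atTop (𝓝 0))
    -- the bootstrap estimator, a function of the data and of the bootstrap counts
    (θstar : (ν : ℕ) → Ω → (Fin (N ν) → ℕ) → EuclideanSpace ℝ (Fin p))
    (hθstar : TendstoInMeasure P (fun ν ω ↦
      (bootLaw (π ν ω) (A ν ω)).real {m | ¬ (θstar ν ω m ∈ 𝓑 ∧
        IsMaxOn (logLik f (bootWeight (π ν ω) m)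
          (A ν ω) (Y ν ω)) Θ (θstar ν ω m))}) atTop (fun _ ↦ 0)) :
    -- the coefficients are the eigenvalues of `Σ_θ 𝓘(θ₀)`, `Σ_θ = 𝓘(θ₀)⁻¹ Σ_S(θ₀) (𝓘(θ₀)⁻¹)ᵀ`
    ∃ c : Fin p → ℝ,
      ((expInfo μ f θ₀ θ₀)⁻¹ * SigmaS θ₀ *
          ((expInfo μ f θ₀ θ₀)⁻¹).transpose *
          expInfo μ f θ₀ θ₀).charpoly
        = ∏ i, (Polynomial.X - Polynomial.C (c i)) ∧
      -- the bootstrap law of `W*` given the sample converges weakly, in probability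
      (∀ g : ℝ →ᵇ ℝ, TendstoInMeasure P
        (fun ν ω ↦ ∫ m, g (lrStat f (bootWeight (π ν ω) m)
          (A ν ω) (Y ν ω) (θhat ν ω) (θstar ν ω m))
            ∂(bootLaw (π ν ω) (A ν ω)))
        atTop
        (fun _ ↦ ∫ z, g (∑ i, c i * z i ^ 2)
          ∂(Measure.pi fun _ : Fin p ↦ gaussianReal 0 1))) ∧
      -- the same limit law for the survey-weighted statistic `W(θ₀)`
      TendstoInDistribution
        (fun ν ω ↦ lrStat f (designWeight (π ν ω))
          (A ν ω) (Y ν ω) θ₀ (θhat ν ω))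
        atTop (fun z : Fin p → ℝ ↦ ∑ i, c i * z i ^ 2)
        (fun _ ↦ P) (Measure.pi fun _ : Fin p ↦ gaussianReal 0 1) := by
  obtain ⟨D, hDi, hD⟩ := hdom
  have M : IsRegularModel μ f Θ 𝓑 θ₀ D :=
    { meas := hf_meas, pos := hf_pos, dens := hf_dens, compact := h𝓑, convex := h𝓑_conv,
      subset := h𝓑Θ, mem_interior := hθ₀, ident := hident, smooth := hsmooth,
      moment := hmoment.imp fun C hC ↦ hC θ₀ (interior_subset hθ₀),
      integrable_dom := hDi, dom := hD, isUnit_det := hinfo_unit }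
  have S : IsSamplingScheme (modelLaw μ f θ₀) P N n₀ Y π A :=
    ⟨hY_meas, hπ_meas, hY_iid, hπ_prob, hA, hn₀, hn₀N, hn₀π, hπ_bdd⟩
  have := M.isProbabilityMeasure
  have hVs := hSigma_pos θ₀ M.mem_ball
  have hlim := hSigma θ₀ M.mem_ball
  have hnormal := tendsto_integral_of_standardized (fun ν ↦ S.measurable_wScore M ν)
    (S.eventually_covMat_posSemidef M) hVs hn₀ hlim hclt
  have hθ : ∀ᶠ x in inProb P, θhat x.1 x.2 ∈ 𝓑 ∧
      IsMaxOn (logLik f (designWeight (π x.1 x.2)) (A x.1 x.2) (Y x.1 x.2)) Θ (θhat x.1 x.2) :=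
    (eventually_probFilter (Q := fun x : Σ _ : ℕ, Ω ↦ θhat x.1 x.2 ∈ 𝓑 ∧ IsMaxOn
      (logLik f (designWeight (π x.1 x.2)) (A x.1 x.2) (Y x.1 x.2)) Θ (θhat x.1 x.2))).2 hθhat
  have hθs : ∀ᶠ x in probFilter (inProb P) fun z ↦ bootLaw (π z.1 z.2) (A z.1 z.2),
      θstar x.1.1 x.1.2 x.2 ∈ 𝓑 ∧ IsMaxOn (logLik f (bootWeight (π x.1.1 x.1.2) x.2)
        (A x.1.1 x.1.2) (Y x.1.1 x.1.2)) Θ (θstar x.1.1 x.1.2 x.2) := by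
    refine (eventually_probFilter (Q := fun x : Σ z : (Σ _ : ℕ, Ω), (Fin (N z.1) → ℕ) ↦
      θstar x.1.1 x.1.2 x.2 ∈ 𝓑 ∧ IsMaxOn (logLik f (bootWeight (π x.1.1 x.1.2) x.2)
        (A x.1.1 x.1.2) (Y x.1.1 x.1.2)) Θ (θstar x.1.1 x.1.2 x.2))).2 ?_
    have h := tendsto_probFilter_iff_tendstoInMeasure (X := fun ν ω ↦
      (bootLaw (π ν ω) (A ν ω)).real {m | ¬ (θstar ν ω m ∈ 𝓑 ∧
        IsMaxOn (logLik f (bootWeight (π ν ω) m) (A ν ω) (Y ν ω)) Θ (θstar ν ω m))}).2 hθstar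
    rw [← ENNReal.toReal_zero] at h
    exact (ENNReal.tendsto_toReal_iff (fun x ↦ measure_ne_top _ _) ENNReal.zero_ne_top).1 h
  obtain ⟨c, hc, hlaw⟩ := exists_eigenvalues_integral_eq M.expInfo_posDef hVs
  refine ⟨c, hc, fun g ↦ ?_, ?_⟩
  · rw [← hlaw]
    exact tendsto_probFilter_iff_tendstoInMeasure (X := fun ν ω ↦ ∫ m, g (lrStat f
      (bootWeight (π ν ω) m) (A ν ω) (Y ν ω) (θhat ν ω) (θstar ν ω m)) ∂(bootLaw (π ν ω) (A ν ω))).1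
      (tendsto_integral_bootstrap_lrStat S M hVs hlim hnormal hθ hθs g)
  · have hmeas := measurable_lrStat S M hθhat_meas
    have hqm : Measurable fun z : Fin p → ℝ ↦ ∑ i, c i * z i ^ 2 := by fun_prop
    refine ⟨fun ν ↦ (hmeas ν).aemeasurable, hqm.aemeasurable, ?_⟩
    refine ProbabilityMeasure.tendsto_iff_forall_integral_tendsto.2 fun g ↦ ?_
    have h := tendsto_integral_lrStat S M hnormal hθhat_meas hθ g
    rw [hlaw] at h
    have hg : Measurable g := g.continuous.measurable
    simp only [ProbabilityMeasure.coe_mk]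
    rw [integral_map hqm.aemeasurable hg.aestronglyMeasurable]
    exact h.congr fun ν ↦ (integral_map (hmeas ν).aemeasurable hg.aestronglyMeasurable).symm
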